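/- Let $k\ge 1$ be an integer. There is an integer $m=m(k)$ such that the following holds for all $\beta>0$, $\sigma\ge k+1$, $C_0>0$ and all functions $b,f\in C^m[0,1]$ with $b\ge\beta^2$ on $[0,1]$. For $0<\varepsilon\le 1$ let $u\in C^2[0,1]$ solve $-\varepsilon u''+bu=f$ in $(0,1)$, $u(0)=u(1)=0$, and put $q=\varepsilon u'$. Let $N\ge 4$ be a multiple of $4$ with $\varepsilon\le C_0N^{-1}$ and $\tau=\sigma\sqrt{\varepsilon}\,\ln N/\beta\le\frac14$. The Shishkin mesh $0=x_0<\dots<x_N=1$ divides $[0,\tau]$ and $[1-\tau,1]$ into $N/4$ equal cells each and $[\tau,1-\tau]$ into $N/2$ equal cells. Put $I_i=(x_{i-1},x_i)$, and let $V_N$ be the space of functions that are polynomials of degree at most $k$ on each $I_i$. Write $v_i^\pm=\lim_{x\to x_i^\pm}v(x)$, $[[v]]_i=v_i^--v_i^+$ for $1\le i\le N-1$, $[[v]]_0=-v_0^+$, $[[v]]_N=v_N^-$. Let $(Q,U)\in V_N\times V_N$ be the solution of the LDG scheme: for all $r,v\in V_N$ and $1\le i\le N$, $$\varepsilon^{-1}\langle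 Q,r\rangle_{I_i}+\langle U,r'\rangle_{I_i}-\widehat U_i r_i^-+\widehat U_{i-1}r_{i-1}^+=0,$$ $$\langle Q,v'\rangle_{I_i}+\langle bU,v\rangle_{I_i}-\widehat Q_i v_i^-+\widehat Q_{i-1}v_{i-1}^+=\langle f,v\rangle_{I_i},$$ where $\langle\cdot,\cdot\rangle_{I_i}$ is the inner product of $L^2(I_i)$ and the fluxes are $\widehat Q_0=Q_0^++\varepsilon^{1/2}U_0^+$, $\widehat Q_i=Q_i^+$ for $1\le i\le N-1$, $\widehat Q_N=Q_N^--\varepsilon^{1/2}U_N^-$; $\widehat U_0=\widehat U_N=0$, $\widehat U_{3N/4}=U_{3N/4}^--\varepsilon^{-1/2}[[Q]]_{3N/4}$, and $\widehat U_i=U_i^-$ for all other $i$. For a pair $w=(p,z)$ set, with $\|\cdot\|$ the norm of $L^2(0,1)$, $$|||w|||_E^2=\varepsilon^{-1}\|p\|^2+\|b^{1/2}z\|^2+\varepsilon^{1/2}\big([[z]]_0^2+[[z]]_N^2\big)+\varepsilon^{-1/2}[[p]]_{3N/4}^2,$$ $$|||w|||_B^2=\varepsilon^{-3/2}\|p\|^2+\|b^{1/2}z\|^2+[[z]]_0^2+[[z]]_N^2+\varepsilon^{-1}[[p]]_{3N/4}^2.$$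 Then the error $e=(q-Q,u-U)$ satisfies $$|||e|||_E\le C\left(\varepsilon^{1/4}(N^{-1}\ln N)^{k+1}+\varepsilon^{1/2}N^{-k}+N^{-(k+1)}\right),$$ $$|||e|||_B\le C\left((N^{-1}\ln N)^{k+1}+\varepsilon^{1/4}N^{-k}\right),$$ with a constant $C>0$ that may depend on $k,\beta,\sigma,C_0,b,f$ but not on $\varepsilon$ and $N$. -/

import Mathlib

open scoped Polynomial

noncomputable section

namespace LDG

/-- `u` is a classical solution in `C²[0,1]` of `-ε u'' + b u = f` in `(0,1)`, `u(0) = u(1) = 0`. -/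
structure IsSolution (ε : ℝ) (b f u : ℝ → ℝ) : Prop where
  contDiffOn : ContDiffOn ℝ 2 u (Set.Icc 0 1)
  equation : ∀ x ∈ Set.Ioo (0 : ℝ) 1,
    -ε * iteratedDerivWithin 2 u (Set.Icc 0 1) x + b x * u x = f x
  left_boundary : u 0 = 0
  right_boundary : u 1 = 0

/-- The exact flux `q = ε u'` on `[0,1]`. -/
def exactFlux (ε : ℝ) (u : ℝ → ℝ) : ℝ → ℝ :=
  fun x => ε * derivWithin u (Set.Icc 0 1) x

/-- The transition point `τ = σ √ε ln N / β`. -/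
def transitionPoint (β σ ε : ℝ) (N : ℕ) : ℝ :=
  σ * Real.sqrt ε * Real.log N / β

/-- The nodes `x_0, …, x_N` of the Shishkin mesh, for `N` divisible by 4. -/
def shishkinNode (β σ ε : ℝ) (N : ℕ) (i : ℕ) : ℝ :=
  if i ≤ N / 4 then
    4 * (σ * Real.sqrt ε / β) * ((i : ℝ) / N) * Real.log N
  else if i ≤ 3 * N / 4 then
    transitionPoint β σ ε N
      + 2 * (1 - 2 * transitionPoint β σ ε N) * ((i : ℝ) / N - 1 / 4)
  else
    1 - 4 * σ * Real.sqrt ε * Real.log N / β * (1 - (i : ℝ) / N)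

/-- The discontinuous space `V_N`: on each open cell `(x_i, x_{i+1})`, `i < N`, the function is a
polynomial of degree at most `k`. The values at the nodes are arbitrary. -/
def brokenPoly (k : ℕ) (x : ℕ → ℝ) (N : ℕ) : Set (ℝ → ℝ) :=
  {v | ∀ i < N, ∃ p : ℝ[X], p.natDegree ≤ k ∧
    ∀ y ∈ Set.Ioo (x i) (x (i + 1)), v y = p.eval y}

/-- The `L²` inner product on the cell `(x_i, x_{i+1})`. -/
def cellInner (x : ℕ → ℝ) (i : ℕ) (v w : ℝ → ℝ) : ℝ :=
  ∫ y in (x i)..(x (i + 1)), v y * w y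

/-- The square of the `L²` norm, as the sum over the cells. -/
def normSq (x : ℕ → ℝ) (N : ℕ) (v : ℝ → ℝ) : ℝ :=
  ∑ i ∈ Finset.range N, cellInner x i v v

/-- The trace `v_i⁻`. -/
def traceL (x : ℕ → ℝ) (v : ℝ → ℝ) (i : ℕ) : ℝ := Function.leftLim v (x i)

/-- The trace `v_i⁺`. -/
def traceR (x : ℕ → ℝ) (v : ℝ → ℝ) (i : ℕ) : ℝ := Function.rightLim v (x i)

/-- The jump: `v_i⁻ - v_i⁺` at interior nodes, `-v_0⁺` at `x_0`, and `v_N⁻` at `x_N`. -/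
def jump (x : ℕ → ℝ) (N : ℕ) (v : ℝ → ℝ) (i : ℕ) : ℝ :=
  if i = 0 then -traceR x v 0
  else if i = N then traceL x v N
  else traceL x v i - traceR x v i

/-- The numerical flux of `Q`, with `λ_0 = λ_N = ε^{1/2}`. -/
def fluxQ (ε : ℝ) (x : ℕ → ℝ) (N : ℕ) (Q U : ℝ → ℝ) (i : ℕ) : ℝ :=
  if i = 0 then traceR x Q 0 + Real.sqrt ε * traceR x U 0
  else if i = N then traceL x Q N - Real.sqrt ε * traceL x U N
  else traceR x Q i

/-- The numerical flux of `U`, with the additional jump term at the node `3N/4`,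
`λ_q = ε^{-1/2}`. -/
def fluxU (ε : ℝ) (x : ℕ → ℝ) (N : ℕ) (Q U : ℝ → ℝ) (i : ℕ) : ℝ :=
  if i = 0 ∨ i = N then 0
  else if i = 3 * N / 4 then traceL x U i - (Real.sqrt ε)⁻¹ * jump x N Q i
  else traceL x U i

/-- `(Q, U) ∈ V_N × V_N` solves the LDG scheme: both equations hold on every cell, for all
test functions in `V_N × V_N`. -/
structure IsLDGSolution (k : ℕ) (ε : ℝ) (b f : ℝ → ℝ) (x : ℕ → ℝ) (N : ℕ)
    (Q U : ℝ → ℝ) : Prop where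
  memQ : Q ∈ brokenPoly k x N
  memU : U ∈ brokenPoly k x N
  eqQ : ∀ r ∈ brokenPoly k x N, ∀ i < N,
    ε⁻¹ * cellInner x i Q r + cellInner x i U (deriv r)
      - fluxU ε x N Q U (i + 1) * traceL x r (i + 1)
      + fluxU ε x N Q U i * traceR x r i = 0
  eqU : ∀ v ∈ brokenPoly k x N, ∀ i < N,
    cellInner x i Q (deriv v) + cellInner x i (fun y => b y * U y) v
      - fluxQ ε x N Q U (i + 1) * traceL x v (i + 1)
      + fluxQ ε x N Q U i * traceR x v i = cellInner x i f v

/-- The energy norm of a pair `(q, u)`. -/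
def energyNorm (ε : ℝ) (b : ℝ → ℝ) (x : ℕ → ℝ) (N : ℕ) (q u : ℝ → ℝ) : ℝ :=
  Real.sqrt (ε⁻¹ * normSq x N q + normSq x N (fun y => Real.sqrt (b y) * u y)
    + Real.sqrt ε * ((jump x N u 0) ^ 2 + (jump x N u N) ^ 2)
    + (Real.sqrt ε)⁻¹ * (jump x N q (3 * N / 4)) ^ 2)

/-- The balanced norm of a pair `(q, u)`. -/
def balancedNorm (ε : ℝ) (b : ℝ → ℝ) (x : ℕ → ℝ) (N : ℕ) (q u : ℝ → ℝ) : ℝ :=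
  Real.sqrt (ε ^ (-(3 / 2) : ℝ) * normSq x N q + normSq x N (fun y => Real.sqrt (b y) * u y)
    + ((jump x N u 0) ^ 2 + (jump x N u N) ^ 2)
    + ε⁻¹ * (jump x N q (3 * N / 4)) ^ 2)

end LDG

end

namespace LDG
open Set

/-! Write e = √ε, Λ = (N⁻¹ ln N)^(k+1), R = N^(-k), M = N^(-(k+1)) and T = eΛ² + e²R². Every squared
contribution to the energy norm of the error is bounded by a multiple of T, except the weighted L²
norm of u - U, where M² is added. The balanced norm divides the other contributions by e, and T/e =
Λ² + eR² is its rate squared up to constants, so one energy estimate yields both bounds.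

The solution is not projected directly. `exists_layer_adapted` replaces it by w = S + χ(u - S). Here
S is an outer expansion with defect O(ε^(k+2)) (`exists_outer_expansion`), and χ cuts off the layers
before they reach the coarse mesh. The maximum principle bounds u - S by the two exponential layers
and a small constant (`abs_le_barrier`), and the differential equation carries this over to
derivatives (`exists_iteratedDeriv_le_layer`). As σ ≥ k+1 and ε ≤ C₀/N, the discarded part has
squared L² norm O(eM²), and so has the source G by which f differs from the operator applied to w.

The rest is a Galerkin argument. Tested with itself, the scheme gives exactly the squared energy
norm (`sum_form_self`), and it is consistent (`formQ_exact`, `formU_exact`). So for piecewise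
polynomial approximants (P, Z) of (εw', w), the discrete error (Q - P, U - Z) solves the scheme with
data (εw' - P, w - Z) and source G. The approximants are chosen to annihilate as much as possible. P
is the Radau projection interpolating at left ends: the volume terms against derivatives and the
interior fluxes of the first component vanish. On fine cells Z is the Radau projection interpolating
at right ends, with the same effect for the second component. On coarse cells Z is the b-weighted L²
projection, which removes the reaction term; that term would contribute M² without a power of e.

On coarse cells the traces of w - Z and its pairing with derivatives of test functions remain.
Inverse inequalities on cells of width about 1/N bound them by e²N²M² = e²R² (`residual_cell_le`).
At the node 3N/4 a coarse cell meets a fine cell on its right, where an inverse inequality would be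
too expensive. There the flux multiplies only the jump of the test function, and the penalty
controls this jump at cost eM² (`discrete_estimate`). On fine cells the local errors carry the
factor e + layer, whose square sums to O(e) (`sum_fine_sq_le`); this gives the factor e in eΛ². -/

/-! ### Extension from the unit interval and regularity of the solution -/

theorem le_on_Icc_of_Ioo {F G : ℝ → ℝ} (hF : Continuous F) (hG : Continuous G)
    (h : ∀ x ∈ Ioo (0 : ℝ) 1, F x ≤ G x) : ∀ x ∈ Icc (0 : ℝ) 1, F x ≤ G x := by
  intro x hx
  rw [← closure_Ioo (zero_ne_one' ℝ)] at hx
  exact le_on_closure h hF.continuousOn hG.continuousOn hx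

theorem eq_on_Icc_of_Ioo {F G : ℝ → ℝ} (hF : Continuous F) (hG : Continuous G)
    (h : ∀ x ∈ Ioo (0 : ℝ) 1, F x = G x) : ∀ x ∈ Icc (0 : ℝ) 1, F x = G x := fun x hx =>
  le_antisymm (le_on_Icc_of_Ioo hF hG (fun y hy => (h y hy).le) x hx)
    (le_on_Icc_of_Ioo hG hF (fun y hy => (h y hy).ge) x hx)

theorem contDiff_succ_of_deriv {n : ℕ} {F g : ℝ → ℝ} (hF : ∀ x, HasDerivAt F (g x) x)
    (hg : ContDiff ℝ n g) : ContDiff ℝ (n + 1 : ℕ) F := by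
  push_cast
  rw [contDiff_succ_iff_deriv]
  refine ⟨fun x => (hF x).differentiableAt, by simp, ?_⟩
  have : deriv F = g := funext fun x => (hF x).deriv
  rwa [this]

theorem ContDiff.deriv_nat {n : ℕ} {F : ℝ → ℝ} (hF : ContDiff ℝ (n + 1 : ℕ) F) :
    ContDiff ℝ n (deriv F) := by
  push_cast at hF
  exact (contDiff_succ_iff_deriv.1 hF).2.2

theorem ContDiff.hasDerivAt_nat {n : ℕ} {F : ℝ → ℝ} (hF : ContDiff ℝ (n + 1 : ℕ) F) (x : ℝ) :
    HasDerivAt F (deriv F x) x :=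
  ((hF.differentiable (by simp)) x).hasDerivAt

/-- A function on `[0,1]` whose derivative is given by a `C^n` function on the line has a
`C^(n+1)` extension. -/
theorem exists_extension_of_hasDerivAt {n : ℕ} {v g : ℝ → ℝ} (hv : ContinuousOn v (Icc 0 1))
    (hg : ContDiff ℝ n g) (hd : ∀ x ∈ Ioo (0 : ℝ) 1, HasDerivAt v (g x) x) :
    ∃ F : ℝ → ℝ, ContDiff ℝ (n + 1 : ℕ) F ∧ (∀ x, HasDerivAt F (g x) x) ∧
      ∀ x ∈ Icc (0 : ℝ) 1, F x = v x := by
  have hF : ∀ x, HasDerivAt (fun x => v 0 + ∫ t in (0 : ℝ)..x, g t) (g x) x := fun x =>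
    (hg.continuous.integral_hasStrictDerivAt 0 x).hasDerivAt.const_add _
  refine ⟨_, contDiff_succ_of_deriv hF hg, hF, fun x hx => ?_⟩
  have := intervalIntegral.integral_eq_sub_of_hasDerivAt_of_le hx.1
    (hv.mono (Icc_subset_Icc_right hx.2))
    (fun y hy => hd y ⟨hy.1, hy.2.trans_le hx.2⟩) (hg.continuous.intervalIntegrable _ _)
  simp only [this]; ring

/-- Induction by integrating an extension of the derivative, so that only continuous functions have
to be extended by hand, namely by constants. With extensions, ordinary derivatives on the line can
be used throughout. -/
theorem exists_contDiff_extension (n : ℕ) : ∀ f : ℝ → ℝ, ContDiffOn ℝ n f (Icc 0 1) →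
    ∃ F : ℝ → ℝ, ContDiff ℝ n F ∧ ∀ x ∈ Icc (0 : ℝ) 1, F x = f x := by
  induction n with
  | zero =>
    intro f hf
    refine ⟨IccExtend zero_le_one ((Icc (0 : ℝ) 1).domRestrict f), ?_, fun x hx => ?_⟩
    · rw [Nat.cast_zero, contDiff_zero]
      exact (continuousOn_iff_continuous_domRestrict.1 hf.continuousOn).Icc_extend'
    · rw [IccExtend_of_mem _ _ hx]; rfl
  | succ n ih =>
    intro f hf
    have hu := uniqueDiffOn_Icc (zero_lt_one' ℝ)
    have h1 := hf
    push_cast at h1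
    obtain ⟨hd, -, hn⟩ := (contDiffOn_succ_iff_derivWithin hu).1 h1
    obtain ⟨G, hG, hGe⟩ := ih _ hn
    obtain ⟨F, hF, -, hFe⟩ := exists_extension_of_hasDerivAt (g := G) hf.continuousOn hG
      (fun x hx => by
        rw [hGe x (Ioo_subset_Icc_self hx)]
        exact (hd x (Ioo_subset_Icc_self hx)).hasDerivWithinAt.hasDerivAt (Icc_mem_nhds hx.1 hx.2))
    exact ⟨F, hF, hFe⟩

theorem iteratedDeriv_two (v : ℝ → ℝ) : iteratedDeriv 2 v = deriv (deriv v) := by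
  rw [iteratedDeriv_succ, iteratedDeriv_one]

/-- The equation, on the closed interval, for an extension of a solution. -/
theorem IsSolution.equation_extension {ε : ℝ} {b f u v : ℝ → ℝ} {n : ℕ} (hb : Continuous b)
    (hf : Continuous f) (hu : IsSolution ε b f u) (hv : ContDiff ℝ (n + 2 : ℕ) v)
    (hvu : ∀ x ∈ Icc (0 : ℝ) 1, v x = u x) :
    ∀ x ∈ Icc (0 : ℝ) 1, -ε * deriv (deriv v) x + b x * v x = f x := by
  have h2 : ContDiff ℝ 2 v := hv.of_le (by norm_cast; omega)
  have hc : Continuous (deriv (deriv v)) := by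
    rw [← iteratedDeriv_two]; exact h2.continuous_iteratedDeriv 2 le_rfl
  refine eq_on_Icc_of_Ioo (((continuous_const.mul hc)).add (hb.mul h2.continuous)) hf
    fun x hx => ?_
  have hx' := Ioo_subset_Icc_self hx
  have := hu.equation x hx
  rw [← hvu x hx', ← iteratedDerivWithin_congr (fun y hy => hvu y hy) hx',
    iteratedDerivWithin_eq_iteratedDeriv (uniqueDiffOn_Icc (zero_lt_one' ℝ)) h2.contDiffAt hx',
    iteratedDeriv_two] at this
  exact this

/-- Bootstrapping: the equation expresses `u''` through `b u - f`, and integrating twice gains a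
derivative per pass until the smoothness of the data is exhausted. Each pass builds a new extension;
only the values on `[0,1]` persist. -/
theorem IsSolution.exists_contDiff {ε : ℝ} (hε : 0 < ε) {b f u : ℝ → ℝ} {n : ℕ}
    (hb : ContDiff ℝ n b) (hf : ContDiff ℝ n f) (hu : IsSolution ε b f u) :
    ∃ v : ℝ → ℝ, ContDiff ℝ (n + 2 : ℕ) v ∧ (∀ x ∈ Icc (0 : ℝ) 1, v x = u x) ∧
      (∀ x ∈ Icc (0 : ℝ) 1, -ε * deriv (deriv v) x + b x * v x = f x) := by
  have key : ∀ j ≤ n, ∃ v : ℝ → ℝ, ContDiff ℝ (j + 2 : ℕ) v ∧ ∀ x ∈ Icc (0 : ℝ) 1, v x = u x := by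
    intro j
    induction j with
    | zero => exact fun _ => exists_contDiff_extension 2 u hu.contDiffOn
    | succ j ih =>
      intro hj
      obtain ⟨v, hv, hvu⟩ := ih (by omega)
      have heq := hu.equation_extension hb.continuous hf.continuous hv hvu
      have hh : ContDiff ℝ (j + 1 : ℕ) (fun x => ε⁻¹ * (b x * v x - f x)) :=
        contDiff_const.mul (((hb.of_le (by norm_cast)).mul (hv.of_le (by norm_cast; omega))).sub
          (hf.of_le (by norm_cast)))
      have hv' : ContDiff ℝ (j + 1 : ℕ) (deriv v) := ContDiff.deriv_nat hv
      obtain ⟨v1, hv1, -, hv1e⟩ := exists_extension_of_hasDerivAt hv'.continuous.continuousOn hh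
        (fun x hx => by
          have h1 := ContDiff.hasDerivAt_nat hv' x
          have h2 := heq x (Ioo_subset_Icc_self hx)
          convert h1 using 1
          rw [← h2]; field_simp; ring)
      obtain ⟨v2, hv2, -, hv2e⟩ := exists_extension_of_hasDerivAt hv.continuous.continuousOn hv1
        (fun x hx => by
          rw [hv1e x (Ioo_subset_Icc_self hx)]
          exact ContDiff.hasDerivAt_nat (n := j + 1) hv x)
      exact ⟨v2, hv2, fun x hx => (hv2e x hx).trans (hvu x hx)⟩
  obtain ⟨v, hv, hvu⟩ := key n le_rfl
  exact ⟨v, hv, hvu, hu.equation_extension hb.continuous hf.continuous hv hvu⟩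

/-! ### Outer expansion with bounds uniform in ε -/

theorem exists_bound_iteratedDeriv {n : ℕ} {g : ℝ → ℝ} (hg : ContDiff ℝ n g) :
    ∃ C : ℝ, 0 < C ∧ ∀ j ≤ n, ∀ x ∈ Icc (0 : ℝ) 1, |iteratedDeriv j g x| ≤ C := by
  have : ∀ j : ℕ, ∃ C : ℝ, 0 < C ∧ (j ≤ n → ∀ x ∈ Icc (0 : ℝ) 1, |iteratedDeriv j g x| ≤ C) := by
    intro j
    by_cases hj : j ≤ n
    · obtain ⟨C, hC⟩ := isCompact_Icc.exists_bound_of_continuousOn (s := Icc (0 : ℝ) 1)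
        (hg.continuous_iteratedDeriv j (by exact_mod_cast hj)).continuousOn
      exact ⟨max C 1, by positivity, fun _ x hx => (hC x hx).trans (le_max_left _ _)⟩
    · exact ⟨1, one_pos, fun h => absurd h hj⟩
  choose C hC h using this
  refine ⟨∑ j ∈ Finset.range (n + 1), C j, Finset.sum_pos (fun j _ => hC j) (by simp),
    fun j hj x hx => (h j hj x hx).trans ?_⟩
  exact Finset.single_le_sum (f := C) (fun i _ => (hC i).le) (Finset.mem_range.2 (by omega))

/-- The truncated outer expansion: it solves the differential equation up to `O(ε^(n+1))`, with
all derivatives bounded uniformly in `ε`. -/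
theorem exists_outer_expansion {r : ℕ} {b : ℝ → ℝ} {β : ℝ} (hβ : 0 < β)
    (hbβ : ∀ x ∈ Icc (0 : ℝ) 1, β ^ 2 ≤ b x) (n : ℕ) :
    ContDiff ℝ (r + 2 * (n + 1) : ℕ) b → ∀ f : ℝ → ℝ, ContDiff ℝ (r + 2 * (n + 1) : ℕ) f →
    ∃ (g : ℝ → ℝ) (C : ℝ), ContDiff ℝ r g ∧ 0 < C ∧ ∀ ε : ℝ, 0 < ε → ε ≤ 1 →
      ∃ S : ℝ → ℝ, ContDiff ℝ (r + 2 : ℕ) S ∧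
        (∀ x ∈ Icc (0 : ℝ) 1, -ε * deriv (deriv S) x + b x * S x = f x + ε ^ (n + 1) * g x) ∧
        ∀ j ≤ r + 2, ∀ x ∈ Icc (0 : ℝ) 1, |iteratedDeriv j S x| ≤ C := by
  have hpos : ∀ x ∈ Icc (0 : ℝ) 1, b x ≠ 0 := fun x hx =>
    ((pow_pos hβ 2).trans_le (hbβ x hx)).ne'
  have hdiv : ∀ (m : ℕ) (f : ℝ → ℝ), ContDiff ℝ m b → ContDiff ℝ m f →
      ∃ F : ℝ → ℝ, ContDiff ℝ m F ∧ ∀ x ∈ Icc (0 : ℝ) 1, b x * F x = f x := by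
    intro m f hb hf
    obtain ⟨F, hF, hFe⟩ := exists_contDiff_extension m (fun x => f x / b x)
      (hf.contDiffOn.div hb.contDiffOn hpos)
    exact ⟨F, hF, fun x hx => by rw [hFe x hx]; field_simp [hpos x hx]⟩
  induction n with
  | zero =>
    intro hb f hf
    obtain ⟨F, hF, hFe⟩ := hdiv _ f hb hf
    have hF' : ContDiff ℝ r (deriv (deriv F)) :=
      ContDiff.deriv_nat (ContDiff.deriv_nat (n := r + 1) hF)
    obtain ⟨C, hC, hCb⟩ := exists_bound_iteratedDeriv hF
    exact ⟨fun x => -deriv (deriv F) x, C, hF'.neg, hC, fun ε hε hε1 => ⟨F, hF, fun x hx => by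
      rw [hFe x hx]; ring, hCb⟩⟩
  | succ n ih =>
    intro hb f hf
    -- The leading term is `F = f / b`. Its defect `-ε F''` is compensated by `ε` times the
    -- expansion for the right-hand side `F''`: a power of `ε` is gained at the price of two
    -- derivatives.
    obtain ⟨F, hF, hFe⟩ := hdiv _ f hb hf
    have hF' : ContDiff ℝ (r + 2 * (n + 1) : ℕ) (deriv (deriv F)) :=
      ContDiff.deriv_nat (ContDiff.deriv_nat (n := r + 2 * (n + 1) + 1) hF)
    obtain ⟨g, C, hg, hC, hS⟩ := ih (hb.of_le (by norm_cast; omega)) _ hF'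
    obtain ⟨C', hC', hCb⟩ := exists_bound_iteratedDeriv
      (hF.of_le (show ((r + 2 : ℕ) : WithTop ℕ∞) ≤ _ by norm_cast; omega))
    refine ⟨g, C' + C, hg, by positivity, fun ε hε hε1 => ?_⟩
    obtain ⟨S, hS, hSe, hSb⟩ := hS ε hε hε1
    have hF2 : ContDiff ℝ (r + 2 : ℕ) F := hF.of_le (by norm_cast; omega)
    have hεS : ContDiff ℝ (r + 2 : ℕ) (fun x => ε * S x) := contDiff_const.mul hS
    have hder : ∀ j ≤ r + 2, ∀ x, iteratedDeriv j (fun x => F x + ε * S x) x =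
        iteratedDeriv j F x + ε * iteratedDeriv j S x := by
      intro j hj x
      have hj' : ((j : ℕ) : WithTop ℕ∞) ≤ (r + 2 : ℕ) := by exact_mod_cast hj
      rw [iteratedDeriv_fun_add (hF2.of_le hj').contDiffAt (hεS.of_le hj').contDiffAt,
        iteratedDeriv_const_mul _ (hS.of_le hj').contDiffAt]
    refine ⟨fun x => F x + ε * S x, hF2.add hεS, fun x hx => ?_, fun j hj x hx => ?_⟩
    · have h1 := hder 2 (by omega) x
      simp only [iteratedDeriv_two] at h1
      rw [h1]
      have h2 := hFe x hx
      have h3 := hSe x hx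
      linear_combination h2 + ε * h3
    · rw [hder j hj x]
      refine (abs_add_le _ _).trans (add_le_add (hCb j hj x hx) ?_)
      rw [abs_mul, abs_of_pos hε]
      exact (mul_le_of_le_one_left (abs_nonneg _) hε1).trans (hSb j hj x hx)

/-! ### Boundary layers: comparison principle and derivative bounds -/

/-- The sum of the two boundary layer functions, with `e = √ε`. -/
noncomputable def layer (β e x : ℝ) : ℝ := Real.exp (-(β * x / e)) + Real.exp (-(β * (1 - x) / e))

theorem layer_pos (β e x : ℝ) : 0 < layer β e x := by unfold layer; positivity

theorem continuous_layer (β e : ℝ) : Continuous (layer β e) := by unfold layer; fun_prop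

theorem layer_le_two {β e : ℝ} (hβ : 0 < β) (he : 0 < e) {x : ℝ} (hx : x ∈ Icc (0 : ℝ) 1) :
    layer β e x ≤ 2 := by
  have h1 : Real.exp (-(β * x / e)) ≤ 1 :=
    Real.exp_le_one_iff.2 (neg_nonpos.2 (div_nonneg (mul_nonneg hβ.le hx.1) he.le))
  have h2 : Real.exp (-(β * (1 - x) / e)) ≤ 1 :=
    Real.exp_le_one_iff.2 (neg_nonpos.2 (div_nonneg (mul_nonneg hβ.le (by linarith [hx.2])) he.le))
  unfold layer; linarith

/-- Each exponent changes by at most `β d / e`. Hence the layers vary by a bounded factor over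
lengths `O(e)`, in particular over a fine cell. -/
theorem layer_le_of_dist {β e d x y : ℝ} (hβ : 0 < β) (he : 0 < e) (h : |x - y| ≤ d) :
    layer β e x ≤ Real.exp (β * d / e) * layer β e y := by
  obtain ⟨h1, h2⟩ := abs_le.1 h
  unfold layer
  rw [mul_add, ← Real.exp_add, ← Real.exp_add]
  have : 0 < β / e := div_pos hβ he
  refine add_le_add (Real.exp_le_exp.2 ?_) (Real.exp_le_exp.2 ?_)
  · have : 0 ≤ β / e * (d - (y - x)) := mul_nonneg this.le (by linarith)
    have e1 : β / e * (d - (y - x)) = β * d / e + -(β * y / e) + (β * x / e) := by ring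
    linarith
  · have : 0 ≤ β / e * (d - (x - y)) := mul_nonneg this.le (by linarith)
    have e1 : β / e * (d - (x - y)) = β * d / e + -(β * (1 - y) / e) + (β * (1 - x) / e) := by ring
    linarith

/-- An interior minimum has nonnegative second derivative. -/
theorem deriv_deriv_nonneg_of_isLocalMin {φ : ℝ → ℝ} {x : ℝ} (hc : ContinuousAt φ x)
    (hmin : IsLocalMin φ x) : 0 ≤ deriv (deriv φ) x := by
  by_contra! h
  -- A negative second derivative would make the minimum a maximum as well, so the function would be
  -- locally constant and its second derivative zero.
  have hmax := isLocalMax_of_deriv_deriv_neg h hmin.deriv_eq_zero hc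
  have hconst : φ =ᶠ[nhds x] fun _ => φ x := by
    filter_upwards [hmin, hmax] with y h1 h2 using le_antisymm h2 h1
  have : deriv (deriv φ) x = 0 := by
    rw [← iteratedDeriv_two, hconst.iteratedDeriv_eq 2, iteratedDeriv_two]; simp
  linarith

/-- At an interior minimum with negative value, `-ε φ'' ≤ 0` and `b φ < 0`, against the sign of the
operator. -/
theorem nonneg_of_maximum_principle {ε : ℝ} (hε : 0 < ε) {b φ : ℝ → ℝ}
    (hb : ∀ x ∈ Icc (0 : ℝ) 1, 0 < b x) (hφ : Continuous φ) (h0 : 0 ≤ φ 0) (h1 : 0 ≤ φ 1)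
    (hop : ∀ x ∈ Icc (0 : ℝ) 1, 0 ≤ -ε * deriv (deriv φ) x + b x * φ x) :
    ∀ x ∈ Icc (0 : ℝ) 1, 0 ≤ φ x := by
  obtain ⟨x₀, hx₀, hmin⟩ := isCompact_Icc.exists_isMinOn (s := Icc (0 : ℝ) 1)
    (nonempty_Icc.2 zero_le_one) hφ.continuousOn
  suffices 0 ≤ φ x₀ from fun x hx => this.trans (hmin hx)
  by_contra! hneg
  have hl : 0 < x₀ := lt_of_le_of_ne hx₀.1 (by rintro rfl; linarith)
  have hr : x₀ < 1 := lt_of_le_of_ne hx₀.2 (by rintro rfl; linarith)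
  have h2 := deriv_deriv_nonneg_of_isLocalMin hφ.continuousAt
    (hmin.isLocalMin (Icc_mem_nhds hl hr))
  have h3 := hop x₀ hx₀
  nlinarith [mul_pos_of_neg_of_neg (neg_neg_of_pos (hb x₀ hx₀)) hneg, mul_nonneg hε.le h2]

theorem hasDerivAt_exp_layers (A B β e x : ℝ) :
    HasDerivAt (fun x => A * Real.exp (-(β * x / e)) + B * Real.exp (-(β * (1 - x) / e)))
      (-(β / e) * A * Real.exp (-(β * x / e)) + (β / e) * B * Real.exp (-(β * (1 - x) / e))) x := by
  have a1 : HasDerivAt (fun x : ℝ => -(β * x / e)) (-(β / e)) x := by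
    have h : (fun x : ℝ => -(β * x / e)) = fun x => (-(β / e)) * x := by funext; ring
    rw [h]; simpa using (hasDerivAt_id' x).const_mul (-(β / e))
  have a2 : HasDerivAt (fun x : ℝ => -(β * (1 - x) / e)) (β / e) x := by
    have h : (fun x : ℝ => -(β * (1 - x) / e)) = fun x => (β / e) * x - β / e := by
      funext; ring
    rw [h]; simpa using ((hasDerivAt_id' x).const_mul (β / e)).sub_const (β / e)
  have := (a1.exp.const_mul A).fun_add (a2.exp.const_mul B)
  exact this.congr_deriv (by ring)

theorem deriv_deriv_layer (β e x : ℝ) :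
    deriv (deriv (layer β e)) x = (β / e) ^ 2 * layer β e x := by
  have h1 : layer β e =
      fun x => 1 * Real.exp (-(β * x / e)) + 1 * Real.exp (-(β * (1 - x) / e)) := by
    funext x; simp [layer]
  have h2 : deriv (layer β e) = fun x => -(β / e) * 1 * Real.exp (-(β * x / e)) +
      (β / e) * 1 * Real.exp (-(β * (1 - x) / e)) :=
    funext fun x => by rw [h1]; exact (hasDerivAt_exp_layers 1 1 β e x).deriv
  rw [h2, (hasDerivAt_exp_layers _ _ β e x).deriv]
  unfold layer; ring


theorem contDiff_layer (β e : ℝ) {n : WithTop ℕ∞} : ContDiff ℝ n (layer β e) := by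
  unfold layer; fun_prop

theorem one_le_layer_zero (β e : ℝ) : 1 ≤ layer β e 0 := by
  unfold layer; simp; positivity

theorem one_le_layer_one (β e : ℝ) : 1 ≤ layer β e 1 := by
  unfold layer; simp; positivity

/-- Since `e² (β/e)² = β²`, the operator maps `layer` to `(b - β²) layer ≥ 0`, and it maps the
constant `D / β²` to at least `D`. At the endpoints `layer ≥ 1` dominates the boundary values, so
the maximum principle applies to the difference. -/
theorem le_barrier {β e A D : ℝ} (hβ : 0 < β) (he : 0 < e) (hA : 0 ≤ A) (hD : 0 ≤ D)
    {b R G : ℝ → ℝ} (hb : ∀ x ∈ Icc (0 : ℝ) 1, β ^ 2 ≤ b x) (hR : ContDiff ℝ 2 R)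
    (hop : ∀ x ∈ Icc (0 : ℝ) 1, -e ^ 2 * deriv (deriv R) x + b x * R x = G x)
    (h0 : R 0 ≤ A) (h1 : R 1 ≤ A) (hG : ∀ x ∈ Icc (0 : ℝ) 1, G x ≤ D) :
    ∀ x ∈ Icc (0 : ℝ) 1, R x ≤ A * layer β e x + D / β ^ 2 := by
  set φ : ℝ → ℝ := fun x => (A * layer β e x + D / β ^ 2) - R x with hφ
  have hβ2 : 0 < β ^ 2 := by positivity
  have hq : 0 ≤ D / β ^ 2 := by positivity
  have hdd : ∀ x, deriv (deriv φ) x = A * ((β / e) ^ 2 * layer β e x) - deriv (deriv R) x := by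
    intro x
    have hl : ContDiff ℝ 2 (fun x => A * layer β e x) := contDiff_const.mul (contDiff_layer β e)
    rw [← deriv_deriv_layer]
    simp only [← iteratedDeriv_two, hφ]
    rw [iteratedDeriv_fun_sub (hl.add contDiff_const).contDiffAt hR.contDiffAt,
      iteratedDeriv_fun_add hl.contDiffAt contDiff_const.contDiffAt,
      iteratedDeriv_const_mul _ (contDiff_layer β e).contDiffAt]
    simp [iteratedDeriv_const]
  have hφc : Continuous φ :=
    ((continuous_const.mul (continuous_layer β e)).add continuous_const).sub hR.continuous
  have := nonneg_of_maximum_principle (ε := e ^ 2) (by positivity) (b := b) (φ := φ)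
    (fun x hx => hβ2.trans_le (hb x hx)) hφc
    (by have := mul_le_mul_of_nonneg_left (one_le_layer_zero β e) hA; simp only [hφ]; linarith)
    (by have := mul_le_mul_of_nonneg_left (one_le_layer_one β e) hA; simp only [hφ]; linarith)
    (fun x hx => by
      rw [hdd]
      have h2 := hop x hx
      have h3 := hG x hx
      have h4 := hb x hx
      have h5 : D ≤ b x * (D / β ^ 2) := by
        calc D = β ^ 2 * (D / β ^ 2) := by field_simp
          _ ≤ _ := mul_le_mul_of_nonneg_right h4 hq
      have h6 : 0 ≤ (b x - β ^ 2) * (A * layer β e x) :=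
        mul_nonneg (by linarith) (mul_nonneg hA (layer_pos _ _ _).le)
      have h7 : e ^ 2 * (A * ((β / e) ^ 2 * layer β e x)) = β ^ 2 * (A * layer β e x) := by
        field_simp
      simp only [hφ]
      nlinarith)
  intro x hx
  have := this x hx
  simp only [hφ] at this; linarith

theorem abs_le_barrier {β e A D : ℝ} (hβ : 0 < β) (he : 0 < e) (hA : 0 ≤ A) (hD : 0 ≤ D)
    {b R G : ℝ → ℝ} (hb : ∀ x ∈ Icc (0 : ℝ) 1, β ^ 2 ≤ b x) (hR : ContDiff ℝ 2 R)
    (hop : ∀ x ∈ Icc (0 : ℝ) 1, -e ^ 2 * deriv (deriv R) x + b x * R x = G x)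
    (h0 : |R 0| ≤ A) (h1 : |R 1| ≤ A) (hG : ∀ x ∈ Icc (0 : ℝ) 1, |G x| ≤ D) :
    ∀ x ∈ Icc (0 : ℝ) 1, |R x| ≤ A * layer β e x + D / β ^ 2 := by
  intro x hx
  have p := le_barrier hβ he hA hD hb hR hop (le_of_abs_le h0) (le_of_abs_le h1)
    (fun x hx => le_of_abs_le (hG x hx)) x hx
  have hdd : deriv (deriv (fun x => -R x)) = fun x => -deriv (deriv R) x := by
    funext y; simp
  have q := le_barrier (R := fun x => -R x) (G := fun x => -G x) hβ he hA hD hb hR.neg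
    (fun x hx => by rw [hdd, ← hop x hx]; ring) (neg_le_of_abs_le h0 |> fun h => by linarith)
    (neg_le_of_abs_le h1 |> fun h => by linarith)
    (fun x hx => by linarith [neg_le_of_abs_le (hG x hx)]) x hx
  exact abs_le.2 ⟨by linarith, p⟩

/-- Derivative bounds `e^j |R^(j)| ≤ C (layer + δ)` for functions with
`e² R'' = b R + δ g` and `|R| ≤ A (layer + δ)`. -/
theorem exists_iteratedDeriv_le_layer {K : ℕ} {β A : ℝ} (hβ : 0 < β) (hA : 0 < A) {b g : ℝ → ℝ}
    (hb : ContDiff ℝ K b) (hg : ContDiff ℝ K g) :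
    ∃ C : ℝ, 0 < C ∧ ∀ (e δ : ℝ) (R : ℝ → ℝ), 0 < e → e ≤ 1 → 0 ≤ δ →
      ContDiff ℝ (K + 2 : ℕ) R →
      (∀ x ∈ Icc (0 : ℝ) 1, e ^ 2 * deriv (deriv R) x = b x * R x + δ * g x) →
      (∀ x ∈ Icc (0 : ℝ) 1, |R x| ≤ A * (layer β e x + δ)) →
      ∀ j ≤ K + 2, ∀ x ∈ Icc (0 : ℝ) 1,
        e ^ j * |iteratedDeriv j R x| ≤ C * (layer β e x + δ) := by
  obtain ⟨Cb, hCb, hbb⟩ := exists_bound_iteratedDeriv hb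
  obtain ⟨Cg, hCg, hgb⟩ := exists_bound_iteratedDeriv hg
  set P : ℕ → ℝ → Prop := fun j C => 0 < C ∧ ∀ (e δ : ℝ) (R : ℝ → ℝ), 0 < e → e ≤ 1 → 0 ≤ δ →
      ContDiff ℝ (K + 2 : ℕ) R →
      (∀ x ∈ Icc (0 : ℝ) 1, e ^ 2 * deriv (deriv R) x = b x * R x + δ * g x) →
      (∀ x ∈ Icc (0 : ℝ) 1, |R x| ≤ A * (layer β e x + δ)) → ∀ x ∈ Icc (0 : ℝ) 1,
        e ^ j * |iteratedDeriv j R x| ≤ C * (layer β e x + δ) with hP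
  have h0 : P 0 A := ⟨hA, fun e δ R he he1 hδ hR heq hRb x hx => by simpa using hRb x hx⟩
  -- Differentiating the equation `i` times by Leibniz' rule bounds order `i + 2` by the orders up
  -- to `i`; the factor `e²` supplies the weight. Orders zero and one therefore suffice.
  have hstep : ∀ i ≤ K, (∀ l ≤ i, ∃ C, P l C) → ∃ C, P (i + 2) C := by
    intro i hi ih
    choose! c hc using ih
    have hsum : 0 ≤ ∑ l ∈ Finset.range (i + 1), (i.choose l : ℝ) * Cb * c (i - l) :=
      Finset.sum_nonneg fun l _ => mul_nonneg (by positivity) (hc _ (by omega)).1.le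
    refine ⟨∑ l ∈ Finset.range (i + 1), (i.choose l : ℝ) * Cb * c (i - l) + Cg, by linarith,
      fun e δ R he he1 hδ hR heq hRb => ?_⟩
    have hiK : ((i : ℕ) : WithTop ℕ∞) ≤ (K : ℕ) := by exact_mod_cast hi
    have hiK2 : ((i : ℕ) : WithTop ℕ∞) ≤ (K + 2 : ℕ) := by exact_mod_cast (by omega)
    have hi2 : ((i + 2 : ℕ) : WithTop ℕ∞) ≤ (K + 2 : ℕ) := by exact_mod_cast (by omega)
    -- The equation holds on `[0,1]` only, so it is differentiated at interior points; the endpoints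
    -- follow by continuity.
    refine le_on_Icc_of_Ioo
      (continuous_const.mul (hR.continuous_iteratedDeriv _ hi2).abs)
      (continuous_const.mul ((continuous_layer β e).add continuous_const)) fun x hx => ?_
    have hx' := Ioo_subset_Icc_self hx
    have hW : 0 < layer β e x + δ := add_pos_of_pos_of_nonneg (layer_pos _ _ _) hδ
    have hloc : (fun y => e ^ 2 * deriv (deriv R) y) =ᶠ[nhds x]
        fun y => b y * R y + δ * g y := by
      filter_upwards [Icc_mem_nhds hx.1 hx.2] with y hy using heq y hy
    have hR2 : ContDiff ℝ K (deriv (deriv R)) := ContDiff.deriv_nat (ContDiff.deriv_nat hR)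
    have h1 := hloc.iteratedDeriv_eq i
    rw [iteratedDeriv_const_mul _ (hR2.of_le hiK).contDiffAt,
      iteratedDeriv_fun_add ((hb.of_le hiK).mul (hR.of_le hiK2)).contDiffAt
        (contDiff_const.mul (hg.of_le hiK)).contDiffAt,
      iteratedDeriv_const_mul _ (hg.of_le hiK).contDiffAt,
      iteratedDeriv_fun_mul (hb.of_le hiK).contDiffAt (hR.of_le hiK2).contDiffAt,
      ← iteratedDeriv_succ', ← iteratedDeriv_succ'] at h1
    have h2 : e ^ (i + 2) * |iteratedDeriv (i + 2) R x| =
        e ^ i * |e ^ 2 * iteratedDeriv (i + 1 + 1) R x| := by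
      rw [abs_mul, abs_of_pos (by positivity : 0 < e ^ 2)]; ring
    rw [h2, h1]
    have hei : e ^ i ≤ 1 := pow_le_one₀ he.le he1
    calc e ^ i * |∑ l ∈ Finset.range (i + 1),
            (i.choose l : ℝ) * iteratedDeriv l b x * iteratedDeriv (i - l) R x +
              δ * iteratedDeriv i g x|
        ≤ e ^ i * (∑ l ∈ Finset.range (i + 1),
            |(i.choose l : ℝ) * iteratedDeriv l b x * iteratedDeriv (i - l) R x| +
              |δ * iteratedDeriv i g x|) := by
          refine mul_le_mul_of_nonneg_left ((abs_add_le _ _).trans ?_) (by positivity)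
          gcongr; exact Finset.abs_sum_le_sum_abs _ _
      _ = ∑ l ∈ Finset.range (i + 1), e ^ i *
            |(i.choose l : ℝ) * iteratedDeriv l b x * iteratedDeriv (i - l) R x| +
              e ^ i * |δ * iteratedDeriv i g x| := by rw [mul_add, Finset.mul_sum]
      _ ≤ ∑ l ∈ Finset.range (i + 1), (i.choose l : ℝ) * Cb * c (i - l) * (layer β e x + δ) +
            Cg * (layer β e x + δ) := by
          refine add_le_add (Finset.sum_le_sum fun l hl => ?_) ?_
          · have hl' : l ≤ i := by have := Finset.mem_range.1 hl; omega
            have h3 := (hc (i - l) (by omega)).2 e δ R he he1 hδ hR heq hRb x hx'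
            have h4 := hbb l (hl'.trans hi) x hx'
            have h5 : e ^ i ≤ e ^ (i - l) := pow_le_pow_of_le_one he.le he1 (by omega)
            rw [abs_mul, abs_mul, Nat.abs_cast]
            calc e ^ i * ((i.choose l : ℝ) * |iteratedDeriv l b x| * |iteratedDeriv (i - l) R x|)
                ≤ e ^ (i - l) * ((i.choose l : ℝ) * Cb * |iteratedDeriv (i - l) R x|) := by gcongr
              _ = (i.choose l : ℝ) * Cb * (e ^ (i - l) * |iteratedDeriv (i - l) R x|) := by ring
              _ ≤ (i.choose l : ℝ) * Cb * (c (i - l) * (layer β e x + δ)) := by gcongr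
              _ = _ := by ring
          · rw [abs_mul, abs_of_nonneg hδ]
            calc e ^ i * (δ * |iteratedDeriv i g x|) ≤ 1 * (δ * Cg) := by
                  gcongr; exact hgb i hi x hx'
              _ ≤ Cg * (layer β e x + δ) := by
                  have := mul_pos hCg (layer_pos β e x); linarith
      _ = _ := by rw [← Finset.sum_mul, add_mul]
  -- Order one is interpolated between orders zero and two. On an interval of length `e / 2` the
  -- mean value theorem gives a point where `e |R'|` is controlled by `R`, and `R''` controls the
  -- change from there to `x`.
  have h1 : ∃ C, P 1 C := by
    obtain ⟨C2, hC2, h2⟩ := hstep 0 (Nat.zero_le _) (fun l hl => ⟨A, by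
      obtain rfl : l = 0 := by omega
      exact h0⟩)
    refine ⟨(4 * A + C2) * Real.exp (β * (1 / 2)), by positivity,
      fun e δ R he he1 hδ hR heq hRb x hx => ?_⟩
    have h2' := h2 e δ R he he1 hδ hR heq hRb
    simp only [zero_add, iteratedDeriv_two] at h2'
    rw [iteratedDeriv_one, pow_one]
    have hexp : 1 ≤ Real.exp (β * (1 / 2)) := Real.one_le_exp (by positivity)
    set κ := Real.exp (β * (1 / 2)) with hκ
    have hnear : ∀ y, |y - x| ≤ e / 2 → layer β e y + δ ≤ κ * (layer β e x + δ) := by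
      intro y hy
      have h := layer_le_of_dist hβ he hy
      have e1 : β * (e / 2) / e = β * (1 / 2) := by field_simp
      rw [e1, ← hκ] at h
      rw [mul_add]
      exact add_le_add h (le_mul_of_one_le_left hδ hexp)
    have hR1 : ContDiff ℝ (K + 1 : ℕ) (deriv R) := ContDiff.deriv_nat hR
    have hRd : ∀ y, HasDerivAt R (deriv R y) y := ContDiff.hasDerivAt_nat (n := K + 1) hR
    have hRdd : ∀ y, HasDerivAt (deriv R) (deriv (deriv R) y) y := ContDiff.hasDerivAt_nat hR1
    -- an adjacent interval of length `e / 2`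
    obtain ⟨s, t, hst, hs, ht, hxst⟩ : ∃ s t : ℝ, t - s = e / 2 ∧ 0 ≤ s ∧ t ≤ 1 ∧
        x ∈ Icc s t := by
      rcases le_total x (1 / 2) with h | h
      · exact ⟨x, x + e / 2, by ring, hx.1, by linarith, le_rfl, by linarith⟩
      · exact ⟨x - e / 2, x, by ring, by linarith, hx.2, by linarith, le_rfl⟩
    have hdist : ∀ y ∈ Icc s t, |y - x| ≤ e / 2 := fun y hy =>
      abs_le.2 ⟨by linarith [hy.1, hxst.2], by linarith [hy.2, hxst.1]⟩
    have hmem : ∀ y ∈ Icc s t, y ∈ Icc (0 : ℝ) 1 := fun y hy =>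
      ⟨hs.trans hy.1, hy.2.trans ht⟩
    have hlt : s < t := by linarith
    set W := layer β e x + δ with hW
    have hW0 : 0 < W := add_pos_of_pos_of_nonneg (layer_pos _ _ _) hδ
    obtain ⟨ξ, hξ, hξe⟩ := exists_deriv_eq_slope R hlt hR.continuous.continuousOn
      (fun y _ => (hRd y).differentiableAt.differentiableWithinAt)
    have hξ' := Ioo_subset_Icc_self hξ
    have hb1 : ∀ y ∈ Icc s t, |R y| ≤ A * (κ * W) := fun y hy =>
      (hRb y (hmem y hy)).trans (mul_le_mul_of_nonneg_left (hnear y (hdist y hy)) hA.le)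
    have hξb : e * |deriv R ξ| ≤ 4 * (A * (κ * W)) := by
      rw [hξe, hst, abs_div, abs_of_pos (by positivity : 0 < e / 2)]
      have h3 : |R t - R s| ≤ 2 * (A * (κ * W)) := by
        have := abs_sub (R t) (R s)
        have := hb1 t ⟨hlt.le, le_rfl⟩
        have := hb1 s ⟨le_rfl, hlt.le⟩
        linarith
      calc e * (|R t - R s| / (e / 2)) = 2 * |R t - R s| := by field_simp
        _ ≤ _ := by linarith
    have hb2 : ∀ y ∈ Icc s t, ‖deriv (deriv R) y‖ ≤ C2 * (κ * W) / e ^ 2 := by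
      intro y hy
      rw [le_div_iff₀ (by positivity), Real.norm_eq_abs, mul_comm]
      exact (h2' y (hmem y hy)).trans
        (mul_le_mul_of_nonneg_left (hnear y (hdist y hy)) hC2.le)
    have hmv := (convex_Icc s t).norm_image_sub_le_of_norm_hasDerivWithin_le
      (fun y _ => (hRdd y).hasDerivWithinAt) hb2 hξ' hxst
    rw [Real.norm_eq_abs, Real.norm_eq_abs] at hmv
    have h5 : |x - ξ| ≤ e / 2 := by rw [abs_sub_comm]; exact hdist ξ hξ'
    have h6 : e * |deriv R x - deriv R ξ| ≤ C2 * (κ * W) := by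
      calc e * |deriv R x - deriv R ξ| ≤ e * (C2 * (κ * W) / e ^ 2 * (e / 2)) := by gcongr; exact hmv.trans (by gcongr)
        _ = C2 * (κ * W) / 2 := by field_simp
        _ ≤ _ := by have : 0 ≤ C2 * (κ * W) := by positivity
                    linarith
    have h7 : |deriv R x| ≤ |deriv R x - deriv R ξ| + |deriv R ξ| := by
      have := abs_add_le (deriv R x - deriv R ξ) (deriv R ξ); simpa using this
    calc e * |deriv R x| ≤ e * |deriv R x - deriv R ξ| + e * |deriv R ξ| := by
          rw [← mul_add]; gcongr
      _ ≤ C2 * (κ * W) + 4 * (A * (κ * W)) := add_le_add h6 hξb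
      _ = _ := by ring
  have hall : ∀ j, j ≤ K + 2 → ∃ C, P j C := by
    intro j
    induction j using Nat.strong_induction_on with
    | _ j ih =>
      intro hj
      match j, ih, hj with
      | 0, _, _ => exact ⟨A, h0⟩
      | 1, _, _ => exact h1
      | j + 2, ih, hj => exact hstep j (by omega) fun l hl => ih l (by omega) (by omega)
  choose! c hc using hall
  refine ⟨∑ j ∈ Finset.range (K + 3), c j,
    Finset.sum_pos (fun j hj => (hc j (by have := Finset.mem_range.1 hj; omega)).1) (by simp),
    fun e δ R he he1 hδ hR heq hRb j hj x hx => ?_⟩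
  refine ((hc j hj).2 e δ R he he1 hδ hR heq hRb x hx).trans
    (mul_le_mul_of_nonneg_right ?_ (add_nonneg (layer_pos _ _ _).le hδ))
  exact Finset.single_le_sum (f := c)
    (fun i hi => (hc i (by have := Finset.mem_range.1 hi; omega)).1.le)
    (Finset.mem_range.2 (by omega))

/-! ### Cutoff functions -/

/-- Outside `[0,1]` the function is locally constant, so compactness of `[0,1]` gives a bound on the
whole line. -/
theorem exists_bound_smoothTransition (K : ℕ) :
    ∃ C : ℝ, 1 ≤ C ∧ ∀ j ≤ K, ∀ x : ℝ, |iteratedDeriv j Real.smoothTransition x| ≤ C := by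
  obtain ⟨C, hC, h⟩ := exists_bound_iteratedDeriv (n := K)
    (Real.smoothTransition.contDiff (n := (K : ℕ∞)))
  refine ⟨max C 1, le_max_right _ _, fun j hj x => ?_⟩
  have hconst : ∀ c : ℝ, |c| ≤ 1 → Real.smoothTransition =ᶠ[nhds x] (fun _ => c) →
      |iteratedDeriv j Real.smoothTransition x| ≤ max C 1 := by
    intro c hc he
    rw [he.iteratedDeriv_eq j, iteratedDeriv_const]
    split_ifs
    · exact hc.trans (le_max_right _ _)
    · simp
  rcases lt_or_ge x 0 with hx | hx
  · exact hconst 0 (by simp) (by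
      filter_upwards [Iio_mem_nhds hx] with y hy
        using Real.smoothTransition.zero_of_nonpos (le_of_lt hy))
  rcases lt_or_ge 1 x with hx1 | hx1
  · exact hconst 1 (by simp) (by
      filter_upwards [Ioi_mem_nhds hx1] with y hy
        using Real.smoothTransition.one_of_one_le (le_of_lt hy))
  exact (h j hj x ⟨hx, hx1⟩).trans (le_max_left _ _)

/-- A cutoff equal to `1` near `[0, τ - w] ∪ [1 - τ + w, 1]` and to `0` near `[τ, 1 - τ]`. -/
noncomputable def cutoff (τ w x : ℝ) : ℝ :=
  Real.smoothTransition (3 * τ / w - 1 - 3 / w * x) +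
    Real.smoothTransition (3 / w * x - (3 * (1 - τ) / w + 1))

theorem contDiff_smoothTransition_nat (n : ℕ) : ContDiff ℝ n Real.smoothTransition :=
  Real.smoothTransition.contDiff (n := (n : ℕ∞))

theorem contDiff_cutoff (τ w : ℝ) (n : ℕ) : ContDiff ℝ n (cutoff τ w) := by
  have := contDiff_smoothTransition_nat n
  unfold cutoff
  exact (this.comp (by fun_prop)).add (this.comp (by fun_prop))

/-- Each transition fills the middle third of an interval of length `w`, whence `3 / w` per
derivative. The outer thirds make the cutoff locally constant, not merely of the right value, at
both ends of that interval. -/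
theorem exists_bound_cutoff (K : ℕ) : ∃ C : ℝ, 1 ≤ C ∧ ∀ τ w : ℝ, 0 < w → ∀ j ≤ K, ∀ x : ℝ,
    |iteratedDeriv j (cutoff τ w) x| ≤ C * (3 / w) ^ j := by
  obtain ⟨C, hC, h⟩ := exists_bound_smoothTransition K
  refine ⟨2 * C, by linarith, fun τ w hw j hj x => ?_⟩
  have hθ := contDiff_smoothTransition_nat j
  have c1 : ContDiff ℝ j (fun y : ℝ => Real.smoothTransition (3 * τ / w - 1 - y)) :=
    hθ.comp (by fun_prop)
  have c2 : ContDiff ℝ j (fun y : ℝ => Real.smoothTransition (y - (3 * (1 - τ) / w + 1))) :=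
    hθ.comp (by fun_prop)
  have d1 := congrFun (iteratedDeriv_comp_const_mul c1 (3 / w)) x
  have d2 := congrFun (iteratedDeriv_comp_const_mul c2 (3 / w)) x
  rw [iteratedDeriv_comp_const_sub] at d1
  rw [iteratedDeriv_comp_sub_const] at d2
  have : iteratedDeriv j (cutoff τ w) x = _ := iteratedDeriv_fun_add
    ((c1.comp (by fun_prop : ContDiff ℝ j (fun x : ℝ => 3 / w * x))).contDiffAt (x := x))
    ((c2.comp (by fun_prop : ContDiff ℝ j (fun x : ℝ => 3 / w * x))).contDiffAt (x := x))
  rw [this]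
  rw [d1, d2]
  refine (abs_add_le _ _).trans ?_
  have hp : (0 : ℝ) ≤ (3 / w) ^ j := by positivity
  simp only [smul_eq_mul, abs_mul, abs_pow, abs_neg, abs_one, one_pow, one_mul,
    abs_of_pos (by positivity : 0 < 3 / w)]
  have h1 := mul_le_mul_of_nonneg_left (h j hj (3 * τ / w - 1 - 3 / w * x)) hp
  have h2 := mul_le_mul_of_nonneg_left (h j hj (3 / w * x - (3 * (1 - τ) / w + 1))) hp
  linarith

theorem cutoff_eventuallyEq_one_left {τ w x : ℝ} (hw : 0 < w) (hτ : τ ≤ 1 / 4)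
    (hx : x ≤ τ - w) : cutoff τ w =ᶠ[nhds x] fun _ => 1 := by
  filter_upwards [Iio_mem_nhds (show x < τ - 2 / 3 * w by linarith)] with y hy
  have hy : y < τ - 2 / 3 * w := hy
  have h1 : (1 : ℝ) ≤ 3 * τ / w - 1 - 3 / w * y := by
    have : 3 * τ / w - 1 - 3 / w * y - 1 = 3 / w * (τ - 2 / 3 * w - y) := by field_simp; ring
    have : 0 ≤ 3 / w * (τ - 2 / 3 * w - y) := mul_nonneg (by positivity) (by linarith)
    linarith
  have h2 : 3 / w * y - (3 * (1 - τ) / w + 1) ≤ 0 := by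
    have : 3 / w * y - (3 * (1 - τ) / w + 1) = -(3 / w * (1 - τ - y + w / 3)) := by
      field_simp; ring
    rw [this]
    exact neg_nonpos.2 (mul_nonneg (by positivity) (by linarith))
  simp [cutoff, Real.smoothTransition.one_of_one_le h1, Real.smoothTransition.zero_of_nonpos h2]

theorem cutoff_symm (τ w x : ℝ) : cutoff τ w (1 - x) = cutoff τ w x := by
  unfold cutoff
  rw [add_comm]
  congr 2 <;> ring

theorem cutoff_eventuallyEq_one_right {τ w x : ℝ} (hw : 0 < w) (hτ : τ ≤ 1 / 4)
    (hx : 1 - (τ - w) ≤ x) : cutoff τ w =ᶠ[nhds x] fun _ => 1 := by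
  have h := cutoff_eventuallyEq_one_left hw hτ (show 1 - x ≤ τ - w by linarith)
  have ht : Filter.Tendsto (fun y : ℝ => 1 - y) (nhds x) (nhds (1 - x)) :=
    (continuous_const.sub continuous_id).tendsto x
  filter_upwards [ht.eventually h] with y hy
  rw [← cutoff_symm]; exact hy

theorem cutoff_eventuallyEq_zero {τ w x : ℝ} (hw : 0 < w)
    (hx : x ∈ Icc τ (1 - τ)) : cutoff τ w =ᶠ[nhds x] fun _ => 0 := by
  filter_upwards [Ioo_mem_nhds (show τ - w / 3 < x by linarith [hx.1])
    (show x < 1 - τ + w / 3 by linarith [hx.2])] with y hy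
  have h1 : 3 * τ / w - 1 - 3 / w * y ≤ 0 := by
    have : 3 * τ / w - 1 - 3 / w * y = -(3 / w * (y - (τ - w / 3))) := by field_simp; ring
    rw [this]
    exact neg_nonpos.2 (mul_nonneg (by positivity) (by linarith [hy.1]))
  have h2 : 3 / w * y - (3 * (1 - τ) / w + 1) ≤ 0 := by
    have : 3 / w * y - (3 * (1 - τ) / w + 1) = -(3 / w * (1 - τ + w / 3 - y)) := by
      field_simp; ring
    rw [this]
    exact neg_nonpos.2 (mul_nonneg (by positivity) (by linarith [hy.2]))
  simp [cutoff, Real.smoothTransition.zero_of_nonpos h1, Real.smoothTransition.zero_of_nonpos h2]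


/-! ### L² size of the layer tails -/

theorem integral_exp_le {c : ℝ} (hc : 0 < c) (a d : ℝ) :
    ∫ x in a..d, Real.exp (-(c * x)) ≤ Real.exp (-(c * a)) / c := by
  have h : ∀ x, HasDerivAt (fun x => -(Real.exp (-(c * x)) / c)) (Real.exp (-(c * x))) x := by
    intro x
    have a1 : HasDerivAt (fun x : ℝ => -(c * x)) (-c) x := by
      have h : (fun x : ℝ => -(c * x)) = fun x => (-c) * x := by funext; ring
      rw [h]; simpa using (hasDerivAt_id' x).const_mul (-c)
    exact ((a1.exp.div_const c).fun_neg).congr_deriv (by field_simp)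
  rw [intervalIntegral.integral_eq_sub_of_hasDerivAt (fun x _ => h x)
    ((by fun_prop : Continuous fun x => Real.exp (-(c * x))).intervalIntegrable _ _)]
  have : 0 ≤ Real.exp (-(c * d)) / c := by positivity
  linarith

/-- The cross term is absorbed by `(p + q)² ≤ 2p² + 2q²`, and the reflection `x ↦ 1 - x` exchanges
the two squares. -/
theorem integral_layer_sq_le {β e a : ℝ} (hβ : 0 < β) (he : 0 < e) (ha : a ≤ 1 / 2) :
    ∫ x in a..(1 - a), layer β e x ^ 2 ≤ 2 * e / β * Real.exp (-(2 * β / e * a)) := by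
  have hc : 0 < 2 * β / e := by positivity
  have i1 : Continuous fun x => Real.exp (-(2 * β / e * x)) := by fun_prop
  have i2 : Continuous fun x => Real.exp (-(2 * β / e * (1 - x))) := by fun_prop
  have h2 : ∫ x in a..(1 - a), Real.exp (-(2 * β / e * (1 - x))) =
      ∫ x in a..(1 - a), Real.exp (-(2 * β / e * x)) := by
    have := intervalIntegral.integral_comp_sub_left
      (fun x => Real.exp (-(2 * β / e * x))) (1 : ℝ) (a := a) (b := 1 - a)
    simpa using this
  have h1 := integral_exp_le hc a (1 - a)
  calc ∫ x in a..(1 - a), layer β e x ^ 2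
      ≤ ∫ x in a..(1 - a), (2 * Real.exp (-(2 * β / e * x)) +
          2 * Real.exp (-(2 * β / e * (1 - x)))) := by
        refine intervalIntegral.integral_mono_on (by linarith)
          (((continuous_layer β e).pow 2).intervalIntegrable _ _)
          (((continuous_const.mul i1).add (continuous_const.mul i2)).intervalIntegrable _ _)
          fun x _ => ?_
        have e1 : Real.exp (-(2 * β / e * x)) = Real.exp (-(β * x / e)) ^ 2 := by
          rw [sq, ← Real.exp_add]; congr 1; ring
        have e2 : Real.exp (-(2 * β / e * (1 - x))) = Real.exp (-(β * (1 - x) / e)) ^ 2 := by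
          rw [sq, ← Real.exp_add]; congr 1; ring
        rw [e1, e2]; unfold layer
        nlinarith [sq_nonneg (Real.exp (-(β * x / e)) - Real.exp (-(β * (1 - x) / e)))]
    _ = 4 * ∫ x in a..(1 - a), Real.exp (-(2 * β / e * x)) := by
        have j1 : Continuous fun x => 2 * Real.exp (-(2 * β / e * x)) := by fun_prop
        have j2 : Continuous fun x => 2 * Real.exp (-(2 * β / e * (1 - x))) := by fun_prop
        rw [intervalIntegral.integral_add (j1.intervalIntegrable _ _) (j2.intervalIntegrable _ _),
          intervalIntegral.integral_const_mul, intervalIntegral.integral_const_mul, h2]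
        ring
    _ ≤ 4 * (Real.exp (-(2 * β / e * a)) / (2 * β / e)) := by linarith
    _ = _ := by field_simp; ring

theorem integral_sq_le_of_layer {β e a A δ : ℝ} (hβ : 0 < β) (he : 0 < e) (ha0 : 0 ≤ a)
    (ha : a ≤ 1 / 2) {F : ℝ → ℝ} (hF : Continuous F)
    (hb : ∀ x ∈ Icc (0 : ℝ) 1, |F x| ≤ A * (layer β e x + δ))
    (h0 : ∀ x ≤ a, F x = 0) (h1 : ∀ x, 1 - a ≤ x → F x = 0) :
    ∫ x in (0 : ℝ)..1, F x ^ 2 ≤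
      A ^ 2 * (4 * e / β * Real.exp (-(2 * β / e * a)) + 2 * δ ^ 2) := by
  have hi : ∀ c d, IntervalIntegrable (fun x => F x ^ 2) MeasureTheory.volume c d :=
    fun c d => (hF.pow 2).intervalIntegrable _ _
  have z0 : ∫ x in (0 : ℝ)..a, F x ^ 2 = 0 := by
    rw [intervalIntegral.integral_congr (g := fun _ => (0 : ℝ)) fun x hx => ?_]
    · simp
    · rw [uIcc_of_le ha0] at hx; simp [h0 x hx.2]
  have z1 : ∫ x in (1 - a)..1, F x ^ 2 = 0 := by
    rw [intervalIntegral.integral_congr (g := fun _ => (0 : ℝ)) fun x hx => ?_]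
    · simp
    · rw [uIcc_of_le (by linarith)] at hx; simp [h1 x hx.1]
  rw [← intervalIntegral.integral_add_adjacent_intervals (hi 0 (1 - a)) (hi (1 - a) 1),
    ← intervalIntegral.integral_add_adjacent_intervals (hi 0 a) (hi a (1 - a)), z0, z1, zero_add,
    add_zero]
  have il : IntervalIntegrable (fun x => layer β e x ^ 2) MeasureTheory.volume a (1 - a) :=
    ((continuous_layer β e).pow 2).intervalIntegrable _ _
  calc ∫ x in a..(1 - a), F x ^ 2
      ≤ ∫ x in a..(1 - a), (2 * A ^ 2 * layer β e x ^ 2 + 2 * A ^ 2 * δ ^ 2) := by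
        refine intervalIntegral.integral_mono_on (by linarith) (hi _ _)
          ((il.const_mul _).add (continuous_const.intervalIntegrable _ _)) fun x hx => ?_
        have h := hb x ⟨by linarith [hx.1], by linarith [hx.2]⟩
        calc F x ^ 2 = |F x| ^ 2 := (sq_abs _).symm
          _ ≤ (A * (layer β e x + δ)) ^ 2 := by gcongr
          _ ≤ _ := by nlinarith [mul_nonneg (sq_nonneg A) (sq_nonneg (layer β e x - δ))]
    _ = 2 * A ^ 2 * (∫ x in a..(1 - a), layer β e x ^ 2) + (1 - a - a) * (2 * A ^ 2 * δ ^ 2) := by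
        rw [intervalIntegral.integral_add (il.const_mul _) (continuous_const.intervalIntegrable _ _),
          intervalIntegral.integral_const_mul, intervalIntegral.integral_const, smul_eq_mul]
    _ ≤ 2 * A ^ 2 * (2 * e / β * Real.exp (-(2 * β / e * a))) + 1 * (2 * A ^ 2 * δ ^ 2) := by
        gcongr
        · exact integral_layer_sq_le hβ he ha
        · linarith
    _ = _ := by ring

/-! ### The layer-adapted comparison function -/

theorem one_le_log_natCast {N : ℕ} (hN : 4 ≤ N) : 1 ≤ Real.log N := by
  rw [Real.le_log_iff_exp_le (by positivity)]
  have : (4 : ℝ) ≤ N := by exact_mod_cast hN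
  linarith [Real.exp_one_lt_d9]

/-- The squared layer at the transition point is `N^(-2σ)`; the condition `σ ≥ k + 1` makes it match
the order of the method. -/
theorem exp_neg_mul_log_le {σ : ℝ} {k N : ℕ} (hN : 4 ≤ N) (hσ : (k : ℝ) + 1 ≤ σ) :
    Real.exp (-(2 * (σ * Real.log N))) ≤ (((N : ℝ) ^ (k + 1))⁻¹) ^ 2 := by
  have hN0 : (0 : ℝ) < N := by positivity
  have h1 := one_le_log_natCast hN
  have : (((N : ℝ) ^ (k + 1))⁻¹) ^ 2 = Real.exp (-(2 * ((k + 1 : ℕ) * Real.log N))) := by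
    rw [Real.exp_neg, two_mul, Real.exp_add, Real.exp_nat_mul, Real.exp_log hN0]
    rw [inv_pow, sq]
  rw [this]
  refine Real.exp_le_exp.2 ?_
  push_cast
  nlinarith

theorem iteratedDeriv_mul_le_layer {K : ℕ} {A B W e x : ℝ} {F R : ℝ → ℝ} (he : 0 < e)
    (hF : ContDiff ℝ K F) (hR : ContDiff ℝ K R) (hA : 0 ≤ A)
    (hFb : ∀ j ≤ K, e ^ j * |iteratedDeriv j F x| ≤ A)
    (hRb : ∀ j ≤ K, e ^ j * |iteratedDeriv j R x| ≤ B * W) :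
    ∀ j ≤ K, e ^ j * |iteratedDeriv j (fun x => F x * R x) x| ≤ 2 ^ K * A * B * W := by
  intro j hj
  have hj' : ((j : ℕ) : WithTop ℕ∞) ≤ (K : ℕ) := by exact_mod_cast hj
  have hBW : 0 ≤ B * W := le_trans (by positivity) (hRb 0 (Nat.zero_le _))
  rw [iteratedDeriv_fun_mul (hF.of_le hj').contDiffAt (hR.of_le hj').contDiffAt]
  calc _ ≤ e ^ j * ∑ l ∈ Finset.range (j + 1),
          |(j.choose l : ℝ) * iteratedDeriv l F x * iteratedDeriv (j - l) R x| := by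
        gcongr; exact Finset.abs_sum_le_sum_abs _ _
    _ = ∑ l ∈ Finset.range (j + 1), e ^ j *
          |(j.choose l : ℝ) * iteratedDeriv l F x * iteratedDeriv (j - l) R x| := Finset.mul_sum _ _ _
    _ ≤ ∑ l ∈ Finset.range (j + 1), (j.choose l : ℝ) * (A * (B * W)) := by
        refine Finset.sum_le_sum fun l hl => ?_
        have hl' : l ≤ j := by have := Finset.mem_range.1 hl; omega
        have h1 := hFb l (hl'.trans hj)
        have h2 := hRb (j - l) (by omega)
        have h3 : e ^ j = e ^ l * e ^ (j - l) := by rw [← pow_add]; congr 1; omega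
        rw [abs_mul, abs_mul, Nat.abs_cast, h3]
        calc _ = (j.choose l : ℝ) * ((e ^ l * |iteratedDeriv l F x|) *
              (e ^ (j - l) * |iteratedDeriv (j - l) R x|)) := by ring
          _ ≤ _ := by gcongr
    _ = 2 ^ j * (A * (B * W)) := by
        rw [← Finset.sum_mul]
        congr 1
        exact_mod_cast Nat.sum_range_choose j
    _ ≤ 2 ^ K * (A * (B * W)) := by
        gcongr; norm_num
    _ = _ := by ring

set_option maxHeartbeats 1000000 in
/-- The solution is, up to a small remainder, a function whose layers do not reach the coarse part
of the mesh. -/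
theorem exists_layer_adapted (k : ℕ) {β σ C₀ : ℝ} (hβ : 0 < β) (hσ : (k : ℝ) + 1 ≤ σ)
    (hC₀ : 0 < C₀) {b f : ℝ → ℝ} (hb : ContDiff ℝ (k + 2 * (k + 1 + 1) : ℕ) b)
    (hf : ContDiff ℝ (k + 2 * (k + 1 + 1) : ℕ) f)
    (hbβ : ∀ x ∈ Icc (0 : ℝ) 1, β ^ 2 ≤ b x) :
    ∃ C : ℝ, 0 < C ∧ ∀ (e τ : ℝ) (N : ℕ) (u : ℝ → ℝ), 0 < e → e ≤ 1 → 4 ≤ N →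
      e ^ 2 ≤ C₀ * (N : ℝ)⁻¹ → β * τ = σ * e * Real.log N → τ ≤ 1 / 4 →
      IsSolution (e ^ 2) b f u →
      ∃ v w : ℝ → ℝ, ContDiff ℝ (k + 2 : ℕ) v ∧ (∀ x ∈ Icc (0 : ℝ) 1, v x = u x) ∧
        ContDiff ℝ (k + 2 : ℕ) w ∧ w 0 = 0 ∧ w 1 = 0 ∧
        (∀ j ≤ k + 2, ∀ x ∈ Icc (0 : ℝ) 1,
          e ^ j * |iteratedDeriv j w x| ≤ C * (e ^ j + layer β e x)) ∧
        (∀ j ≤ k + 2, ∀ x ∈ Icc τ (1 - τ), |iteratedDeriv j w x| ≤ C) ∧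
        ∫ x in (0 : ℝ)..1, (v x - w x) ^ 2 ≤ C * e * (((N : ℝ) ^ (k + 1))⁻¹) ^ 2 ∧
        ∫ x in (0 : ℝ)..1, (e ^ 2 * (deriv v x - deriv w x)) ^ 2 ≤
          C * e ^ 3 * (((N : ℝ) ^ (k + 1))⁻¹) ^ 2 ∧
        ∫ x in (0 : ℝ)..1, (f x - (-e ^ 2 * deriv (deriv w) x + b x * w x)) ^ 2 ≤
          C * e * (((N : ℝ) ^ (k + 1))⁻¹) ^ 2 := by
  obtain ⟨g, CS, hg, hCS, hS⟩ := exists_outer_expansion (r := k) hβ hbβ (k + 1) hb f hf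
  obtain ⟨Cg, hCg, hgb⟩ := exists_bound_iteratedDeriv hg
  obtain ⟨Cb, hCb, hbb⟩ := exists_bound_iteratedDeriv hb
  have hσ0 : 0 < σ := lt_of_lt_of_le (by positivity) hσ
  -- `CS` accounts for the boundary values of the remainder, `Cg / β ^ 2` for the defect of the
  -- expansion.
  obtain ⟨A, hA⟩ : ∃ y, y = CS + Cg / β ^ 2 := ⟨_, rfl⟩
  have hA0 : 0 < A := by rw [hA]; positivity
  obtain ⟨CR, hCR, hRall⟩ := exists_iteratedDeriv_le_layer (K := k) hβ hA0
    (hb.of_le (by norm_cast; omega)) hg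
  obtain ⟨Cθ, hCθ, hθ⟩ := exists_bound_cutoff (k + 2)
  obtain ⟨Cχ, hCχ⟩ : ∃ y, y = Cθ * (1 + 3 * β / σ) ^ (k + 2) := ⟨_, rfl⟩
  have hCχ1 : 0 < Cχ := by rw [hCχ]; positivity
  obtain ⟨D, hD⟩ : ∃ y, y = 2 ^ (k + 2) * Cχ * CR := ⟨_, rfl⟩
  have hD0 : 0 < D := by rw [hD]; positivity
  obtain ⟨F, hF⟩ : ∃ y, y = CR + D := ⟨_, rfl⟩
  have hF0 : 0 < F := by rw [hF]; positivity
  obtain ⟨Q, hQ⟩ : ∃ y, y = 4 / β * Real.exp (2 * σ) + 2 * C₀ ^ (2 * k + 2) := ⟨_, rfl⟩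
  have hQ0 : 0 < Q := by rw [hQ]; positivity
  obtain ⟨C, hC⟩ : ∃ C, C = CS + 2 * D + (F * (1 + Cb)) ^ 2 * Q + F ^ 2 * Q := ⟨_, rfl⟩
  have hCpos : 0 < C := by rw [hC]; positivity
  refine ⟨C, hCpos, fun e τ N u he he1 hN heN hτ hτ4 hu => ?_⟩
  have he2 : 0 < e ^ 2 := by positivity
  have he21 : e ^ 2 ≤ 1 := pow_le_one₀ he.le he1
  obtain ⟨v, hv, hvu, hve⟩ := hu.exists_contDiff he2 hb hf
  obtain ⟨S, hSc, hSe, hSb⟩ := hS (e ^ 2) he2 he21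
  have hv2 : ContDiff ℝ (k + 2 : ℕ) v := hv.of_le (by norm_cast; omega)
  set δ := (e ^ 2) ^ (k + 1 + 1) with hδ
  have hδ0 : 0 < δ := by positivity
  have h2le : ((2 : ℕ) : WithTop ℕ∞) ≤ (k + 2 : ℕ) := by norm_cast; omega
  -- the remainder of the outer expansion
  set R : ℝ → ℝ := fun x => v x - S x with hR
  have hRc : ContDiff ℝ (k + 2 : ℕ) R := hv2.sub hSc
  have hRdd : ∀ x, deriv (deriv R) x = deriv (deriv v) x - deriv (deriv S) x := by
    intro x
    simp only [← iteratedDeriv_two, hR]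
    exact iteratedDeriv_fun_sub (hv2.of_le h2le).contDiffAt (hSc.of_le h2le).contDiffAt
  have hReq : ∀ x ∈ Icc (0 : ℝ) 1, -e ^ 2 * deriv (deriv R) x + b x * R x = -(δ * g x) := by
    intro x hx
    have h1 := hve x hx
    have h2 := hSe x hx
    rw [hRdd]; simp only [hR, hδ]
    linear_combination h1 - h2
  have m0 : (0 : ℝ) ∈ Icc (0 : ℝ) 1 := ⟨le_rfl, zero_le_one⟩
  have m1 : (1 : ℝ) ∈ Icc (0 : ℝ) 1 := ⟨zero_le_one, le_rfl⟩
  have hv0 : v 0 = 0 := (hvu 0 m0).trans hu.left_boundary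
  have hv1 : v 1 = 0 := (hvu 1 m1).trans hu.right_boundary
  have hR0 : ∀ x ∈ Icc (0 : ℝ) 1, |R x| ≤ A * (layer β e x + δ) := by
    intro x hx
    have := abs_le_barrier (A := CS) (D := δ * Cg) hβ he hCS.le (by positivity) hbβ
      (hRc.of_le h2le) hReq
      (by simpa [hR, hv0] using hSb 0 (by omega) 0 m0)
      (by simpa [hR, hv1] using hSb 0 (by omega) 1 m1)
      (fun y hy => by
        rw [abs_neg, abs_mul, abs_of_pos hδ0]
        exact mul_le_mul_of_nonneg_left (by simpa using hgb 0 (by omega) y hy) hδ0.le) x hx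
    refine this.trans ?_
    have hl := layer_pos β e x
    have : 0 ≤ Cg / β ^ 2 * layer β e x := by positivity
    have : 0 ≤ CS * δ := by positivity
    rw [hA]; ring_nf at *; linarith
  have hRb := hRall e δ R he he1 hδ0.le hRc
    (fun x hx => by linarith [hReq x hx]) hR0
  -- the cutoff
  set w := σ * e / β with hw
  have hw0 : 0 < w := by positivity
  have hlog := one_le_log_natCast hN
  -- As `τ = w ln N` and `ln N ≥ 1`, stepping back by `w` stays in `[0,1]`. It costs only the factor
  -- `exp (2σ)` in the squared tail, while `w` is proportional to `e`, so the weighted derivatives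
  -- of the cutoff are bounded.
  set a := τ - w with ha
  have hτw : τ = w * Real.log N := by rw [hw]; field_simp; linarith
  have ha0 : 0 ≤ a := by rw [ha, hτw]; nlinarith
  have hχc := contDiff_cutoff τ w (k + 2)
  have hχb : ∀ x, ∀ j ≤ k + 2, e ^ j * |iteratedDeriv j (cutoff τ w) x| ≤ Cχ := by
    intro x j hj
    calc e ^ j * |iteratedDeriv j (cutoff τ w) x| ≤ e ^ j * (Cθ * (3 / w) ^ j) := by
          gcongr; exact hθ τ w hw0 j hj x
      _ = Cθ * (3 * β / σ) ^ j := by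
          rw [mul_left_comm, ← mul_pow, hw]; congr 2; field_simp
      _ ≤ Cθ * (1 + 3 * β / σ) ^ j := by gcongr; linarith
      _ ≤ Cχ := by
          rw [hCχ]; gcongr; linarith [show 0 < 3 * β / σ by positivity]
  set T : ℝ → ℝ := fun x => cutoff τ w x * R x with hT
  have hTc : ContDiff ℝ (k + 2 : ℕ) T := hχc.mul hRc
  have hTb : ∀ j ≤ k + 2, ∀ x ∈ Icc (0 : ℝ) 1,
      e ^ j * |iteratedDeriv j T x| ≤ D * (layer β e x + δ) := fun j hj x hx => hD ▸
    iteratedDeriv_mul_le_layer he hχc hRc hCχ1.le (hχb x) (fun j hj => hRb j hj x hx) j hj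
  have hwc : ContDiff ℝ (k + 2 : ℕ) (fun x => S x + T x) := hSc.add hTc
  have hwd : ∀ j ≤ k + 2, ∀ x, iteratedDeriv j (fun x => S x + T x) x =
      iteratedDeriv j S x + iteratedDeriv j T x := by
    intro j hj x
    have hj' : ((j : ℕ) : WithTop ℕ∞) ≤ (k + 2 : ℕ) := by exact_mod_cast hj
    exact iteratedDeriv_fun_add (hSc.of_le hj').contDiffAt (hTc.of_le hj').contDiffAt
  -- the tail of the layers
  set ρ : ℝ → ℝ := fun x => v x - (S x + T x) with hρ
  have hρc : ContDiff ℝ (k + 2 : ℕ) ρ := hv2.sub hwc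
  have hρRT : ρ = fun x => R x - T x := by funext x; simp only [hρ, hR]; ring
  have hρb : ∀ j ≤ k + 2, ∀ x ∈ Icc (0 : ℝ) 1,
      e ^ j * |iteratedDeriv j ρ x| ≤ F * (layer β e x + δ) := by
    intro j hj x hx
    have hj' : ((j : ℕ) : WithTop ℕ∞) ≤ (k + 2 : ℕ) := by exact_mod_cast hj
    rw [hρRT, iteratedDeriv_fun_sub (hRc.of_le hj').contDiffAt (hTc.of_le hj').contDiffAt]
    calc _ ≤ e ^ j * (|iteratedDeriv j R x| + |iteratedDeriv j T x|) := by
          gcongr; exact abs_sub _ _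
      _ ≤ _ := by rw [mul_add, hF, add_mul]; exact add_le_add (hRb j hj x hx) (hTb j hj x hx)
  have hρ0 : ∀ x, x ≤ a ∨ 1 - a ≤ x → ρ =ᶠ[nhds x] fun _ => 0 := by
    intro x hx
    have : cutoff τ w =ᶠ[nhds x] fun _ => 1 := hx.elim
      (fun h => cutoff_eventuallyEq_one_left hw0 hτ4 h)
      (fun h => cutoff_eventuallyEq_one_right hw0 hτ4 h)
    filter_upwards [this] with y hy
    rw [hρRT]; simp [hT, hy]
  have hρj : ∀ j x, x ≤ a ∨ 1 - a ≤ x → iteratedDeriv j ρ x = 0 := by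
    intro j x hx
    rw [(hρ0 x hx).iteratedDeriv_eq j, iteratedDeriv_const]; simp
  -- smallness
  set M := ((N : ℝ) ^ (k + 1))⁻¹ with hM
  have hN0 : (0 : ℝ) < N := by positivity
  have hM0 : 0 < M := by positivity
  have ha2 : a ≤ 1 / 2 := by rw [ha]; linarith
  have hsmall : 4 * e / β * Real.exp (-(2 * β / e * a)) + 2 * δ ^ 2 ≤ Q * e * M ^ 2 := by
    have h1 : Real.exp (-(2 * β / e * a)) ≤ Real.exp (2 * σ) * M ^ 2 := by
      have h2 : -(2 * β / e * a) = 2 * σ + -(2 * (σ * Real.log N)) := by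
        rw [ha, hτw, hw]; field_simp; ring
      rw [h2, Real.exp_add]
      gcongr; exact exp_neg_mul_log_le hN hσ
    -- Here `δ² = e⁴ (e²)^(2k+2)`: the assumption `e² ≤ C₀ / N` turns the second factor into a
    -- multiple of `M²`, and the first supplies the required factor `e`. This is why the expansion
    -- goes up to the power `k + 2`.
    have h3 : δ ^ 2 ≤ e * (C₀ ^ (2 * k + 2) * M ^ 2) := by
      have h4 : δ ^ 2 = e * e ^ 3 * (e ^ 2) ^ (2 * k + 2) := by rw [hδ]; ring
      have h5 : M ^ 2 = ((N : ℝ)⁻¹) ^ (2 * k + 2) := by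
        rw [hM, ← inv_pow, ← pow_mul]; congr 1; ring
      rw [h4, h5, ← mul_pow]
      calc e * e ^ 3 * (e ^ 2) ^ (2 * k + 2) ≤ e * 1 * (C₀ * (N : ℝ)⁻¹) ^ (2 * k + 2) := by
            gcongr; exact pow_le_one₀ he.le he1
        _ = _ := by ring
    calc _ ≤ 4 * e / β * (Real.exp (2 * σ) * M ^ 2) + 2 * (e * (C₀ ^ (2 * k + 2) * M ^ 2)) := by
          gcongr
      _ = _ := by rw [hQ]; ring
  -- Everything built from `ρ` vanishes outside `(a, 1 - a)`, so all three integral bounds are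
  -- instances of this one.
  have hint : ∀ (B : ℝ) (G : ℝ → ℝ), Continuous G →
      (∀ x ∈ Icc (0 : ℝ) 1, |G x| ≤ B * (layer β e x + δ)) →
      (∀ x, x ≤ a ∨ 1 - a ≤ x → G x = 0) →
      ∫ x in (0 : ℝ)..1, G x ^ 2 ≤ B ^ 2 * (Q * e * M ^ 2) := fun B G hG hGb hG0 =>
    (integral_sq_le_of_layer hβ he ha0 ha2 hG hGb (fun x hx => hG0 x (.inl hx))
      (fun x hx => hG0 x (.inr hx))).trans (mul_le_mul_of_nonneg_left hsmall (sq_nonneg _))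
  refine ⟨v, fun x => S x + T x, hv2, hvu, hwc, ?_, ?_, ?_, ?_, ?_, ?_, ?_⟩
  · have := (hρ0 0 (.inl ha0)).self_of_nhds
    simp only [hρ, hv0] at this; linarith
  · have := (hρ0 1 (.inr (by linarith))).self_of_nhds
    simp only [hρ, hv1] at this; linarith
  · intro j hj x hx
    rw [hwd j hj]
    have hej : 0 < e ^ j := by positivity
    have hδj : δ ≤ e ^ j := by
      rw [hδ, ← pow_mul]; exact pow_le_pow_of_le_one he.le he1 (by omega)
    have hl := layer_pos β e x
    calc _ ≤ e ^ j * (|iteratedDeriv j S x| + |iteratedDeriv j T x|) := by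
          gcongr; exact abs_add_le _ _
      _ ≤ e ^ j * CS + D * (layer β e x + e ^ j) := by
          rw [mul_add]
          exact add_le_add (mul_le_mul_of_nonneg_left (hSb j hj x hx) hej.le)
            ((hTb j hj x hx).trans (by gcongr))
      _ ≤ (CS + 2 * D) * (e ^ j + layer β e x) := by
          linarith [mul_pos hCS hl, mul_pos hD0 hl, mul_pos hD0 hej]
      _ ≤ _ := by
          gcongr
          have : 0 ≤ (F * (1 + Cb)) ^ 2 * Q + F ^ 2 * Q := by positivity
          rw [hC]; linarith
  · intro j hj x hx
    have hx' : x ∈ Icc (0 : ℝ) 1 := ⟨by linarith [hx.1], by linarith [hx.2]⟩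
    -- On the coarse part the cut-off layer term vanishes identically, so only the outer expansion
    -- with its uniform bounds is left.
    have hT0 : T =ᶠ[nhds x] fun _ => 0 := by
      filter_upwards [cutoff_eventuallyEq_zero hw0 hx] with y hy
      simp [hT, hy]
    rw [hwd j hj, hT0.iteratedDeriv_eq j, iteratedDeriv_const]
    simp only [ite_self, add_zero]
    refine (hSb j hj x hx').trans ?_
    have : 0 ≤ 2 * D + (F * (1 + Cb)) ^ 2 * Q + F ^ 2 * Q := by positivity
    rw [hC]; linarith
  · refine (hint F ρ hρc.continuous (fun x hx => by simpa using hρb 0 (by omega) x hx)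
      (fun x hx => by simpa using hρj 0 x hx)).trans ?_
    have : F ^ 2 * Q ≤ C := by
      have : 0 ≤ CS + 2 * D + (F * (1 + Cb)) ^ 2 * Q := by positivity
      rw [hC]; linarith
    calc F ^ 2 * (Q * e * M ^ 2) = F ^ 2 * Q * (e * M ^ 2) := by ring
      _ ≤ C * (e * M ^ 2) := by gcongr
      _ = _ := by ring
  · have hd : ∀ x, deriv ρ x = deriv v x - deriv (fun x => S x + T x) x := fun x =>
      deriv_fun_sub ((hv2.differentiable (by simp)) x) ((hwc.differentiable (by simp)) x)
    have hc : Continuous (fun x => e ^ 2 * deriv ρ x) :=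
      continuous_const.mul (ContDiff.deriv_nat (n := k + 1) hρc).continuous
    simp only [← hd]
    refine (hint (F * e) _ hc (fun x hx => ?_) (fun x hx => ?_)).trans ?_
    · have := hρb 1 (by omega) x hx
      rw [iteratedDeriv_one, pow_one] at this
      rw [abs_mul, abs_of_pos he2]
      calc e ^ 2 * |deriv ρ x| = e * (e * |deriv ρ x|) := by ring
        _ ≤ e * (F * (layer β e x + δ)) := by gcongr
        _ = _ := by ring
    · have := hρj 1 x hx
      rw [iteratedDeriv_one] at this; simp [this]
    · have : F ^ 2 * Q ≤ C := by
        have : 0 ≤ CS + 2 * D + (F * (1 + Cb)) ^ 2 * Q := by positivity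
        rw [hC]; linarith
      calc (F * e) ^ 2 * (Q * e * M ^ 2) = F ^ 2 * Q * (e ^ 3 * M ^ 2) := by ring
        _ ≤ C * (e ^ 3 * M ^ 2) := by gcongr
        _ = _ := by ring
  · have hd : ∀ x, iteratedDeriv 2 ρ x =
        deriv (deriv v) x - deriv (deriv (fun x => S x + T x)) x := by
      intro x
      simp only [← iteratedDeriv_two, hρ]
      exact iteratedDeriv_fun_sub (hv2.of_le h2le).contDiffAt (hwc.of_le h2le).contDiffAt
    have hcongr : ∫ x in (0 : ℝ)..1,
        (f x - (-e ^ 2 * deriv (deriv fun x => S x + T x) x + b x * (S x + T x))) ^ 2 =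
        ∫ x in (0 : ℝ)..1, (-e ^ 2 * iteratedDeriv 2 ρ x + b x * ρ x) ^ 2 := by
      refine intervalIntegral.integral_congr fun x hx => ?_
      rw [uIcc_of_le zero_le_one] at hx
      have hρx : ρ x = v x - (S x + T x) := rfl
      simp only [hd x]
      rw [hρx, ← hve x hx]
      ring
    rw [hcongr]
    refine (hint (F * (1 + Cb)) _ ((continuous_const.mul (hρc.continuous_iteratedDeriv 2 h2le)).add
      (hb.continuous.mul hρc.continuous)) (fun x hx => ?_) (fun x hx => ?_)).trans ?_
    · have h2 := hρb 2 (by omega) x hx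
      have h0 := hρb 0 (by omega) x hx
      have hb0 := hbb 0 (by omega) x hx
      simp only [iteratedDeriv_zero, pow_zero, one_mul] at h0 hb0
      calc |-e ^ 2 * iteratedDeriv 2 ρ x + b x * ρ x|
          ≤ e ^ 2 * |iteratedDeriv 2 ρ x| + |b x| * |ρ x| := by
            refine (abs_add_le _ _).trans ?_
            rw [abs_mul, abs_mul, abs_neg, abs_of_pos he2]
        _ ≤ F * (layer β e x + δ) + Cb * (F * (layer β e x + δ)) := by gcongr
        _ = _ := by ring
    · have h0 := hρj 0 x hx
      rw [iteratedDeriv_zero] at h0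
      simp [hρj 2 x hx, h0]
    · have : (F * (1 + Cb)) ^ 2 * Q ≤ C := by
        have : 0 ≤ CS + 2 * D + F ^ 2 * Q := by positivity
        rw [hC]; linarith
      calc (F * (1 + Cb)) ^ 2 * (Q * e * M ^ 2) = (F * (1 + Cb)) ^ 2 * Q * (e * M ^ 2) := by ring
        _ ≤ C * (e * M ^ 2) := by gcongr
        _ = _ := by ring


/-! ### Moments, inverse inequalities and projections on the unit interval -/

/-- The polynomial of degree at most `k` with the given coefficients. -/
noncomputable def coeffPoly (k : ℕ) : (Fin (k + 1) → ℝ) →ₗ[ℝ] ℝ[X] :=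
  ∑ i : Fin (k + 1), (Polynomial.monomial (i : ℕ)).comp (LinearMap.proj i)

theorem coeffPoly_apply (k : ℕ) (c : Fin (k + 1) → ℝ) :
    coeffPoly k c = ∑ i : Fin (k + 1), Polynomial.monomial (i : ℕ) (c i) := by
  simp [coeffPoly, LinearMap.sum_apply]

theorem natDegree_coeffPoly_le (k : ℕ) (c : Fin (k + 1) → ℝ) :
    (coeffPoly k c).natDegree ≤ k := by
  rw [coeffPoly_apply]
  exact Polynomial.natDegree_sum_le_of_forall_le _ _ fun i _ =>
    (Polynomial.natDegree_monomial_le _).trans (by omega)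

theorem exists_coeffPoly_eq {k : ℕ} {p : ℝ[X]} (hp : p.natDegree ≤ k) :
    ∃ c, coeffPoly k c = p := by
  refine ⟨fun i => p.coeff i, ?_⟩
  rw [coeffPoly_apply, Fin.sum_univ_eq_sum_range (fun i => Polynomial.monomial i (p.coeff i)),
    ← Polynomial.as_sum_range' p (k + 1) (by omega)]

theorem coeffPoly_injective (k : ℕ) : Function.Injective (coeffPoly k) := by
  rw [injective_iff_map_eq_zero]
  intro c hc
  funext i
  have := congrArg (fun p => Polynomial.coeff p i) hc
  rw [coeffPoly_apply] at this
  simp only [Polynomial.finsetSum_coeff, Polynomial.coeff_monomial, Polynomial.coeff_zero] at this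
  simpa [Fin.val_inj] using this

theorem eval_coeffPoly (k : ℕ) (c : Fin (k + 1) → ℝ) (y : ℝ) :
    (coeffPoly k c).eval y = ∑ i : Fin (k + 1), c i * y ^ (i : ℕ) := by
  rw [coeffPoly_apply, Polynomial.eval_finsetSum]
  simp

theorem abs_eval_coeffPoly_le (k : ℕ) (c : Fin (k + 1) → ℝ) {y : ℝ} (hy : y ∈ Icc (0 : ℝ) 1) :
    |(coeffPoly k c).eval y| ≤ (k + 1) * ‖c‖ := by
  rw [eval_coeffPoly]
  calc _ ≤ ∑ i : Fin (k + 1), |c i * y ^ (i : ℕ)| := Finset.abs_sum_le_sum_abs _ _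
    _ ≤ ∑ _i : Fin (k + 1), ‖c‖ := by
        refine Finset.sum_le_sum fun i _ => ?_
        rw [abs_mul, abs_of_nonneg (pow_nonneg hy.1 _)]
        exact (mul_le_of_le_one_right (abs_nonneg _) (pow_le_one₀ hy.1 hy.2)).trans
          (norm_le_pi_norm c i)
    _ = _ := by simp

theorem abs_eval_derivative_coeffPoly_le (k : ℕ) (c : Fin (k + 1) → ℝ) {y : ℝ}
    (hy : y ∈ Icc (0 : ℝ) 1) :
    |(coeffPoly k c).derivative.eval y| ≤ (k + 1) * (k * ‖c‖) := by
  rw [coeffPoly_apply, Polynomial.derivative_sum, Polynomial.eval_finsetSum]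
  calc _ ≤ ∑ i : Fin (k + 1), |((Polynomial.monomial (i : ℕ) (c i)).derivative).eval y| :=
        Finset.abs_sum_le_sum_abs _ _
    _ ≤ ∑ _i : Fin (k + 1), k * ‖c‖ := by
        refine Finset.sum_le_sum fun i _ => ?_
        rw [Polynomial.derivative_monomial, Polynomial.eval_monomial, abs_mul, abs_mul,
          Nat.abs_cast, abs_of_nonneg (pow_nonneg hy.1 _)]
        have h1 : ((i : ℕ) : ℝ) ≤ k := by exact_mod_cast (by omega : (i : ℕ) ≤ k)
        have h2 : |c i| ≤ ‖c‖ := norm_le_pi_norm c i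
        have h3 : y ^ ((i : ℕ) - 1) ≤ 1 := pow_le_one₀ hy.1 hy.2
        have h4 : 0 ≤ y ^ ((i : ℕ) - 1) := pow_nonneg hy.1 _
        calc |c i| * ((i : ℕ) : ℝ) * y ^ ((i : ℕ) - 1) ≤ ‖c‖ * k * 1 := by gcongr
          _ = _ := by ring
    _ = _ := by simp

theorem eq_zero_of_integral_eq_zero {F : ℝ → ℝ} (hF : Continuous F)
    (h0 : ∀ t ∈ Icc (0 : ℝ) 1, 0 ≤ F t) (hi : ∫ t in (0 : ℝ)..1, F t = 0) :
    ∀ t ∈ Icc (0 : ℝ) 1, F t = 0 := by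
  by_contra! h
  obtain ⟨t, ht, hne⟩ := h
  have := intervalIntegral.integral_pos (zero_lt_one' ℝ) hF.continuousOn
    (fun s hs => h0 s ⟨hs.1.le, hs.2⟩) ⟨t, ht, (h0 t ht).lt_of_ne hne.symm⟩
  linarith

theorem polynomial_eq_zero_of_Ioo {p : ℝ[X]} (h : ∀ t ∈ Ioo (0 : ℝ) 1, p.eval t = 0) : p = 0 :=
  Polynomial.eq_zero_of_infinite_isRoot p
    ((Ioo_infinite (zero_lt_one' ℝ)).mono fun t ht => h t ht)

/-- Nonnegativity of the variance. -/
theorem sq_integral_le {F : ℝ → ℝ} (hF : Continuous F) :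
    (∫ t in (0 : ℝ)..1, F t) ^ 2 ≤ ∫ t in (0 : ℝ)..1, F t ^ 2 := by
  set m := ∫ t in (0 : ℝ)..1, F t with hm
  have h0 : 0 ≤ ∫ t in (0 : ℝ)..1, (F t - m) ^ 2 :=
    intervalIntegral.integral_nonneg zero_le_one fun t _ => sq_nonneg _
  have h1 : ∫ t in (0 : ℝ)..1, (F t - m) ^ 2 =
      (∫ t in (0 : ℝ)..1, F t ^ 2) - ((2 * m) * m - m ^ 2) := by
    have e1 : ∀ t, (F t - m) ^ 2 = F t ^ 2 - ((2 * m) * F t - m ^ 2) := fun t => by ring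
    have c1 : Continuous fun t => (2 * m) * F t := by fun_prop
    have c2 : Continuous fun t => (2 * m) * F t - m ^ 2 := by fun_prop
    have c3 : Continuous fun t => F t ^ 2 := by fun_prop
    simp only [e1]
    rw [intervalIntegral.integral_sub (c3.intervalIntegrable _ _) (c2.intervalIntegrable _ _),
      intervalIntegral.integral_sub (c1.intervalIntegrable _ _) (by simp),
      intervalIntegral.integral_const_mul, ← hm]
    simp
  nlinarith

/-- `p ↦ ∫₀¹ b p t^j`. -/
noncomputable def weightedMoment (b : ℝ → ℝ) (hb : Continuous b) (j : ℕ) : ℝ[X] →ₗ[ℝ] ℝ where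
  toFun p := ∫ t in (0 : ℝ)..1, b t * p.eval t * t ^ j
  map_add' p q := by
    rw [← intervalIntegral.integral_add]
    · refine intervalIntegral.integral_congr fun t _ => ?_
      simp only [Polynomial.eval_add]; ring
    · exact ((hb.mul p.continuous).mul (by fun_prop)).intervalIntegrable _ _
    · exact ((hb.mul q.continuous).mul (by fun_prop)).intervalIntegrable _ _
  map_smul' a p := by
    rw [RingHom.id_apply, smul_eq_mul, ← intervalIntegral.integral_const_mul]
    refine intervalIntegral.integral_congr fun t _ => ?_
    simp only [Polynomial.eval_smul, smul_eq_mul]; ring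

theorem integral_mul_eval_eq_zero {k : ℕ} {F : ℝ → ℝ} (hF : Continuous F)
    (h : ∀ j < k, ∫ t in (0 : ℝ)..1, F t * t ^ j = 0) {z : ℝ[X]} (hz : z.natDegree < k) :
    ∫ t in (0 : ℝ)..1, F t * z.eval t = 0 := by
  have e1 : ∀ t, F t * z.eval t = ∑ j ∈ Finset.range k, z.coeff j * (F t * t ^ j) := by
    intro t
    rw [Polynomial.eval_eq_sum_range' hz, Finset.mul_sum]
    exact Finset.sum_congr rfl fun j _ => by ring
  simp only [e1]
  rw [intervalIntegral.integral_finsetSum]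
  · refine Finset.sum_eq_zero fun j hj => ?_
    rw [intervalIntegral.integral_const_mul, h j (Finset.mem_range.1 hj), mul_zero]
  · intro j _
    exact (continuous_const.mul (hF.mul (by fun_prop))).intervalIntegrable _ _

/-- The map from coefficients to weighted moments. -/
noncomputable def gramMap (k : ℕ) (b : ℝ → ℝ) (hb : Continuous b) :
    (Fin (k + 1) → ℝ) →ₗ[ℝ] (Fin (k + 1) → ℝ) :=
  LinearMap.pi fun j => (weightedMoment b hb j).comp (coeffPoly k)

/-- Vanishing weighted moments make the polynomial orthogonal to itself for a positive weight. -/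
theorem gramMap_injective (k : ℕ) {b : ℝ → ℝ} (hb : Continuous b)
    (hpos : ∀ t ∈ Icc (0 : ℝ) 1, 0 < b t) : Function.Injective (gramMap k b hb) := by
  rw [injective_iff_map_eq_zero]
  intro c hc
  have h1 : ∀ j < k + 1, ∫ t in (0 : ℝ)..1, b t * (coeffPoly k c).eval t * t ^ j = 0 :=
    fun j hj => congrFun hc ⟨j, hj⟩
  have hcont : Continuous fun t => b t * (coeffPoly k c).eval t :=
    hb.mul (coeffPoly k c).continuous
  have h2 := integral_mul_eval_eq_zero hcont h1
    (Nat.lt_succ_of_le (natDegree_coeffPoly_le k c))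
  have h3 := eq_zero_of_integral_eq_zero (hcont.mul (coeffPoly k c).continuous)
    (fun t ht => by
      have : 0 ≤ b t * ((coeffPoly k c).eval t) ^ 2 := mul_nonneg (hpos t ht).le (sq_nonneg _)
      have h5 : b t * (coeffPoly k c).eval t * (coeffPoly k c).eval t =
          b t * ((coeffPoly k c).eval t) ^ 2 := by ring
      exact (this.trans_eq h5.symm)) h2
  have h4 : coeffPoly k c = 0 := polynomial_eq_zero_of_Ioo fun t ht => by
    have h5 := h3 t (Ioo_subset_Icc_self ht)
    have h6 := (hpos t (Ioo_subset_Icc_self ht)).ne'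
    simpa [h6] using h5
  exact coeffPoly_injective k (h4.trans (map_zero _).symm)

/-- In finite dimension an injective linear map is bounded below. The inverse inequalities and the
Radau projections take their constants from here. -/
theorem exists_antilipschitz {n : ℕ} (G : (Fin n → ℝ) →ₗ[ℝ] (Fin n → ℝ))
    (hG : Function.Injective G) : ∃ C : ℝ, 0 < C ∧ ∀ c, ‖c‖ ≤ C * ‖G c‖ := by
  obtain ⟨K, hK, h⟩ := G.exists_antilipschitzWith (LinearMap.ker_eq_bot.2 hG)
  refine ⟨K, hK, fun c => ?_⟩
  have := h.le_mul_dist c 0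
  simpa using this

/-- Inverse inequalities on the unit interval. -/
theorem exists_inverse_inequality (k : ℕ) : ∃ C : ℝ, 0 < C ∧ ∀ p : ℝ[X], p.natDegree ≤ k →
    ∀ y ∈ Icc (0 : ℝ) 1, p.eval y ^ 2 ≤ C * ∫ t in (0 : ℝ)..1, p.eval t ^ 2 ∧
      p.derivative.eval y ^ 2 ≤ C * ∫ t in (0 : ℝ)..1, p.eval t ^ 2 := by
  -- For weight one the moments are bounded by the L² norm, so invertibility of the Gram map bounds
  -- the coefficients, and with them values and derivatives.
  obtain ⟨C, hC, h⟩ := exists_antilipschitz _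
    (gramMap_injective k (continuous_const (y := (1 : ℝ))) fun _ _ => one_pos)
  refine ⟨((k + 1) * ((k + 1) * C)) ^ 2, by positivity, fun p hp y hy => ?_⟩
  obtain ⟨c, rfl⟩ := exists_coeffPoly_eq hp
  set p := coeffPoly k c with hp
  set I := ∫ t in (0 : ℝ)..1, p.eval t ^ 2 with hI
  have hI0 : 0 ≤ I := intervalIntegral.integral_nonneg zero_le_one fun t _ => sq_nonneg _
  have h1 : ‖gramMap k _ (continuous_const (y := (1 : ℝ))) c‖ ≤ √I := by
    rw [pi_norm_le_iff_of_nonneg (Real.sqrt_nonneg _)]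
    intro j
    refine Real.abs_le_sqrt ?_
    change (∫ t in (0 : ℝ)..1, 1 * p.eval t * t ^ (j : ℕ)) ^ 2 ≤ I
    have hcont : Continuous fun t => 1 * p.eval t * t ^ (j : ℕ) :=
      (continuous_const.mul p.continuous).mul (by fun_prop)
    refine (sq_integral_le hcont).trans (intervalIntegral.integral_mono_on zero_le_one
      ((hcont.pow 2).intervalIntegrable _ _) ((p.continuous.pow 2).intervalIntegrable _ _)
      fun t ht => ?_)
    have : (t ^ (j : ℕ)) ^ 2 ≤ 1 := pow_le_one₀ (pow_nonneg ht.1 _) (pow_le_one₀ ht.1 ht.2)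
    rw [one_mul, mul_pow]
    exact mul_le_of_le_one_right (sq_nonneg _) this
  have h2 : ‖c‖ ≤ C * √I := (h c).trans (mul_le_mul_of_nonneg_left h1 hC.le)
  have hs : √I ^ 2 = I := Real.sq_sqrt hI0
  have hk : (0 : ℝ) ≤ k := Nat.cast_nonneg k
  constructor
  · calc p.eval y ^ 2 = |p.eval y| ^ 2 := (sq_abs _).symm
      _ ≤ ((k + 1) * ((k + 1) * (C * √I))) ^ 2 := by
          gcongr
          refine (abs_eval_coeffPoly_le k c hy).trans ?_
          gcongr
          refine h2.trans (le_mul_of_one_le_left (by positivity) (by linarith))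
      _ = ((k + 1) * ((k + 1) * C)) ^ 2 * √I ^ 2 := by ring
      _ = _ := by rw [hs]
  · calc p.derivative.eval y ^ 2 = |p.derivative.eval y| ^ 2 := (sq_abs _).symm
      _ ≤ ((k + 1) * ((k + 1) * (C * √I))) ^ 2 := by
          gcongr
          refine (abs_eval_derivative_coeffPoly_le k c hy).trans ?_
          gcongr
          linarith
      _ = ((k + 1) * ((k + 1) * C)) ^ 2 * √I ^ 2 := by ring
      _ = _ := by rw [hs]

/-- The map from coefficients to the first `k` moments and the value at `a`. -/
noncomputable def radauMap (k : ℕ) (a : ℝ) : (Fin (k + 1) → ℝ) →ₗ[ℝ] (Fin (k + 1) → ℝ) :=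
  LinearMap.pi fun j => if (j : ℕ) < k then
    (weightedMoment (fun _ => 1) continuous_const j).comp (coeffPoly k)
    else (Polynomial.leval a).comp (coeffPoly k)

/-- A polynomial in the kernel is `(X - a) w` with `deg w < k`. Testing with `w` gives `∫ (t - a) w²
= 0`, and the integrand has one sign because `a` is an endpoint. -/
theorem radauMap_injective (k : ℕ) {a : ℝ} (ha : a = 0 ∨ a = 1) :
    Function.Injective (radauMap k a) := by
  rw [injective_iff_map_eq_zero]
  intro c hc
  set p := coeffPoly k c with hp
  have h1 : ∀ j < k, ∫ t in (0 : ℝ)..1, p.eval t * t ^ j = 0 := fun j hj => by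
    have := congrFun hc ⟨j, by omega⟩
    simpa [radauMap, hj, weightedMoment] using this
  have h2 : p.eval a = 0 := by
    have := congrFun hc ⟨k, by omega⟩
    simpa [radauMap] using this
  obtain ⟨w, hw⟩ := Polynomial.dvd_iff_isRoot.2 h2
  have hw0 : w = 0 := by
    by_contra hne
    have hdeg : w.natDegree < k := by
      have h3 := natDegree_coeffPoly_le k c
      rw [← hp, hw, Polynomial.natDegree_mul (Polynomial.X_sub_C_ne_zero a) hne,
        Polynomial.natDegree_X_sub_C] at h3
      omega
    have h4 := integral_mul_eval_eq_zero p.continuous h1 hdeg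
    have h5 : ∀ t, p.eval t * w.eval t = (t - a) * w.eval t ^ 2 := fun t => by
      rw [hw]; simp only [Polynomial.eval_mul, Polynomial.eval_sub, Polynomial.eval_X,
        Polynomial.eval_C]; ring
    simp only [h5] at h4
    have hcont : Continuous fun t => (t - a) * w.eval t ^ 2 :=
      (continuous_id.sub continuous_const).mul (w.continuous.pow 2)
    refine hne (polynomial_eq_zero_of_Ioo fun t ht => ?_)
    have ht' := Ioo_subset_Icc_self ht
    have h6 : (t - a) * w.eval t ^ 2 = 0 := by
      rcases ha with rfl | rfl
      · exact eq_zero_of_integral_eq_zero hcont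
          (fun t ht => mul_nonneg (by linarith [ht.1]) (sq_nonneg _)) h4 t ht'
      · have h7 := eq_zero_of_integral_eq_zero hcont.neg
          (fun t ht => neg_nonneg.2 (mul_nonpos_of_nonpos_of_nonneg (by linarith [ht.2])
            (sq_nonneg _)))
          (by simp only [Pi.neg_apply, intervalIntegral.integral_neg, h4, neg_zero]) t ht'
        simpa using h7
    have h8 : t - a ≠ 0 := by
      rcases ha with rfl | rfl
      · exact (sub_pos.2 ht.1).ne'
      · exact (sub_neg.2 ht.2).ne
    simpa [h8] using h6
  have h4 : coeffPoly k c = 0 := by rw [← hp, hw, hw0, mul_zero]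
  exact coeffPoly_injective k (h4.trans (map_zero _).symm)

theorem abs_integral_mul_pow_le {r : ℝ → ℝ} {δ : ℝ}
    (hδ : ∀ t ∈ Icc (0 : ℝ) 1, |r t| ≤ δ) (j : ℕ) :
    |∫ t in (0 : ℝ)..1, r t * t ^ j| ≤ δ := by
  have := intervalIntegral.norm_integral_le_of_norm_le_const (a := (0 : ℝ)) (b := 1)
    (f := fun t => r t * t ^ j) (C := δ) fun t ht => by
      rw [uIoc_of_le zero_le_one] at ht
      rw [Real.norm_eq_abs, abs_mul, abs_of_nonneg (pow_nonneg ht.1.le j)]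
      exact (mul_le_of_le_one_right (abs_nonneg _) (pow_le_one₀ ht.1.le ht.2)).trans
        (hδ t ⟨ht.1.le, ht.2⟩)
  simpa using this

/-- Injectivity gives solvability by equality of dimensions. The prescribed moments and the
prescribed value are all at most `δ`, so the bounded inverse of `radauMap` bounds the projection. -/
theorem exists_radau (k : ℕ) {a : ℝ} (ha : a = 0 ∨ a = 1) : ∃ C : ℝ, 0 < C ∧
    ∀ (r : ℝ → ℝ) (δ : ℝ), Continuous r → (∀ t ∈ Icc (0 : ℝ) 1, |r t| ≤ δ) →
      ∃ p : ℝ[X], p.natDegree ≤ k ∧ p.eval a = r a ∧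
        (∀ z : ℝ[X], z.natDegree < k → ∫ t in (0 : ℝ)..1, (r t - p.eval t) * z.eval t = 0) ∧
        ∀ t ∈ Icc (0 : ℝ) 1, |p.eval t| ≤ C * δ := by
  have hinj := radauMap_injective k ha
  obtain ⟨C, hC, h⟩ := exists_antilipschitz _ hinj
  refine ⟨(k + 1) * C, by positivity, fun r δ hr hδ => ?_⟩
  have hδ0 : 0 ≤ δ := (abs_nonneg _).trans (hδ 0 ⟨le_rfl, zero_le_one⟩)
  obtain ⟨c, hc⟩ := (LinearMap.injective_iff_surjective.1 hinj) (fun j : Fin (k + 1) =>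
    if (j : ℕ) < k then ∫ t in (0 : ℝ)..1, r t * t ^ (j : ℕ) else r a)
  have hmem : a ∈ Icc (0 : ℝ) 1 := by rcases ha with rfl | rfl <;> simp
  refine ⟨coeffPoly k c, natDegree_coeffPoly_le k c, ?_, fun z hz => ?_, fun t ht => ?_⟩
  · have := congrFun hc ⟨k, by omega⟩
    simpa [radauMap] using this
  · have hcont : Continuous fun t => r t - (coeffPoly k c).eval t :=
      hr.sub (coeffPoly k c).continuous
    refine integral_mul_eval_eq_zero hcont (fun j hj => ?_) hz
    have := congrFun hc ⟨j, by omega⟩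
    have h1 : ∫ t in (0 : ℝ)..1, (coeffPoly k c).eval t * t ^ j =
        ∫ t in (0 : ℝ)..1, r t * t ^ j := by
      simpa [radauMap, hj, weightedMoment] using this
    have c1 : Continuous fun t => (coeffPoly k c).eval t * t ^ j :=
      (coeffPoly k c).continuous.mul (by fun_prop)
    have c2 : Continuous fun t => r t * t ^ j := by fun_prop
    simp only [sub_mul]
    rw [intervalIntegral.integral_sub (c2.intervalIntegrable _ _) (c1.intervalIntegrable _ _), h1,
      sub_self]
  · refine (abs_eval_coeffPoly_le k c ht).trans ?_
    rw [mul_assoc]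
    gcongr
    refine (h c).trans ?_
    gcongr
    rw [hc, pi_norm_le_iff_of_nonneg hδ0]
    intro j
    split_ifs
    · exact abs_integral_mul_pow_le hδ j
    · exact hδ a hmem

/-- The bound has to be uniform in the weight, whereas the inverse of the Gram map depends on it. So
the map serves only for existence; the bound combines L² stability, with loss `B / β₀`, and the
unweighted inverse inequality. -/
theorem exists_weighted_projection (k : ℕ) {β₀ B : ℝ} (hβ₀ : 0 < β₀) (hB : 0 < B) :
    ∃ C : ℝ, 0 < C ∧ ∀ (b r : ℝ → ℝ) (δ : ℝ), Continuous b → Continuous r →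
      (∀ t ∈ Icc (0 : ℝ) 1, β₀ ≤ b t) → (∀ t ∈ Icc (0 : ℝ) 1, b t ≤ B) →
      (∀ t ∈ Icc (0 : ℝ) 1, |r t| ≤ δ) →
      ∃ p : ℝ[X], p.natDegree ≤ k ∧
        (∀ z : ℝ[X], z.natDegree ≤ k →
          ∫ t in (0 : ℝ)..1, b t * (r t - p.eval t) * z.eval t = 0) ∧
        ∀ t ∈ Icc (0 : ℝ) 1, |p.eval t| ≤ C * δ := by
  obtain ⟨C, hC, hinv⟩ := exists_inverse_inequality k
  refine ⟨√(C * (B / β₀)), by positivity, fun b r δ hb hr hβb hbB hδ => ?_⟩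
  have hδ0 : 0 ≤ δ := (abs_nonneg _).trans (hδ 0 ⟨le_rfl, zero_le_one⟩)
  have hinj := gramMap_injective k hb fun t ht => hβ₀.trans_le (hβb t ht)
  obtain ⟨c, hc⟩ := (LinearMap.injective_iff_surjective.1 hinj) (fun j : Fin (k + 1) =>
    ∫ t in (0 : ℝ)..1, b t * r t * t ^ (j : ℕ))
  set p := coeffPoly k c with hp
  have hpd : p.natDegree ≤ k := natDegree_coeffPoly_le k c
  have horth : ∀ z : ℝ[X], z.natDegree ≤ k →
      ∫ t in (0 : ℝ)..1, b t * (r t - p.eval t) * z.eval t = 0 := by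
    intro z hz
    have hcont : Continuous fun t => b t * (r t - p.eval t) := hb.mul (hr.sub p.continuous)
    refine integral_mul_eval_eq_zero hcont (fun j hj => ?_)
      (Nat.lt_succ_of_le hz)
    have h1 : ∫ t in (0 : ℝ)..1, b t * p.eval t * t ^ j =
        ∫ t in (0 : ℝ)..1, b t * r t * t ^ j := congrFun hc ⟨j, hj⟩
    have c1 : Continuous fun t => b t * p.eval t * t ^ j :=
      (hb.mul p.continuous).mul (by fun_prop)
    have c2 : Continuous fun t => b t * r t * t ^ j := by fun_prop
    simp only [mul_sub, sub_mul]
    rw [intervalIntegral.integral_sub (c2.intervalIntegrable _ _) (c1.intervalIntegrable _ _), h1,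
      sub_self]
  refine ⟨p, hpd, horth, fun t ht => ?_⟩
  have hpc := p.continuous
  have h1 := horth p hpd
  have h2 : ∫ t in (0 : ℝ)..1, p.eval t ^ 2 ≤ B / β₀ * δ ^ 2 := by
    -- Pointwise `2bp² - 2brp = bp² - br² + b(r - p)²`, and the left-hand side integrates to zero by
    -- orthogonality to `p`.
    have h3 : ∫ t in (0 : ℝ)..1, (β₀ * p.eval t ^ 2 - B * δ ^ 2) ≤
        ∫ t in (0 : ℝ)..1, -2 * (b t * (r t - p.eval t) * p.eval t) := by
      refine intervalIntegral.integral_mono_on zero_le_one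
        (Continuous.intervalIntegrable (by fun_prop) _ _)
        (Continuous.intervalIntegrable (by fun_prop) _ _) fun t ht => ?_
      have h4 := hβb t ht
      have h5 := hbB t ht
      have h6 : r t ^ 2 ≤ δ ^ 2 := by
        rw [← sq_abs]; gcongr; exact hδ t ht
      have h7 : b t * r t ^ 2 ≤ B * δ ^ 2 := by
        have : 0 ≤ r t ^ 2 := sq_nonneg _
        gcongr
      have h8 : β₀ * p.eval t ^ 2 ≤ b t * p.eval t ^ 2 := by gcongr
      have h9 : 0 ≤ b t * (r t - p.eval t) ^ 2 := mul_nonneg (hβ₀.le.trans h4) (sq_nonneg _)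
      nlinarith
    rw [intervalIntegral.integral_const_mul, h1,
      intervalIntegral.integral_sub (Continuous.intervalIntegrable (by fun_prop) _ _) (by simp),
      intervalIntegral.integral_const_mul] at h3
    simp only [intervalIntegral.integral_const, smul_eq_mul] at h3
    rw [div_mul_eq_mul_div, le_div_iff₀ hβ₀]
    linarith
  rw [← Real.sqrt_sq hδ0, ← Real.sqrt_mul (by positivity)]
  refine Real.abs_le_sqrt (((hinv p hpd t ht).1).trans ?_)
  rw [mul_assoc]
  gcongr


/-! ### Local approximation on a cell by scaling -/

/-- Taylor's polynomial with the remainder bound. -/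
theorem exists_taylor_polynomial {k : ℕ} {g : ℝ → ℝ} (hg : ContDiff ℝ (k + 1 : ℕ) g) {a d M : ℝ}
    (had : a < d) (hM : ∀ y ∈ Icc a d, |iteratedDeriv (k + 1) g y| ≤ M) :
    ∃ T : ℝ[X], T.natDegree ≤ k ∧ ∀ y ∈ Icc a d, |g y - T.eval y| ≤ M * (d - a) ^ (k + 1) := by
  have hu := uniqueDiffOn_Icc had
  have hM0 : 0 ≤ M := (abs_nonneg _).trans (hM a ⟨le_rfl, had.le⟩)
  refine ⟨∑ j ∈ Finset.range (k + 1), Polynomial.C ((j.factorial : ℝ)⁻¹ *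
    iteratedDerivWithin j g (Icc a d) a) * (Polynomial.X - Polynomial.C a) ^ j, ?_, fun y hy => ?_⟩
  · refine Polynomial.natDegree_sum_le_of_forall_le _ _ fun j hj => ?_
    refine (Polynomial.natDegree_C_mul_le _ _).trans ?_
    rw [Polynomial.natDegree_pow, Polynomial.natDegree_X_sub_C, mul_one]
    have := Finset.mem_range.1 hj; omega
  · have h := taylor_mean_remainder_bound (n := k) (C := M) had.le
      (by exact_mod_cast hg.contDiffOn) hy (fun z hz => by
        rw [iteratedDerivWithin_eq_iteratedDeriv hu hg.contDiffAt hz]; exact hM z hz)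
    rw [taylor_within_apply] at h
    have e1 : (∑ j ∈ Finset.range (k + 1), Polynomial.C ((j.factorial : ℝ)⁻¹ *
        iteratedDerivWithin j g (Icc a d) a) * (Polynomial.X - Polynomial.C a) ^ j).eval y =
        ∑ j ∈ Finset.range (k + 1), ((j.factorial : ℝ)⁻¹ * (y - a) ^ j) •
          iteratedDerivWithin j g (Icc a d) a := by
      rw [Polynomial.eval_finsetSum]
      refine Finset.sum_congr rfl fun j _ => ?_
      simp only [Polynomial.eval_mul, Polynomial.eval_C, Polynomial.eval_pow, Polynomial.eval_sub,
        Polynomial.eval_X, smul_eq_mul]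
      ring
    rw [e1]
    refine h.trans ?_
    have h1 : (1 : ℝ) ≤ (k.factorial : ℝ) := by exact_mod_cast k.factorial_pos
    have h2 : (y - a) ^ (k + 1) ≤ (d - a) ^ (k + 1) := by
      have : 0 ≤ y - a := by linarith [hy.1]
      gcongr; exact hy.2
    have h3 : 0 ≤ (y - a) ^ (k + 1) := pow_nonneg (by linarith [hy.1]) _
    calc M * (y - a) ^ (k + 1) / k.factorial ≤ M * (y - a) ^ (k + 1) :=
          div_le_self (mul_nonneg hM0 h3) h1
      _ ≤ _ := by gcongr

theorem integral_cell {F : ℝ → ℝ} {a d : ℝ} (had : a < d) :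
    ∫ y in a..d, F y = (d - a) * ∫ t in (0 : ℝ)..1, F (a + (d - a) * t) := by
  have h := intervalIntegral.integral_comp_add_mul (a := 0) (b := 1) F (sub_pos.2 had).ne' a
  simp only [mul_zero, add_zero, mul_one, add_sub_cancel, smul_eq_mul] at h
  rw [h, mul_inv_cancel_left₀ (sub_pos.2 had).ne']

/-- Pull back a polynomial to the unit interval. -/
noncomputable def toUnit (a d : ℝ) (p : ℝ[X]) : ℝ[X] :=
  p.comp (Polynomial.C (d - a) * Polynomial.X + Polynomial.C a)

/-- Transport a polynomial from the unit interval to `[a, d]`. -/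
noncomputable def ofUnit (a d : ℝ) (p : ℝ[X]) : ℝ[X] :=
  p.comp (Polynomial.C (d - a)⁻¹ * (Polynomial.X - Polynomial.C a))

theorem eval_toUnit (a d t : ℝ) (p : ℝ[X]) :
    (toUnit a d p).eval t = p.eval (a + (d - a) * t) := by
  simp [toUnit, Polynomial.eval_comp, add_comm]

theorem eval_derivative_toUnit (a d t : ℝ) (p : ℝ[X]) :
    (toUnit a d p).derivative.eval t = (d - a) * p.derivative.eval (a + (d - a) * t) := by
  simp [toUnit, Polynomial.derivative_comp, Polynomial.eval_comp, add_comm]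

theorem eval_ofUnit {a d : ℝ} (had : a < d) (t : ℝ) (p : ℝ[X]) :
    (ofUnit a d p).eval (a + (d - a) * t) = p.eval t := by
  have : (d - a) ≠ 0 := (sub_pos.2 had).ne'
  simp [ofUnit, Polynomial.eval_comp, this]

theorem natDegree_toUnit_le (a d : ℝ) (p : ℝ[X]) : (toUnit a d p).natDegree ≤ p.natDegree := by
  refine Polynomial.natDegree_comp_le.trans ?_
  exact (Nat.mul_le_mul_left _ (Polynomial.natDegree_linear_le)).trans (by simp)

theorem natDegree_ofUnit_le (a d : ℝ) (p : ℝ[X]) : (ofUnit a d p).natDegree ≤ p.natDegree := by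
  refine Polynomial.natDegree_comp_le.trans ?_
  exact (Nat.mul_le_mul_left _ ((Polynomial.natDegree_C_mul_le _ _).trans
    (Polynomial.natDegree_X_sub_C_le _))).trans (by simp)

theorem exists_unit_coord {a d y : ℝ} (had : a < d) (hy : y ∈ Icc a d) :
    ∃ t ∈ Icc (0 : ℝ) 1, y = a + (d - a) * t := by
  have h : 0 < d - a := sub_pos.2 had
  refine ⟨(y - a) / (d - a), ⟨div_nonneg (by linarith [hy.1]) h.le, ?_⟩, by field_simp; ring⟩
  rw [div_le_one h]; linarith [hy.2]

theorem unit_coord_mem {a d t : ℝ} (had : a < d) (ht : t ∈ Icc (0 : ℝ) 1) :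
    a + (d - a) * t ∈ Icc a d := by
  have h : 0 < d - a := sub_pos.2 had
  constructor <;> nlinarith [ht.1, ht.2]

/-- Inverse inequalities on a cell. -/
theorem exists_inverse_inequality_cell (k : ℕ) : ∃ C : ℝ, 0 < C ∧ ∀ (p : ℝ[X]) (a d : ℝ),
    p.natDegree ≤ k → a < d → ∀ y ∈ Icc a d,
      (d - a) * p.eval y ^ 2 ≤ C * ∫ t in a..d, p.eval t ^ 2 ∧
      (d - a) ^ 3 * p.derivative.eval y ^ 2 ≤ C * ∫ t in a..d, p.eval t ^ 2 := by
  obtain ⟨C, hC, h⟩ := exists_inverse_inequality k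
  refine ⟨C, hC, fun p a d hp had y hy => ?_⟩
  obtain ⟨t, ht, rfl⟩ := exists_unit_coord had hy
  obtain ⟨h1, h2⟩ := h (toUnit a d p) ((natDegree_toUnit_le a d p).trans hp) t ht
  simp only [eval_derivative_toUnit] at h2
  simp only [eval_toUnit] at h1 h2
  have h0 : 0 < d - a := sub_pos.2 had
  rw [integral_cell had]
  constructor
  · calc _ ≤ _ := mul_le_mul_of_nonneg_left h1 h0.le
      _ = _ := by ring
  · calc (d - a) ^ 3 * p.derivative.eval (a + (d - a) * t) ^ 2 =
          (d - a) * ((d - a) * p.derivative.eval (a + (d - a) * t)) ^ 2 := by ring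
      _ ≤ _ := mul_le_mul_of_nonneg_left h2 h0.le
      _ = _ := by ring

/-- The Taylor polynomial is left unchanged and only the remainder, of size `h^(k+1)`, is projected
after transport to the unit interval. `right` selects the interpolated endpoint. -/
theorem exists_radau_cell (k : ℕ) : ∃ C : ℝ, 0 < C ∧
    ∀ (g : ℝ → ℝ) (a d M : ℝ) (right : Prop), ContDiff ℝ (k + 1 : ℕ) g → a < d →
      (∀ y ∈ Icc a d, |iteratedDeriv (k + 1) g y| ≤ M) →
      ∃ p : ℝ[X], p.natDegree ≤ k ∧ (right → p.eval d = g d) ∧ (¬ right → p.eval a = g a) ∧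
        (∀ z : ℝ[X], z.natDegree < k → ∫ y in a..d, (g y - p.eval y) * z.eval y = 0) ∧
        ∀ y ∈ Icc a d, |g y - p.eval y| ≤ C * ((d - a) ^ (k + 1) * M) := by
  have key : ∀ s : ℝ, s = 0 ∨ s = 1 → ∃ C : ℝ, 0 < C ∧
    ∀ (g : ℝ → ℝ) (a d M : ℝ), ContDiff ℝ (k + 1 : ℕ) g → a < d →
      (∀ y ∈ Icc a d, |iteratedDeriv (k + 1) g y| ≤ M) →
      ∃ p : ℝ[X], p.natDegree ≤ k ∧ p.eval (a + (d - a) * s) = g (a + (d - a) * s) ∧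
        (∀ z : ℝ[X], z.natDegree < k → ∫ y in a..d, (g y - p.eval y) * z.eval y = 0) ∧
        ∀ y ∈ Icc a d, |g y - p.eval y| ≤ C * ((d - a) ^ (k + 1) * M) := by
    intro s hs
    obtain ⟨C, hC, h⟩ := exists_radau k hs
    refine ⟨1 + C, by positivity, fun g a d M hg had hM => ?_⟩
    obtain ⟨T, hT, hTb⟩ := exists_taylor_polynomial hg had hM
    have hrc : Continuous fun t => g (a + (d - a) * t) - T.eval (a + (d - a) * t) :=
      (hg.continuous.comp (by fun_prop)).sub (T.continuous.comp (by fun_prop))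
    obtain ⟨p, hp, hps, hpo, hpb⟩ := h _ (M * (d - a) ^ (k + 1)) hrc
      fun t ht => hTb _ (unit_coord_mem had ht)
    have hev : ∀ t, (T + ofUnit a d p).eval (a + (d - a) * t) =
        T.eval (a + (d - a) * t) + p.eval t := fun t => by
      rw [Polynomial.eval_add, eval_ofUnit had]
    refine ⟨T + ofUnit a d p, (Polynomial.natDegree_add_le _ _).trans
      (max_le hT ((natDegree_ofUnit_le _ _ _).trans hp)), ?_, fun z hz => ?_, fun y hy => ?_⟩
    · rw [hev, hps]; ring
    · have h1 := hpo (toUnit a d z) ((natDegree_toUnit_le a d z).trans_lt hz)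
      rw [integral_cell had]
      simp only [eval_toUnit] at h1
      have h2 : ∫ t in (0 : ℝ)..1, (g (a + (d - a) * t) - (T + ofUnit a d p).eval (a + (d - a) * t))
          * z.eval (a + (d - a) * t) = ∫ t in (0 : ℝ)..1,
          (g (a + (d - a) * t) - T.eval (a + (d - a) * t) - p.eval t) *
            z.eval (a + (d - a) * t) := by
        refine intervalIntegral.integral_congr fun t _ => ?_
        simp only [hev]; ring
      rw [h2, h1, mul_zero]
    · have h1 := hTb y hy
      obtain ⟨t, ht, rfl⟩ := exists_unit_coord had hy
      rw [hev]
      have h2 := abs_sub (g (a + (d - a) * t) - T.eval (a + (d - a) * t)) (p.eval t)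
      have h3 := hpb t ht
      rw [← sub_sub]
      calc _ ≤ _ := h2
        _ ≤ M * (d - a) ^ (k + 1) + C * (M * (d - a) ^ (k + 1)) := add_le_add h1 h3
        _ = _ := by ring
  obtain ⟨C0, hC0, h0⟩ := key 0 (.inl rfl)
  obtain ⟨C1, hC1, h1⟩ := key 1 (.inr rfl)
  refine ⟨C0 + C1, by positivity, fun g a d M right hg had hM => ?_⟩
  have hM0 : 0 ≤ (d - a) ^ (k + 1) * M :=
    mul_nonneg (pow_nonneg (sub_pos.2 had).le _) ((abs_nonneg _).trans (hM a ⟨le_rfl, had.le⟩))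
  by_cases hr : right
  · obtain ⟨p, hp, hps, hpo, hpb⟩ := h1 g a d M hg had hM
    refine ⟨p, hp, fun _ => by simpa using hps, fun h => absurd hr h, hpo, fun y hy =>
      (hpb y hy).trans ?_⟩
    gcongr; linarith
  · obtain ⟨p, hp, hps, hpo, hpb⟩ := h0 g a d M hg had hM
    refine ⟨p, hp, fun h => absurd h hr, fun _ => by simpa using hps, hpo, fun y hy =>
      (hpb y hy).trans ?_⟩
    gcongr; linarith

/-- Scaling transports the weight along with the Taylor remainder and leaves its bounds unchanged,
so the constant does not depend on the cell. -/
theorem exists_weighted_projection_cell (k : ℕ) {β₀ B : ℝ} (hβ₀ : 0 < β₀) (hB : 0 < B) :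
    ∃ C : ℝ, 0 < C ∧ ∀ (b g : ℝ → ℝ) (a d M : ℝ), Continuous b → ContDiff ℝ (k + 1 : ℕ) g →
      a < d → (∀ y ∈ Icc a d, β₀ ≤ b y) → (∀ y ∈ Icc a d, b y ≤ B) →
      (∀ y ∈ Icc a d, |iteratedDeriv (k + 1) g y| ≤ M) →
      ∃ p : ℝ[X], p.natDegree ≤ k ∧
        (∀ z : ℝ[X], z.natDegree ≤ k → ∫ y in a..d, b y * (g y - p.eval y) * z.eval y = 0) ∧
        ∀ y ∈ Icc a d, |g y - p.eval y| ≤ C * ((d - a) ^ (k + 1) * M) := by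
  obtain ⟨C, hC, h⟩ := exists_weighted_projection k hβ₀ hB
  refine ⟨1 + C, by positivity, fun b g a d M hb hg had hβb hbB hM => ?_⟩
  obtain ⟨T, hT, hTb⟩ := exists_taylor_polynomial hg had hM
  have hrc : Continuous fun t => g (a + (d - a) * t) - T.eval (a + (d - a) * t) :=
    (hg.continuous.comp (by fun_prop)).sub (T.continuous.comp (by fun_prop))
  obtain ⟨p, hp, hpo, hpb⟩ := h (fun t => b (a + (d - a) * t)) _ (M * (d - a) ^ (k + 1))
    (hb.comp (by fun_prop)) hrc (fun t ht => hβb _ (unit_coord_mem had ht))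
    (fun t ht => hbB _ (unit_coord_mem had ht)) fun t ht => hTb _ (unit_coord_mem had ht)
  have hev : ∀ t, (T + ofUnit a d p).eval (a + (d - a) * t) =
      T.eval (a + (d - a) * t) + p.eval t := fun t => by
    rw [Polynomial.eval_add, eval_ofUnit had]
  refine ⟨T + ofUnit a d p, (Polynomial.natDegree_add_le _ _).trans
    (max_le hT ((natDegree_ofUnit_le _ _ _).trans hp)), fun z hz => ?_, fun y hy => ?_⟩
  · have h1 := hpo (toUnit a d z) ((natDegree_toUnit_le a d z).trans hz)
    rw [integral_cell had]
    simp only [eval_toUnit] at h1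
    have h2 : ∫ t in (0 : ℝ)..1, b (a + (d - a) * t) *
        (g (a + (d - a) * t) - (T + ofUnit a d p).eval (a + (d - a) * t))
        * z.eval (a + (d - a) * t) = ∫ t in (0 : ℝ)..1, b (a + (d - a) * t) *
        (g (a + (d - a) * t) - T.eval (a + (d - a) * t) - p.eval t) *
          z.eval (a + (d - a) * t) := by
      refine intervalIntegral.integral_congr fun t _ => ?_
      simp only [hev]; ring
    rw [h2, h1, mul_zero]
  · have h1 := hTb y hy
    obtain ⟨t, ht, rfl⟩ := exists_unit_coord had hy
    rw [hev]
    have h2 := abs_sub (g (a + (d - a) * t) - T.eval (a + (d - a) * t)) (p.eval t)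
    have h3 := hpb t ht
    rw [← sub_sub]
    calc _ ≤ _ := h2
      _ ≤ M * (d - a) ^ (k + 1) + C * (M * (d - a) ^ (k + 1)) := add_le_add h1 h3
      _ = _ := by ring


/-! ### Bilinear form of the scheme: consistency and coercivity -/

/-- The flux of `u` for a family of functions, one for each cell. -/
noncomputable def cellFluxU (e : ℝ) (x : ℕ → ℝ) (n : ℕ) (q u : ℕ → ℝ → ℝ) (i : ℕ) : ℝ :=
  if i = 0 ∨ i = 4 * n then 0
  else if i = 3 * n then u (i - 1) (x i) - e⁻¹ * (q (i - 1) (x i) - q i (x i))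
  else u (i - 1) (x i)

/-- The flux of `q` for a family of functions, one for each cell. -/
noncomputable def cellFluxQ (e : ℝ) (x : ℕ → ℝ) (n : ℕ) (q u : ℕ → ℝ → ℝ) (i : ℕ) : ℝ :=
  if i = 0 then q 0 (x 0) + e * u 0 (x 0)
  else if i = 4 * n then q (i - 1) (x i) - e * u (i - 1) (x i)
  else q i (x i)

/-- The left-hand side of the first equation of the scheme on the cell `i`. -/
noncomputable def formQ (e : ℝ) (x : ℕ → ℝ) (n : ℕ) (q u : ℕ → ℝ → ℝ) (i : ℕ) (r : ℝ[X]) : ℝ :=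
  (e ^ 2)⁻¹ * (∫ y in (x i)..(x (i + 1)), q i y * r.eval y) +
    (∫ y in (x i)..(x (i + 1)), u i y * r.derivative.eval y) -
    cellFluxU e x n q u (i + 1) * r.eval (x (i + 1)) + cellFluxU e x n q u i * r.eval (x i)

/-- The left-hand side of the second equation of the scheme on the cell `i`. -/
noncomputable def formU (e : ℝ) (b : ℝ → ℝ) (x : ℕ → ℝ) (n : ℕ) (q u : ℕ → ℝ → ℝ) (i : ℕ)
    (v : ℝ[X]) : ℝ :=
  (∫ y in (x i)..(x (i + 1)), q i y * v.derivative.eval y) +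
    (∫ y in (x i)..(x (i + 1)), b y * u i y * v.eval y) -
    cellFluxQ e x n q u (i + 1) * v.eval (x (i + 1)) + cellFluxQ e x n q u i * v.eval (x i)

theorem cellFluxU_sub (e : ℝ) (x : ℕ → ℝ) (n : ℕ) (q u q' u' : ℕ → ℝ → ℝ) (i : ℕ) :
    cellFluxU e x n (fun i y => q i y - q' i y) (fun i y => u i y - u' i y) i =
      cellFluxU e x n q u i - cellFluxU e x n q' u' i := by
  unfold cellFluxU; split_ifs <;> ring

theorem cellFluxQ_sub (e : ℝ) (x : ℕ → ℝ) (n : ℕ) (q u q' u' : ℕ → ℝ → ℝ) (i : ℕ) :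
    cellFluxQ e x n (fun i y => q i y - q' i y) (fun i y => u i y - u' i y) i =
      cellFluxQ e x n q u i - cellFluxQ e x n q' u' i := by
  unfold cellFluxQ; split_ifs <;> ring

theorem integral_sub_mul {f g h : ℝ → ℝ} (hf : Continuous f) (hg : Continuous g)
    (hh : Continuous h) (a d : ℝ) : ∫ y in a..d, (f y - g y) * h y =
      (∫ y in a..d, f y * h y) - ∫ y in a..d, g y * h y := by
  rw [← intervalIntegral.integral_sub (Continuous.intervalIntegrable (by fun_prop) _ _)
    (Continuous.intervalIntegrable (by fun_prop) _ _)]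
  exact intervalIntegral.integral_congr fun y _ => sub_mul _ _ _

theorem formQ_sub {e : ℝ} {x : ℕ → ℝ} {n : ℕ} {q u q' u' : ℕ → ℝ → ℝ}
    (hq : ∀ i, Continuous (q i)) (hu : ∀ i, Continuous (u i))
    (hq' : ∀ i, Continuous (q' i)) (hu' : ∀ i, Continuous (u' i)) (i : ℕ) (r : ℝ[X]) :
    formQ e x n (fun i y => q i y - q' i y) (fun i y => u i y - u' i y) i r =
      formQ e x n q u i r - formQ e x n q' u' i r := by
  unfold formQ
  rw [cellFluxU_sub, cellFluxU_sub, integral_sub_mul (hq i) (hq' i) r.continuous,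
    integral_sub_mul (hu i) (hu' i) r.derivative.continuous]
  ring

theorem formU_sub {e : ℝ} {b : ℝ → ℝ} (hb : Continuous b) {x : ℕ → ℝ} {n : ℕ}
    {q u q' u' : ℕ → ℝ → ℝ}
    (hq : ∀ i, Continuous (q i)) (hu : ∀ i, Continuous (u i))
    (hq' : ∀ i, Continuous (q' i)) (hu' : ∀ i, Continuous (u' i)) (i : ℕ) (v : ℝ[X]) :
    formU e b x n (fun i y => q i y - q' i y) (fun i y => u i y - u' i y) i v =
      formU e b x n q u i v - formU e b x n q' u' i v := by
  unfold formU
  have := integral_sub_mul (hb.mul (hu i)) (hb.mul (hu' i)) v.continuous (x i) (x (i + 1))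
  simp only [Pi.mul_apply, ← mul_sub] at this
  rw [cellFluxQ_sub, cellFluxQ_sub, integral_sub_mul (hq i) (hq' i) v.derivative.continuous, this]
  ring

theorem integral_by_parts_eval {w : ℝ → ℝ} (hw : ContDiff ℝ 1 w) (r : ℝ[X]) (a d : ℝ) :
    (∫ y in a..d, deriv w y * r.eval y) + ∫ y in a..d, w y * r.derivative.eval y =
      w d * r.eval d - w a * r.eval a := by
  have hd : Continuous (deriv w) := hw.continuous_deriv le_rfl
  have hc := hw.continuous
  rw [← intervalIntegral.integral_add (Continuous.intervalIntegrable (by fun_prop) _ _)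
    (Continuous.intervalIntegrable (by fun_prop) _ _)]
  exact intervalIntegral.integral_eq_sub_of_hasDerivAt (f := fun y => w y * r.eval y)
    (fun y _ => ((hw.differentiable (by simp)) y).hasDerivAt.fun_mul (r.hasDerivAt y))
    (Continuous.intervalIntegrable (by fun_prop) _ _)

/-- For a smooth pair the jumps vanish, so every flux is the value of `w`, at the boundary because
`w` is zero there. What remains is integration by parts; no differential equation is used. -/
theorem formQ_exact {e : ℝ} (he : 0 < e) {x : ℕ → ℝ} {n : ℕ} {w : ℝ → ℝ}
    (hw : ContDiff ℝ 1 w) (h0 : w (x 0) = 0) (h1 : w (x (4 * n)) = 0) (i : ℕ) (r : ℝ[X]) :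
    formQ e x n (fun _ y => e ^ 2 * deriv w y) (fun _ => w) i r = 0 := by
  have hF : ∀ i, cellFluxU e x n (fun _ y => e ^ 2 * deriv w y) (fun _ => w) i = w (x i) := by
    intro i
    unfold cellFluxU
    split_ifs with h
    · rcases h with rfl | rfl
      · exact h0.symm
      · exact h1.symm
    · ring
    · rfl
  have hi := integral_by_parts_eval hw r (x i) (x (i + 1))
  unfold formQ
  rw [hF, hF]
  simp only [mul_assoc]
  rw [intervalIntegral.integral_const_mul, inv_mul_cancel_left₀ (by positivity)]
  linarith

/-- The operator applied to `w` appears, not `f`: `w` will be the comparison function rather than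
the solution, and the difference becomes a source term of the error equation. -/
theorem formU_exact {e : ℝ} {x : ℕ → ℝ} {n : ℕ} {b w : ℝ → ℝ} (hb : Continuous b)
    (hw : ContDiff ℝ 2 w) (h0 : w (x 0) = 0) (h1 : w (x (4 * n)) = 0) (i : ℕ) (v : ℝ[X]) :
    formU e b x n (fun _ y => e ^ 2 * deriv w y) (fun _ => w) i v =
      ∫ y in (x i)..(x (i + 1)), (-e ^ 2 * deriv (deriv w) y + b y * w y) * v.eval y := by
  have hF : ∀ i, cellFluxQ e x n (fun _ y => e ^ 2 * deriv w y) (fun _ => w) i =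
      e ^ 2 * deriv w (x i) := by
    intro i
    unfold cellFluxQ
    split_ifs with h h'
    · subst h; simp [h0]
    · subst h'; simp [h1]
    · rfl
  have hw' : ContDiff ℝ 1 (deriv w) := ContDiff.deriv_nat (n := 1) hw
  have hc := hw.continuous
  have hc2 : Continuous (deriv (deriv w)) := hw'.continuous_deriv le_rfl
  have hi := integral_by_parts_eval hw' v (x i) (x (i + 1))
  have hs : ∫ y in (x i)..(x (i + 1)), (-e ^ 2 * deriv (deriv w) y + b y * w y) * v.eval y =
      (-e ^ 2 * ∫ y in (x i)..(x (i + 1)), deriv (deriv w) y * v.eval y) +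
        ∫ y in (x i)..(x (i + 1)), b y * w y * v.eval y := by
    rw [← intervalIntegral.integral_const_mul,
      ← intervalIntegral.integral_add (Continuous.intervalIntegrable (by fun_prop) _ _)
        (Continuous.intervalIntegrable (by fun_prop) _ _)]
    exact intervalIntegral.integral_congr fun y _ => by ring
  unfold formU
  rw [hF, hF, hs]
  simp only [mul_assoc (e ^ 2)]
  rw [intervalIntegral.integral_const_mul]
  linear_combination e ^ 2 * hi

/-- Regroups the endpoint contributions of the cells by nodes. -/
theorem sum_range_succ_sub (R L : ℕ → ℝ) (m : ℕ) : ∑ i ∈ Finset.range (m + 1), (R i - L i) =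
    ∑ i ∈ Finset.range m, (R i - L (i + 1)) + (R m - L 0) := by
  rw [Finset.sum_sub_distrib, Finset.sum_sub_distrib, Finset.sum_range_succ,
    Finset.sum_range_succ' L]
  ring

/-- Coercivity of the scheme, as an identity. -/
theorem sum_form_self {e : ℝ} {x : ℕ → ℝ} {n : ℕ} (hn : 1 ≤ n) {b : ℝ → ℝ} (p z : ℕ → ℝ[X]) :
    ∑ i ∈ Finset.range (4 * n), (formQ e x n (fun i y => (p i).eval y)
        (fun i y => (z i).eval y) i (p i) +
        formU e b x n (fun i y => (p i).eval y) (fun i y => (z i).eval y) i (z i)) =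
      (∑ i ∈ Finset.range (4 * n), ((e ^ 2)⁻¹ * (∫ y in (x i)..(x (i + 1)), (p i).eval y ^ 2) +
        ∫ y in (x i)..(x (i + 1)), b y * (z i).eval y ^ 2)) +
      e * ((z 0).eval (x 0) ^ 2 + (z (4 * n - 1)).eval (x (4 * n)) ^ 2) +
      e⁻¹ * ((p (3 * n - 1)).eval (x (3 * n)) - (p (3 * n)).eval (x (3 * n))) ^ 2 := by
  set fU := cellFluxU e x n (fun i y => (p i).eval y) (fun i y => (z i).eval y) with hfU
  set fQ := cellFluxQ e x n (fun i y => (p i).eval y) (fun i y => (z i).eval y) with hfQ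
  -- Integration by parts leaves endpoint values only, collected in `R` and `L` for the right and
  -- left ends. The alternating fluxes cancel them at each interior node except `3n`; there and at
  -- the boundary the stabilisation leaves squares.
  set R : ℕ → ℝ := fun i => (z i).eval (x (i + 1)) * (p i).eval (x (i + 1)) -
    fU (i + 1) * (p i).eval (x (i + 1)) - fQ (i + 1) * (z i).eval (x (i + 1)) with hR
  set L : ℕ → ℝ := fun i => (z i).eval (x i) * (p i).eval (x i) -
    fU i * (p i).eval (x i) - fQ i * (z i).eval (x i) with hL
  have hcell : ∀ i, formQ e x n (fun i y => (p i).eval y) (fun i y => (z i).eval y) i (p i) +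
        formU e b x n (fun i y => (p i).eval y) (fun i y => (z i).eval y) i (z i) =
      ((e ^ 2)⁻¹ * (∫ y in (x i)..(x (i + 1)), (p i).eval y ^ 2) +
        ∫ y in (x i)..(x (i + 1)), b y * (z i).eval y ^ 2) + (R i - L i) := by
    intro i
    have hparts := integral_by_parts_eval (w := fun y => (z i).eval y) (by simpa using (z i).contDiff_aeval (𝕜 := ℝ) 1) (p i)
      (x i) (x (i + 1))
    simp only [Polynomial.deriv] at hparts
    have h1 : ∫ y in (x i)..(x (i + 1)), (z i).derivative.eval y * (p i).eval y =
        ∫ y in (x i)..(x (i + 1)), (p i).eval y * (z i).derivative.eval y :=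
      intervalIntegral.integral_congr fun y _ => mul_comm _ _
    rw [h1] at hparts
    unfold formQ formU
    simp only [mul_assoc, ← sq]
    simp only [hR, hL, hfU, hfQ]
    linear_combination hparts
  have htel : ∑ i ∈ Finset.range (4 * n), (R i - L i) =
      e * ((z 0).eval (x 0) ^ 2 + (z (4 * n - 1)).eval (x (4 * n)) ^ 2) +
      e⁻¹ * ((p (3 * n - 1)).eval (x (3 * n)) - (p (3 * n)).eval (x (3 * n))) ^ 2 := by
    obtain ⟨m, hm⟩ : ∃ m, 4 * n = m + 1 := ⟨4 * n - 1, by omega⟩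
    obtain ⟨l, hl⟩ : ∃ l, 3 * n = l + 1 := ⟨3 * n - 1, by omega⟩
    have h1 : ∑ i ∈ Finset.range (4 * n), (R i - L i) =
        ∑ i ∈ Finset.range m, (R i - L (i + 1)) + (R m - L 0) := by
      rw [hm, sum_range_succ_sub]
    have h2 : ∑ i ∈ Finset.range m, (R i - L (i + 1)) = R l - L (l + 1) := by
      refine Finset.sum_eq_single l (fun i hi hne => ?_) (fun h => ?_)
      · have := Finset.mem_range.1 hi
        have a2 : i + 1 ≠ 3 * n := by omega
        have a3 : i + 1 ≠ 4 * n := by omega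
        simp only [hR, hL, hfU, hfQ, cellFluxU, cellFluxQ, a2, a3, if_false,
          Nat.add_sub_cancel, Nat.succ_ne_zero, or_self]
        ring
      · exact absurd (Finset.mem_range.2 (by omega)) h
    have h3 : R l - L (l + 1) =
        e⁻¹ * ((p (3 * n - 1)).eval (x (3 * n)) - (p (3 * n)).eval (x (3 * n))) ^ 2 := by
      have a3 : l + 1 ≠ 4 * n := by omega
      simp only [hR, hL, hfU, hfQ, cellFluxU, cellFluxQ, hl, a3, if_false, if_true,
        Nat.add_sub_cancel, Nat.succ_ne_zero, or_self]
      ring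
    have h4 : R m = e * (z (4 * n - 1)).eval (x (4 * n)) ^ 2 := by
      simp only [hR, hfU, hfQ, cellFluxU, cellFluxQ, ← hm, if_true, or_true]
      rw [if_neg (by omega), show 4 * n - 1 = m by omega]
      ring
    have h5 : L 0 = -(e * (z 0).eval (x 0) ^ 2) := by
      simp only [hL, hfU, hfQ, cellFluxU, cellFluxQ, if_true, true_or]
      ring
    rw [h1, h2, h3, h4, h5]
    ring
  rw [Finset.sum_congr rfl fun i _ => hcell i, Finset.sum_add_distrib, htel]
  ring

/-! ### Energy estimate for the discrete part of the error -/

theorem mul_le_young {a s c : ℝ} (hc : 0 < c) : a * s ≤ c * s ^ 2 + a ^ 2 / (4 * c) := by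
  have h : 0 ≤ (2 * c * s - a) ^ 2 / (4 * c) := by positivity
  have e1 : (2 * c * s - a) ^ 2 / (4 * c) = c * s ^ 2 + a ^ 2 / (4 * c) - a * s := by
    field_simp; ring
  linarith

theorem integral_mul_le_young {f g : ℝ → ℝ} (hf : Continuous f) (hg : Continuous g) {a d : ℝ}
    (had : a ≤ d) : ∫ y in a..d, f y * g y ≤
      2 * (∫ y in a..d, f y ^ 2) + 1 / 8 * ∫ y in a..d, g y ^ 2 := by
  rw [← intervalIntegral.integral_const_mul, ← intervalIntegral.integral_const_mul,
    ← intervalIntegral.integral_add (Continuous.intervalIntegrable (by fun_prop) _ _)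
      (Continuous.intervalIntegrable (by fun_prop) _ _)]
  refine intervalIntegral.integral_mono_on had (Continuous.intervalIntegrable (by fun_prop) _ _)
    (Continuous.intervalIntegrable (by fun_prop) _ _) fun y _ => ?_
  nlinarith [sq_nonneg (4 * f y - g y)]

theorem integral_sq_le_of_abs_le {f : ℝ → ℝ} (hf : Continuous f) {a d M : ℝ}
    (had : a ≤ d) (h : ∀ y ∈ Icc a d, |f y| ≤ M) : ∫ y in a..d, f y ^ 2 ≤ (d - a) * M ^ 2 := by
  have : ∫ y in a..d, f y ^ 2 ≤ ∫ _y in a..d, M ^ 2 := by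
    refine intervalIntegral.integral_mono_on had
      (Continuous.intervalIntegrable (by fun_prop) _ _) (by simp) fun y hy => ?_
    rw [← sq_abs]; gcongr; exact h y hy
  simpa using this


theorem integral_weighted_le_young {b f g : ℝ → ℝ} (hb : Continuous b) (hf : Continuous f)
    (hg : Continuous g) {a d B M : ℝ} (had : a ≤ d) (hb0 : ∀ y ∈ Icc a d, 0 ≤ b y)
    (hbB : ∀ y ∈ Icc a d, b y ≤ B) (hM : ∀ y ∈ Icc a d, |f y| ≤ M) :
    ∫ y in a..d, b y * f y * g y ≤
      2 * B * ((d - a) * M ^ 2) + 1 / 8 * ∫ y in a..d, b y * g y ^ 2 := by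
  have hc : ∫ y in a..d, 2 * B * M ^ 2 = 2 * B * ((d - a) * M ^ 2) := by
    rw [intervalIntegral.integral_const, smul_eq_mul]; ring
  rw [← hc, ← intervalIntegral.integral_const_mul,
    ← intervalIntegral.integral_add (by simp)
      (Continuous.intervalIntegrable (by fun_prop) _ _)]
  refine intervalIntegral.integral_mono_on had (Continuous.intervalIntegrable (by fun_prop) _ _)
    (Continuous.intervalIntegrable (by fun_prop) _ _) fun y hy => ?_
  have h1 := hb0 y hy
  have h2 : f y ^ 2 ≤ M ^ 2 := by rw [← sq_abs]; gcongr; exact hM y hy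
  have h3 : b y * f y ^ 2 ≤ B * M ^ 2 := by
    have := hbB y hy
    have : 0 ≤ f y ^ 2 := sq_nonneg _
    gcongr
    exact h1.trans (hbB y hy)
  have h4 : 0 ≤ b y * (4 * f y - g y) ^ 2 := mul_nonneg h1 (sq_nonneg _)
  nlinarith

theorem integral_source_le_young {b G g : ℝ → ℝ} (hb : Continuous b) (hG : Continuous G)
    (hg : Continuous g) {a d β : ℝ} (had : a ≤ d) (hβ : 0 < β) (hbβ : ∀ y ∈ Icc a d, β ^ 2 ≤ b y) :
    ∫ y in a..d, G y * g y ≤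
      2 / β ^ 2 * (∫ y in a..d, G y ^ 2) + 1 / 8 * ∫ y in a..d, b y * g y ^ 2 := by
  rw [← intervalIntegral.integral_const_mul, ← intervalIntegral.integral_const_mul,
    ← intervalIntegral.integral_add (Continuous.intervalIntegrable (by fun_prop) _ _)
      (Continuous.intervalIntegrable (by fun_prop) _ _)]
  refine intervalIntegral.integral_mono_on had (Continuous.intervalIntegrable (by fun_prop) _ _)
    (Continuous.intervalIntegrable (by fun_prop) _ _) fun y hy => ?_
  have h1 : β ^ 2 * g y ^ 2 ≤ b y * g y ^ 2 := by
    have := hbβ y hy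
    gcongr
  have h2 := mul_le_young (a := G y) (s := g y) (c := β ^ 2 / 8) (by positivity)
  have h3 : G y ^ 2 / (4 * (β ^ 2 / 8)) = 2 / β ^ 2 * G y ^ 2 := by field_simp; ring
  rw [h3] at h2
  linarith

/-- Bound for a product `a s` where `s²` is controlled through an inverse inequality. -/
theorem mul_le_of_inverse {a s D e n Ci A : ℝ} (he : 0 < e) (hn : 0 < n) (hCi : 0 < Ci)
    (ha : |a| ≤ D) (hs : s ^ 2 ≤ 4 * n * Ci * A) :
    a * s ≤ (e ^ 2)⁻¹ * (1 / 24 * A) + 24 * n * Ci * e ^ 2 * D ^ 2 := by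
  -- The parameter leaves the share 1/24 of the energy of a cell: a coarse cell has three such
  -- terms, two traces and one derivative term, and 1/8 is reserved for them.
  have h := mul_le_young (a := a) (s := s) (c := (e ^ 2)⁻¹ / (96 * n * Ci)) (by positivity)
  have h1 : a ^ 2 ≤ D ^ 2 := by rw [← sq_abs]; gcongr
  have h2 : a ^ 2 / (4 * ((e ^ 2)⁻¹ / (96 * n * Ci))) = 24 * n * Ci * e ^ 2 * a ^ 2 := by
    field_simp; ring
  have h3 : (e ^ 2)⁻¹ / (96 * n * Ci) * s ^ 2 ≤
      (e ^ 2)⁻¹ / (96 * n * Ci) * (4 * n * Ci * A) := by gcongr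
  have h4 : (e ^ 2)⁻¹ / (96 * n * Ci) * (4 * n * Ci * A) = (e ^ 2)⁻¹ * (1 / 24 * A) := by
    field_simp; ring
  have h5 : 24 * n * Ci * e ^ 2 * a ^ 2 ≤ 24 * n * Ci * e ^ 2 * D ^ 2 := by gcongr
  linarith

/-- The contribution of one cell to the first part of the residual, away from the penalised
node. -/
theorem residual_cell_le {k : ℕ} {e n Ci : ℝ} (he : 0 < e) (hn : 0 < n) (hCi : 0 < Ci)
    (hinv : ∀ (p : ℝ[X]) (a d : ℝ), p.natDegree ≤ k → a < d → ∀ y ∈ Icc a d,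
      (d - a) * p.eval y ^ 2 ≤ Ci * ∫ t in a..d, p.eval t ^ 2 ∧
      (d - a) ^ 3 * p.derivative.eval y ^ 2 ≤ Ci * ∫ t in a..d, p.eval t ^ 2)
    {p : ℝ[X]} (hp : p.natDegree ≤ k) {a d F₀ F₁ D dq : ℝ} (had : a < d)
    (hwidth : 1 ≤ 4 * n * (d - a))
    {ηq ηu : ℝ → ℝ} (hq : Continuous ηq) (hηq : ∀ y ∈ Icc a d, |ηq y| ≤ dq)
    (hηu : ∀ y ∈ Icc a d, |ηu y| ≤ D) (hF₀ : |F₀| ≤ D) (hF₁ : |F₁| ≤ D) :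
    (e ^ 2)⁻¹ * (∫ y in a..d, ηq y * p.eval y) + (∫ y in a..d, ηu y * p.derivative.eval y) -
      F₁ * p.eval d + F₀ * p.eval a ≤
      (e ^ 2)⁻¹ * (2 * ((d - a) * dq ^ 2) + 1 / 4 * ∫ y in a..d, p.eval y ^ 2) +
        72 * n * Ci * e ^ 2 * D ^ 2 := by
  have h0 : 0 < d - a := sub_pos.2 had
  set A := ∫ y in a..d, p.eval y ^ 2 with hA
  have hA0 : 0 ≤ A := intervalIntegral.integral_nonneg had.le fun t _ => sq_nonneg _
  have hpc := p.continuous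
  have h1 := integral_mul_le_young hq hpc had.le
  have h2 := integral_sq_le_of_abs_le hq had.le hηq
  -- A coarse cell has width at least `1 / (4n)`, so the inverse inequality costs a factor `4n`.
  have hpt : ∀ y ∈ Icc a d, p.eval y ^ 2 ≤ 4 * n * Ci * A := by
    intro y hy
    have h3 := (hinv p a d hp had y hy).1
    calc p.eval y ^ 2 ≤ 4 * n * (d - a) * p.eval y ^ 2 :=
          le_mul_of_one_le_left (sq_nonneg _) hwidth
      _ = 4 * n * ((d - a) * p.eval y ^ 2) := by ring
      _ ≤ 4 * n * (Ci * A) := by gcongr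
      _ = _ := by ring
  have h3 := mul_le_of_inverse (a := -F₁) (D := D) he hn hCi (by rwa [abs_neg]) (hpt d ⟨had.le, le_rfl⟩)
  have h4 := mul_le_of_inverse (a := F₀) he hn hCi hF₀ (hpt a ⟨le_rfl, had.le⟩)
  have hD0 : 0 ≤ D := (abs_nonneg _).trans hF₀
  -- The derivative costs `h^(-3/2)` pointwise; integration over the cell returns `h`, so this term
  -- is no more expensive than a trace.
  set S := √(Ci * A / (d - a) ^ 3) with hS
  have hS2 : S ^ 2 = Ci * A / (d - a) ^ 3 := Real.sq_sqrt (by positivity)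
  have hSb : ∀ y ∈ Icc a d, |p.derivative.eval y| ≤ S := by
    intro y hy
    refine Real.abs_le_sqrt ?_
    rw [le_div_iff₀ (by positivity), mul_comm]
    exact (hinv p a d hp had y hy).2
  have h5 : ∫ y in a..d, ηu y * p.derivative.eval y ≤ D * (S * (d - a)) := by
    have := intervalIntegral.norm_integral_le_of_norm_le_const (a := a) (b := d)
      (f := fun y => ηu y * p.derivative.eval y) (C := D * S) fun y hy => by
        rw [uIoc_of_le had.le] at hy
        have hy' : y ∈ Icc a d := ⟨hy.1.le, hy.2⟩
        rw [Real.norm_eq_abs, abs_mul]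
        exact mul_le_mul (hηu y hy') (hSb y hy') (abs_nonneg _) hD0
    rw [abs_of_pos h0] at this
    exact (Real.le_norm_self _).trans (this.trans_eq (by ring))
  have h6 : (S * (d - a)) ^ 2 ≤ 4 * n * Ci * A := by
    have e1 : (S * (d - a)) ^ 2 = Ci * A / (d - a) := by
      rw [mul_pow, hS2]; field_simp
    rw [e1, div_le_iff₀ h0]
    have : 0 ≤ Ci * A := by positivity
    calc Ci * A ≤ 4 * n * (d - a) * (Ci * A) := le_mul_of_one_le_left this hwidth
      _ = _ := by ring
  have h7 := mul_le_of_inverse (a := D) he hn hCi (by rw [abs_of_nonneg hD0]) h6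
  have h8 : (e ^ 2)⁻¹ * (∫ y in a..d, ηq y * p.eval y) ≤
      (e ^ 2)⁻¹ * (2 * ((d - a) * dq ^ 2) + 1 / 8 * A) := by
    have : 0 < (e ^ 2)⁻¹ := by positivity
    gcongr
    linarith
  have h9 : (e ^ 2)⁻¹ * (2 * ((d - a) * dq ^ 2) + 1 / 4 * A) =
      (e ^ 2)⁻¹ * (2 * ((d - a) * dq ^ 2) + 1 / 8 * A) + 3 * ((e ^ 2)⁻¹ * (1 / 24 * A)) := by ring
  rw [h9]
  linarith

/-- The energy estimate for the discrete part of the error, in terms of pointwise bounds for the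
approximation error `(ηq, ηu)`. -/
theorem discrete_estimate {k n : ℕ} (hk : 1 ≤ k) (hn : 1 ≤ n) {e β B Ci : ℝ} (he : 0 < e)
    (hβ : 0 < β) (hCi : 0 < Ci)
    (hinv : ∀ (p : ℝ[X]) (a d : ℝ), p.natDegree ≤ k → a < d → ∀ y ∈ Icc a d,
      (d - a) * p.eval y ^ 2 ≤ Ci * ∫ t in a..d, p.eval t ^ 2 ∧
      (d - a) ^ 3 * p.derivative.eval y ^ 2 ≤ Ci * ∫ t in a..d, p.eval t ^ 2)
    {b G : ℝ → ℝ} (hb : Continuous b) (hG : Continuous G) {x : ℕ → ℝ}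
    (hx : ∀ i < 4 * n, x i < x (i + 1))
    (hbβ : ∀ i < 4 * n, ∀ y ∈ Icc (x i) (x (i + 1)), β ^ 2 ≤ b y)
    (hbB : ∀ i < 4 * n, ∀ y ∈ Icc (x i) (x (i + 1)), b y ≤ B)
    (hwidth : ∀ i, n ≤ i → i < 3 * n → 1 ≤ 4 * (n : ℝ) * (x (i + 1) - x i))
    {p z : ℕ → ℝ[X]} (hp : ∀ i, (p i).natDegree ≤ k) (hz : ∀ i, (z i).natDegree ≤ k)
    {ηq ηu : ℕ → ℝ → ℝ} (hηq : ∀ i, Continuous (ηq i)) (hηu : ∀ i, Continuous (ηu i))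
    (hQ : ∀ i < 4 * n, formQ e x n (fun i y => (p i).eval y) (fun i y => (z i).eval y) i (p i) =
      formQ e x n ηq ηu i (p i))
    (hU : ∀ i < 4 * n, formU e b x n (fun i y => (p i).eval y) (fun i y => (z i).eval y) i (z i) =
      formU e b x n ηq ηu i (z i) + ∫ y in (x i)..(x (i + 1)), G y * (z i).eval y)
    (hq0 : ∀ i < 4 * n, ∀ r : ℝ[X], r.natDegree < k →
      ∫ y in (x i)..(x (i + 1)), ηq i y * r.eval y = 0)
    (hqx : ∀ i < 4 * n, ηq i (x i) = 0)
    (hu0 : ∀ i < 4 * n, i < n ∨ 3 * n ≤ i → ∀ r : ℝ[X], r.natDegree < k →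
      ∫ y in (x i)..(x (i + 1)), ηu i y * r.eval y = 0)
    (hux : ∀ i < 4 * n, i < n ∨ 3 * n ≤ i → ηu i (x (i + 1)) = 0)
    (hub : ∀ i, n ≤ i → i < 3 * n → ∀ r : ℝ[X], r.natDegree ≤ k →
      ∫ y in (x i)..(x (i + 1)), b y * ηu i y * r.eval y = 0)
    {dq du : ℕ → ℝ} {Dq Du : ℝ}
    (hdq : ∀ i < 4 * n, ∀ y ∈ Icc (x i) (x (i + 1)), |ηq i y| ≤ dq i)
    (hdu : ∀ i < 4 * n, ∀ y ∈ Icc (x i) (x (i + 1)), |ηu i y| ≤ du i)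
    (hDu : ∀ i, n ≤ i → i < 3 * n → du i ≤ Du) (hDq : dq (3 * n - 1) ≤ Dq) :
    (∑ i ∈ Finset.range (4 * n), ((e ^ 2)⁻¹ * (∫ y in (x i)..(x (i + 1)), (p i).eval y ^ 2) +
        ∫ y in (x i)..(x (i + 1)), b y * (z i).eval y ^ 2)) +
      e * ((z 0).eval (x 0) ^ 2 + (z (4 * n - 1)).eval (x (4 * n)) ^ 2) +
      e⁻¹ * ((p (3 * n - 1)).eval (x (3 * n)) - (p (3 * n)).eval (x (3 * n))) ^ 2 ≤
    2 * ((∑ i ∈ Finset.range (4 * n), ((e ^ 2)⁻¹ * (2 * ((x (i + 1) - x i) * dq i ^ 2)) +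
          (if i < n ∨ 3 * n ≤ i then 2 * B * ((x (i + 1) - x i) * du i ^ 2) else 0) +
          2 / β ^ 2 * ∫ y in (x i)..(x (i + 1)), G y ^ 2)) +
        288 * n ^ 2 * Ci * e ^ 2 * Du ^ 2 + e * (Du + e⁻¹ * Dq) ^ 2 + e * du 0 ^ 2 +
        e⁻¹ * dq (4 * n - 1) ^ 2) := by
  have hn0 : (0 : ℝ) < n := by positivity
  have hid := sum_form_self (e := e) (x := x) hn (b := b) p z
  set Ξ := (∑ i ∈ Finset.range (4 * n), ((e ^ 2)⁻¹ *
      (∫ y in (x i)..(x (i + 1)), (p i).eval y ^ 2) +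
        ∫ y in (x i)..(x (i + 1)), b y * (z i).eval y ^ 2)) with hΞ
  set Jz := (z 0).eval (x 0) ^ 2 + (z (4 * n - 1)).eval (x (4 * n)) ^ 2 with hJz
  set J := (p (3 * n - 1)).eval (x (3 * n)) - (p (3 * n)).eval (x (3 * n)) with hJ
  set F := cellFluxU e x n ηq ηu with hF
  set H := cellFluxQ e x n ηq ηu with hH
  -- The penalised node is split off. The other fluxes vanish on the fine part and are at most `Du`
  -- on the coarse part.
  set F' : ℕ → ℝ := fun i => if i = 3 * n then 0 else F i with hF'
  have hDu0 : 0 ≤ Du := ((abs_nonneg _).trans (hdu n (by omega) (x n)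
    ⟨le_rfl, (hx n (by omega)).le⟩)).trans (hDu n le_rfl (by omega))
  have hF'fine : ∀ i, i ≤ n ∨ 3 * n ≤ i → i ≤ 4 * n → F' i = 0 := by
    intro i hi hi4
    simp only [hF', hF, cellFluxU]
    split_ifs with h1 h2
    · rfl
    · rfl
    · push Not at h2
      -- The flux takes its trace from the cell on the left, which is fine here even for `i = n`; so
      -- the first transition point needs no penalty.
      have := hux (i - 1) (by omega) (by omega)
      rwa [Nat.sub_add_cancel (by omega)] at this
  have hF'coarse : ∀ i, n ≤ i → i ≤ 3 * n → |F' i| ≤ Du := by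
    intro i h1 h2
    by_cases h3 : i ≤ n ∨ 3 * n ≤ i
    · rw [hF'fine i h3 (by omega)]; simpa using hDu0
    · simp only [hF', hF, cellFluxU]
      rw [if_neg (by omega), if_neg (by omega), if_neg (by omega)]
      have h4 := hdu (i - 1) (by omega) (x i) (by
        have := hx (i - 1) (by omega)
        rw [Nat.sub_add_cancel (by omega)] at this ⊢
        exact ⟨this.le, le_rfl⟩)
      exact h4.trans (hDu _ (by omega) (by omega))
  -- the node carrying the penalty
  have hF3 : |F (3 * n)| ≤ Du + e⁻¹ * Dq := by
    have hmem : x (3 * n) ∈ Icc (x (3 * n - 1)) (x (3 * n - 1 + 1)) := by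
      have := hx (3 * n - 1) (by omega)
      rw [Nat.sub_add_cancel (by omega)] at this ⊢
      exact ⟨this.le, le_rfl⟩
    simp only [hF, cellFluxU]
    rw [if_neg (by omega), if_pos trivial, hqx (3 * n) (by omega), sub_zero]
    refine (abs_sub _ _).trans (add_le_add ?_ ?_)
    · exact (hdu _ (by omega) _ hmem).trans (hDu _ (by omega) (by omega))
    · rw [abs_mul, abs_of_pos (by positivity : 0 < e⁻¹)]
      gcongr
      exact (hdq _ (by omega) _ hmem).trans hDq
  -- Only the jump `J` of the test function meets this flux, and the penalty controls it without
  -- reference to the width of the fine cell on the right.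
  have hpen : -(F (3 * n) * J) ≤ 1 / 4 * (e⁻¹ * J ^ 2) + e * (Du + e⁻¹ * Dq) ^ 2 := by
    have h1 := mul_le_young (a := -F (3 * n)) (s := J) (c := e⁻¹ / 4) (by positivity)
    have h2 : (-F (3 * n)) ^ 2 / (4 * (e⁻¹ / 4)) = e * F (3 * n) ^ 2 := by field_simp
    have h3 : F (3 * n) ^ 2 ≤ (Du + e⁻¹ * Dq) ^ 2 := by rw [← sq_abs]; gcongr
    have h4 : e * F (3 * n) ^ 2 ≤ e * (Du + e⁻¹ * Dq) ^ 2 := by gcongr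
    linarith
  have hsplit : ∑ i ∈ Finset.range (4 * n),
      (-F (i + 1) * (p i).eval (x (i + 1)) + F i * (p i).eval (x i)) =
      ∑ i ∈ Finset.range (4 * n),
        (-F' (i + 1) * (p i).eval (x (i + 1)) + F' i * (p i).eval (x i)) - F (3 * n) * J := by
    have h1 : ∀ i ∈ Finset.range (4 * n),
        (-F (i + 1) * (p i).eval (x (i + 1)) + F i * (p i).eval (x i)) =
        (-F' (i + 1) * (p i).eval (x (i + 1)) + F' i * (p i).eval (x i)) +
        ((if i = 3 * n then F (3 * n) * (p (3 * n)).eval (x (3 * n)) else 0) -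
          (if i = 3 * n - 1 then F (3 * n) * (p (3 * n - 1)).eval (x (3 * n)) else 0)) := by
      intro i _
      simp only [hF']
      by_cases h2 : i = 3 * n
      · subst h2
        rw [if_neg (by omega), if_pos rfl, if_pos rfl, if_neg (by omega)]; ring
      · by_cases h3 : i = 3 * n - 1
        · have h4 : i + 1 = 3 * n := by omega
          rw [if_pos h4, if_neg h2, if_neg h2, if_pos h3, h4, ← h3]; ring
        · rw [if_neg (by omega), if_neg h2, if_neg h2, if_neg h3]; ring
    rw [Finset.sum_congr rfl h1, Finset.sum_add_distrib, Finset.sum_sub_distrib,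
      Finset.sum_ite_eq', Finset.sum_ite_eq', if_pos (Finset.mem_range.2 (by omega)),
      if_pos (Finset.mem_range.2 (by omega)), hJ]
    ring
  have hcellQ : ∀ i ∈ Finset.range (4 * n),
      (e ^ 2)⁻¹ * (∫ y in (x i)..(x (i + 1)), ηq i y * (p i).eval y) +
        (∫ y in (x i)..(x (i + 1)), ηu i y * (p i).derivative.eval y) +
        (-F' (i + 1) * (p i).eval (x (i + 1)) + F' i * (p i).eval (x i)) ≤
      (e ^ 2)⁻¹ * (2 * ((x (i + 1) - x i) * dq i ^ 2) +
        1 / 4 * ∫ y in (x i)..(x (i + 1)), (p i).eval y ^ 2) + 72 * n * Ci * e ^ 2 * Du ^ 2 := by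
    intro i hi
    have hi := Finset.mem_range.1 hi
    by_cases hfine : i < n ∨ 3 * n ≤ i
    -- This uses `k ≥ 1`: orthogonality is available only below degree `k`.
    · have hder : ((p i).derivative).natDegree < k := by
        have := Polynomial.natDegree_derivative_le (p i)
        have := hp i
        omega
      rw [hu0 i hi hfine _ hder, hF'fine i (by omega) (by omega),
        hF'fine (i + 1) (by omega) (by omega)]
      have h1 := integral_mul_le_young (hηq i) (p i).continuous (hx i hi).le
      have h2 := integral_sq_le_of_abs_le (hηq i) (hx i hi).le (hdq i hi)
      have h3 : 0 ≤ ∫ y in (x i)..(x (i + 1)), (p i).eval y ^ 2 :=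
        intervalIntegral.integral_nonneg (hx i hi).le fun t _ => sq_nonneg _
      have h4 : (e ^ 2)⁻¹ * (∫ y in (x i)..(x (i + 1)), ηq i y * (p i).eval y) ≤
          (e ^ 2)⁻¹ * (2 * ((x (i + 1) - x i) * dq i ^ 2) +
            1 / 4 * ∫ y in (x i)..(x (i + 1)), (p i).eval y ^ 2) := by
        gcongr; linarith
      have h5 : 0 ≤ 72 * (n : ℝ) * Ci * e ^ 2 * Du ^ 2 := by positivity
      linarith
    · have h1 := residual_cell_le he hn0 hCi hinv (hp i) (hx i hi)
        (hwidth i (by omega) (by omega)) (hηq i) (hdq i hi)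
        (fun y hy => (hdu i hi y hy).trans (hDu i (by omega) (by omega)))
        (hF'coarse i (by omega) (by omega)) (hF'coarse (i + 1) (by omega) (by omega))
      linarith
  have hcellU : ∀ i ∈ Finset.range (4 * n),
      (∫ y in (x i)..(x (i + 1)), ηq i y * (z i).derivative.eval y) +
        (∫ y in (x i)..(x (i + 1)), b y * ηu i y * (z i).eval y) +
        (∫ y in (x i)..(x (i + 1)), G y * (z i).eval y) ≤
      (if i < n ∨ 3 * n ≤ i then 2 * B * ((x (i + 1) - x i) * du i ^ 2) else 0) +
        2 / β ^ 2 * (∫ y in (x i)..(x (i + 1)), G y ^ 2) +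
        1 / 4 * ∫ y in (x i)..(x (i + 1)), b y * (z i).eval y ^ 2 := by
    intro i hi
    have hi := Finset.mem_range.1 hi
    have hb0 : ∀ y ∈ Icc (x i) (x (i + 1)), 0 ≤ b y := fun y hy =>
      (by positivity : (0 : ℝ) ≤ β ^ 2).trans (hbβ i hi y hy)
    have hder : ((z i).derivative).natDegree < k := by
      have := Polynomial.natDegree_derivative_le (z i)
      have := hz i
      omega
    have h1 := integral_source_le_young hb hG (z i).continuous (hx i hi).le hβ (hbβ i hi)
    have h2 : 0 ≤ ∫ y in (x i)..(x (i + 1)), b y * (z i).eval y ^ 2 :=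
      intervalIntegral.integral_nonneg (hx i hi).le fun t ht =>
        mul_nonneg (hb0 t ht) (sq_nonneg _)
    rw [hq0 i hi _ hder]
    by_cases hfine : i < n ∨ 3 * n ≤ i
    · rw [if_pos hfine]
      have h3 := integral_weighted_le_young hb (hηu i) (z i).continuous (hx i hi).le hb0
        (hbB i hi) (hdu i hi)
      linarith
    -- The weighted projection removes the reaction term on coarse cells, so no term of size `Du²`
    -- without a power of `e` arises.
    · rw [if_neg hfine, hub i (by omega) (by omega) _ (hz i)]
      linarith
  -- the boundary nodes
  have hsumH : ∑ i ∈ Finset.range (4 * n),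
      (-H (i + 1) * (z i).eval (x (i + 1)) + H i * (z i).eval (x i)) =
      e * ηu 0 (x 0) * (z 0).eval (x 0) -
        ηq (4 * n - 1) (x (4 * n)) * (z (4 * n - 1)).eval (x (4 * n)) := by
    obtain ⟨m, hm⟩ : ∃ m, 4 * n = m + 1 := ⟨4 * n - 1, by omega⟩
    have h1 := sum_range_succ_sub (fun i => -H (i + 1) * (z i).eval (x (i + 1)))
      (fun i => -(H i * (z i).eval (x i))) m
    -- Interior fluxes of the first component are traces from the right, where the left-end
    -- interpolation makes `ηq` vanish.
    have hmid : ∀ i, 1 ≤ i → i < 4 * n → H i = 0 := by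
      intro i hi1 hi2
      simp only [hH, cellFluxQ]
      rw [if_neg (by omega), if_neg (by omega), hqx i hi2]
    have h2 : ∑ i ∈ Finset.range m, (-H (i + 1) * (z i).eval (x (i + 1)) -
        -(H (i + 1) * (z (i + 1)).eval (x (i + 1)))) = 0 := by
      refine Finset.sum_eq_zero fun i hi => ?_
      have := Finset.mem_range.1 hi
      rw [hmid (i + 1) (by omega) (by omega)]; ring
    have h3 : H 0 = e * ηu 0 (x 0) := by
      simp only [hH, cellFluxQ, if_true]
      rw [hqx 0 (by omega), zero_add]
    have h4 : H (4 * n) = ηq (4 * n - 1) (x (4 * n)) := by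
      simp only [hH, cellFluxQ, if_true]
      rw [if_neg (by omega)]
      have := hux (4 * n - 1) (by omega) (by omega)
      rw [Nat.sub_add_cancel (by omega)] at this
      rw [this]; ring
    simp only [sub_neg_eq_add] at h1 h2
    rw [hm, h1, h2, ← hm, show m = 4 * n - 1 by omega, h3, h4]
    ring
  have hbd0 : e * ηu 0 (x 0) * (z 0).eval (x 0) ≤
      1 / 4 * (e * (z 0).eval (x 0) ^ 2) + e * du 0 ^ 2 := by
    have h1 := mul_le_young (a := e * ηu 0 (x 0)) (s := (z 0).eval (x 0)) (c := e / 4)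
      (by positivity)
    have h2 : (e * ηu 0 (x 0)) ^ 2 / (4 * (e / 4)) = e * ηu 0 (x 0) ^ 2 := by field_simp
    have h3 : ηu 0 (x 0) ^ 2 ≤ du 0 ^ 2 := by
      rw [← sq_abs]; gcongr
      exact hdu 0 (by omega) _ ⟨le_rfl, (hx 0 (by omega)).le⟩
    have h4 : e * ηu 0 (x 0) ^ 2 ≤ e * du 0 ^ 2 := by gcongr
    linarith
  have hbd1 : -(ηq (4 * n - 1) (x (4 * n)) * (z (4 * n - 1)).eval (x (4 * n))) ≤
      1 / 4 * (e * (z (4 * n - 1)).eval (x (4 * n)) ^ 2) + e⁻¹ * dq (4 * n - 1) ^ 2 := by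
    have h1 := mul_le_young (a := -ηq (4 * n - 1) (x (4 * n)))
      (s := (z (4 * n - 1)).eval (x (4 * n))) (c := e / 4) (by positivity)
    have h2 : (-ηq (4 * n - 1) (x (4 * n))) ^ 2 / (4 * (e / 4)) =
        e⁻¹ * ηq (4 * n - 1) (x (4 * n)) ^ 2 := by field_simp
    have h3 : ηq (4 * n - 1) (x (4 * n)) ^ 2 ≤ dq (4 * n - 1) ^ 2 := by
      rw [← sq_abs]; gcongr
      refine hdq (4 * n - 1) (by omega) _ ?_
      have := hx (4 * n - 1) (by omega)
      rw [Nat.sub_add_cancel (by omega)] at this ⊢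
      exact ⟨this.le, le_rfl⟩
    have h4 : e⁻¹ * ηq (4 * n - 1) (x (4 * n)) ^ 2 ≤ e⁻¹ * dq (4 * n - 1) ^ 2 := by gcongr
    linarith
  -- assembly
  have hsum : ∑ i ∈ Finset.range (4 * n), (formQ e x n (fun i y => (p i).eval y)
        (fun i y => (z i).eval y) i (p i) +
        formU e b x n (fun i y => (p i).eval y) (fun i y => (z i).eval y) i (z i)) =
      ∑ i ∈ Finset.range (4 * n),
        ((e ^ 2)⁻¹ * (∫ y in (x i)..(x (i + 1)), ηq i y * (p i).eval y) +
        (∫ y in (x i)..(x (i + 1)), ηu i y * (p i).derivative.eval y)) +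
      ∑ i ∈ Finset.range (4 * n),
        (-F (i + 1) * (p i).eval (x (i + 1)) + F i * (p i).eval (x i)) +
      ∑ i ∈ Finset.range (4 * n),
        ((∫ y in (x i)..(x (i + 1)), ηq i y * (z i).derivative.eval y) +
        (∫ y in (x i)..(x (i + 1)), b y * ηu i y * (z i).eval y) +
        (∫ y in (x i)..(x (i + 1)), G y * (z i).eval y)) +
      ∑ i ∈ Finset.range (4 * n),
        (-H (i + 1) * (z i).eval (x (i + 1)) + H i * (z i).eval (x i)) := by
    rw [← Finset.sum_add_distrib, ← Finset.sum_add_distrib, ← Finset.sum_add_distrib]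
    refine Finset.sum_congr rfl fun i hi => ?_
    have hi := Finset.mem_range.1 hi
    rw [hQ i hi, hU i hi]
    simp only [formQ, formU, hF, hH]
    ring
  have hA := Finset.sum_le_sum hcellQ
  have hB := Finset.sum_le_sum hcellU
  -- The constant 72 occurs once for each of the `4n` cells, which gives 288. Only a quarter of the
  -- energy stands on the right, so absorbing it is covered by the factor 2 of the conclusion.
  have hdata : ∑ i ∈ Finset.range (4 * n), ((e ^ 2)⁻¹ * (2 * ((x (i + 1) - x i) * dq i ^ 2) +
        1 / 4 * ∫ y in (x i)..(x (i + 1)), (p i).eval y ^ 2) + 72 * n * Ci * e ^ 2 * Du ^ 2) +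
      ∑ i ∈ Finset.range (4 * n), ((if i < n ∨ 3 * n ≤ i then
        2 * B * ((x (i + 1) - x i) * du i ^ 2) else 0) +
        2 / β ^ 2 * (∫ y in (x i)..(x (i + 1)), G y ^ 2) +
        1 / 4 * ∫ y in (x i)..(x (i + 1)), b y * (z i).eval y ^ 2) =
      (∑ i ∈ Finset.range (4 * n), ((e ^ 2)⁻¹ * (2 * ((x (i + 1) - x i) * dq i ^ 2)) +
          (if i < n ∨ 3 * n ≤ i then 2 * B * ((x (i + 1) - x i) * du i ^ 2) else 0) +
          2 / β ^ 2 * ∫ y in (x i)..(x (i + 1)), G y ^ 2)) +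
        288 * n ^ 2 * Ci * e ^ 2 * Du ^ 2 + 1 / 4 * Ξ := by
    have hconst : (288 : ℝ) * n ^ 2 * Ci * e ^ 2 * Du ^ 2 =
        ∑ _i ∈ Finset.range (4 * n), 72 * n * Ci * e ^ 2 * Du ^ 2 := by
      rw [Finset.sum_const, Finset.card_range, nsmul_eq_mul]; push_cast; ring
    rw [hconst, hΞ, Finset.mul_sum, ← Finset.sum_add_distrib, ← Finset.sum_add_distrib,
      ← Finset.sum_add_distrib]
    exact Finset.sum_congr rfl fun i _ => by ring
  rw [hid, hsplit, hsumH] at hsum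
  rw [Finset.sum_add_distrib] at hA
  have hJe : e * Jz = e * (z 0).eval (x 0) ^ 2 + e * (z (4 * n - 1)).eval (x (4 * n)) ^ 2 := by
    rw [hJz]; ring
  have hJ0 : 0 ≤ e⁻¹ * J ^ 2 := by positivity
  have hz0 : 0 ≤ e * (z 0).eval (x 0) ^ 2 := by positivity
  have hz1 : 0 ≤ e * (z (4 * n - 1)).eval (x (4 * n)) ^ 2 := by positivity
  have hΞ0 : 0 ≤ Ξ := by
    refine Finset.sum_nonneg fun i hi => ?_
    have hi := Finset.mem_range.1 hi
    refine add_nonneg (mul_nonneg (by positivity)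
      (intervalIntegral.integral_nonneg (hx i hi).le fun t _ => sq_nonneg _))
      (intervalIntegral.integral_nonneg (hx i hi).le fun t ht =>
        mul_nonneg ((by positivity : (0 : ℝ) ≤ β ^ 2).trans (hbβ i hi t ht)) (sq_nonneg _))
  rw [hJe]
  rw [hJe] at hsum
  linarith


/-! ### Traces, and the scheme in terms of polynomials -/

theorem integral_congr_of_eqOn_Ioo {F G : ℝ → ℝ} {a d : ℝ} (had : a ≤ d)
    (h : ∀ y ∈ Ioo a d, F y = G y) : ∫ y in a..d, F y = ∫ y in a..d, G y :=
  intervalIntegral.integral_congr_Ioo_of_le had h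

/-- A one-sided limit sees only the open cell, so the arbitrary values at the nodes are irrelevant.
-/
theorem traceL_eq {x : ℕ → ℝ} {v g : ℝ → ℝ} {i : ℕ} (hlt : x i < x (i + 1)) (hg : Continuous g)
    (h : ∀ y ∈ Ioo (x i) (x (i + 1)), v y = g y) : traceL x v (i + 1) = g (x (i + 1)) := by
  refine leftLim_eq_of_tendsto ((hg.continuousWithinAt (s := Iio (x (i + 1)))).tendsto.congr' ?_)
  filter_upwards [Ioo_mem_nhdsLT hlt] with y hy using (h y hy).symm

theorem traceR_eq {x : ℕ → ℝ} {v g : ℝ → ℝ} {i : ℕ} (hlt : x i < x (i + 1)) (hg : Continuous g)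
    (h : ∀ y ∈ Ioo (x i) (x (i + 1)), v y = g y) : traceR x v i = g (x i) := by
  refine rightLim_eq_of_tendsto ((hg.continuousWithinAt (s := Ioi (x i))).tendsto.congr' ?_)
  filter_upwards [Ioo_mem_nhdsGT hlt] with y hy using (h y hy).symm

theorem fluxU_eq {e : ℝ} (he : 0 < e) {x : ℕ → ℝ} {n : ℕ} {Q U : ℝ → ℝ}
    {q u : ℕ → ℝ[X]} (hx : ∀ i < 4 * n, x i < x (i + 1))
    (hQ : ∀ i < 4 * n, ∀ y ∈ Ioo (x i) (x (i + 1)), Q y = (q i).eval y)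
    (hU : ∀ i < 4 * n, ∀ y ∈ Ioo (x i) (x (i + 1)), U y = (u i).eval y) {i : ℕ} (hi : i ≤ 4 * n) :
    fluxU (e ^ 2) x (4 * n) Q U i =
      cellFluxU e x n (fun i y => (q i).eval y) (fun i y => (u i).eval y) i := by
  unfold fluxU cellFluxU jump
  have h34 : 3 * (4 * n) / 4 = 3 * n := by omega
  rw [h34, Real.sqrt_sq he.le]
  by_cases h0 : i = 0 ∨ i = 4 * n
  · rw [if_pos h0, if_pos h0]
  · rw [if_neg h0, if_neg h0]
    obtain ⟨j, rfl⟩ : ∃ j, i = j + 1 := ⟨i - 1, by omega⟩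
    by_cases h3 : j + 1 = 3 * n
    · rw [if_pos h3, if_pos h3, if_neg (by omega : ¬ j + 1 = 0), if_neg (by omega : j + 1 ≠ 4 * n),
        Nat.add_sub_cancel, traceL_eq (hx j (by omega)) (u j).continuous (hU j (by omega)),
        traceL_eq (hx j (by omega)) (q j).continuous (hQ j (by omega)),
        traceR_eq (hx (j + 1) (by omega)) (q (j + 1)).continuous (hQ (j + 1) (by omega))]
    · rw [if_neg h3, if_neg h3, Nat.add_sub_cancel,
        traceL_eq (hx j (by omega)) (u j).continuous (hU j (by omega))]

theorem fluxQ_eq {e : ℝ} (he : 0 < e) {x : ℕ → ℝ} {n : ℕ} (hn : 1 ≤ n) {Q U : ℝ → ℝ}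
    {q u : ℕ → ℝ[X]} (hx : ∀ i < 4 * n, x i < x (i + 1))
    (hQ : ∀ i < 4 * n, ∀ y ∈ Ioo (x i) (x (i + 1)), Q y = (q i).eval y)
    (hU : ∀ i < 4 * n, ∀ y ∈ Ioo (x i) (x (i + 1)), U y = (u i).eval y) {i : ℕ} (hi : i ≤ 4 * n) :
    fluxQ (e ^ 2) x (4 * n) Q U i =
      cellFluxQ e x n (fun i y => (q i).eval y) (fun i y => (u i).eval y) i := by
  unfold fluxQ cellFluxQ
  rw [Real.sqrt_sq he.le]
  by_cases h0 : i = 0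
  · rw [if_pos h0, if_pos h0, traceR_eq (hx 0 (by omega)) (q 0).continuous (hQ 0 (by omega)),
      traceR_eq (hx 0 (by omega)) (u 0).continuous (hU 0 (by omega))]
  · rw [if_neg h0, if_neg h0]
    by_cases h1 : i = 4 * n
    · rw [if_pos h1, if_pos h1]
      obtain ⟨j, rfl⟩ : ∃ j, i = j + 1 := ⟨i - 1, by omega⟩
      rw [← h1, Nat.add_sub_cancel,
        traceL_eq (hx j (by omega)) (u j).continuous (hU j (by omega)),
        traceL_eq (hx j (by omega)) (q j).continuous (hQ j (by omega))]
    · rw [if_neg h1, if_neg h1,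
        traceR_eq (hx i (by omega)) (q i).continuous (hQ i (by omega))]

theorem polynomial_mem_brokenPoly {k : ℕ} (x : ℕ → ℝ) (N : ℕ) {r : ℝ[X]} (hr : r.natDegree ≤ k) :
    (fun y => r.eval y) ∈ brokenPoly k x N := fun _ _ => ⟨r, hr, fun _ _ => rfl⟩

/-- The polynomials representing a solution of the scheme, and the scheme in terms of these. -/
theorem IsLDGSolution.exists_polynomials {k n : ℕ} (hn : 1 ≤ n) {e : ℝ} (he : 0 < e)
    {b f : ℝ → ℝ} {x : ℕ → ℝ} (hx : ∀ i < 4 * n, x i < x (i + 1)) {Q U : ℝ → ℝ}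
    (h : IsLDGSolution k (e ^ 2) b f x (4 * n) Q U) :
    ∃ q u : ℕ → ℝ[X], (∀ i, (q i).natDegree ≤ k) ∧ (∀ i, (u i).natDegree ≤ k) ∧
      (∀ i < 4 * n, ∀ y ∈ Ioo (x i) (x (i + 1)), Q y = (q i).eval y) ∧
      (∀ i < 4 * n, ∀ y ∈ Ioo (x i) (x (i + 1)), U y = (u i).eval y) ∧
      (∀ i < 4 * n, ∀ r : ℝ[X], r.natDegree ≤ k →
        formQ e x n (fun i y => (q i).eval y) (fun i y => (u i).eval y) i r = 0) ∧
      ∀ i < 4 * n, ∀ r : ℝ[X], r.natDegree ≤ k →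
        formU e b x n (fun i y => (q i).eval y) (fun i y => (u i).eval y) i r =
          ∫ y in (x i)..(x (i + 1)), f y * r.eval y := by
  have hch : ∀ v ∈ brokenPoly k x (4 * n), ∃ q : ℕ → ℝ[X], (∀ i, (q i).natDegree ≤ k) ∧
      ∀ i < 4 * n, ∀ y ∈ Ioo (x i) (x (i + 1)), v y = (q i).eval y := by
    intro v hv
    have : ∀ i, ∃ p : ℝ[X], p.natDegree ≤ k ∧
        (i < 4 * n → ∀ y ∈ Ioo (x i) (x (i + 1)), v y = p.eval y) := by
      intro i
      by_cases hi : i < 4 * n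
      · obtain ⟨p, hp, hpv⟩ := hv i hi
        exact ⟨p, hp, fun _ => hpv⟩
      · exact ⟨0, by simp, fun h => absurd h hi⟩
    choose q hq hqv using this
    exact ⟨q, hq, fun i hi => hqv i hi⟩
  obtain ⟨q, hq, hQ⟩ := hch Q h.memQ
  obtain ⟨u, hu, hU⟩ := hch U h.memU
  refine ⟨q, u, hq, hu, hQ, hU, fun i hi r hr => ?_, fun i hi r hr => ?_⟩
  · have h1 := h.eqQ _ (polynomial_mem_brokenPoly x (4 * n) hr) i hi
    rw [fluxU_eq he hx hQ hU (by omega), fluxU_eq he hx hQ hU (by omega),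
      traceL_eq (hx i hi) r.continuous (fun _ _ => rfl),
      traceR_eq (hx i hi) r.continuous (fun _ _ => rfl)] at h1
    unfold cellInner at h1
    rw [integral_congr_of_eqOn_Ioo (hx i hi).le fun y hy => by rw [hQ i hi y hy],
      integral_congr_of_eqOn_Ioo (F := fun y => U y * _) (hx i hi).le
        fun y hy => by rw [hU i hi y hy, Polynomial.deriv]] at h1
    exact h1
  · have h1 := h.eqU _ (polynomial_mem_brokenPoly x (4 * n) hr) i hi
    rw [fluxQ_eq he hn hx hQ hU (by omega), fluxQ_eq he hn hx hQ hU (by omega),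
      traceL_eq (hx i hi) r.continuous (fun _ _ => rfl),
      traceR_eq (hx i hi) r.continuous (fun _ _ => rfl)] at h1
    unfold cellInner at h1
    rw [integral_congr_of_eqOn_Ioo (F := fun y => Q y * _) (hx i hi).le
        fun y hy => by rw [hQ i hi y hy, Polynomial.deriv],
      integral_congr_of_eqOn_Ioo (F := fun y => b y * U y * _) (hx i hi).le
        fun y hy => by rw [hU i hi y hy]] at h1
    exact h1

/-! ### Geometry of the Shishkin mesh -/

section Mesh

variable {β σ e : ℝ} {n : ℕ}

theorem shishkinNode_of_le (he : 0 < e) {i : ℕ} (hi : i ≤ n) (hn : 1 ≤ n) :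
    shishkinNode β σ (e ^ 2) (4 * n) i =
      transitionPoint β σ (e ^ 2) (4 * n) * ((i : ℝ) / n) := by
  unfold shishkinNode transitionPoint
  rw [if_pos (by omega), Real.sqrt_sq he.le]
  have : (n : ℝ) ≠ 0 := by positivity
  push_cast
  field_simp

/-- The branches of the definition agree at the transition nodes. Including `i = n` here, and `i =
3n` in the next lemma, lets both ends of a cell be described by the same formula. -/
theorem shishkinNode_of_mid (he : 0 < e) {i : ℕ} (hi : n ≤ i) (hi' : i ≤ 3 * n) (hn : 1 ≤ n) :
    shishkinNode β σ (e ^ 2) (4 * n) i = transitionPoint β σ (e ^ 2) (4 * n) +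
      (1 - 2 * transitionPoint β σ (e ^ 2) (4 * n)) * (((i : ℝ) - n) / (2 * n)) := by
  have hn0 : (n : ℝ) ≠ 0 := by positivity
  rcases hi.eq_or_lt with rfl | hlt
  · rw [shishkinNode_of_le he le_rfl hn]; field_simp; ring
  · unfold shishkinNode
    rw [if_neg (by omega), if_pos (by omega)]
    push_cast
    field_simp; ring

theorem shishkinNode_of_ge (he : 0 < e) {i : ℕ} (hi : 3 * n ≤ i) (hn : 1 ≤ n) :
    shishkinNode β σ (e ^ 2) (4 * n) i =
      1 - transitionPoint β σ (e ^ 2) (4 * n) * ((4 * n - (i : ℝ)) / n) := by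
  have hn0 : (n : ℝ) ≠ 0 := by positivity
  rcases hi.eq_or_lt with rfl | hlt
  · rw [shishkinNode_of_mid he (by omega) le_rfl hn]
    push_cast; field_simp; ring
  · unfold shishkinNode transitionPoint
    rw [if_neg (by omega), if_neg (by omega), Real.sqrt_sq he.le]
    push_cast
    field_simp

theorem shishkinNode_zero (he : 0 < e) (hn : 1 ≤ n) :
    shishkinNode β σ (e ^ 2) (4 * n) 0 = 0 := by
  rw [shishkinNode_of_le he (Nat.zero_le _) hn]; simp

theorem shishkinNode_last (he : 0 < e) (hn : 1 ≤ n) :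
    shishkinNode β σ (e ^ 2) (4 * n) (4 * n) = 1 := by
  rw [shishkinNode_of_ge he (by omega) hn]; push_cast; simp

theorem shishkin_width_fine (he : 0 < e) {i : ℕ} (hi : i < n ∨ 3 * n ≤ i) (hn : 1 ≤ n) :
    shishkinNode β σ (e ^ 2) (4 * n) (i + 1) - shishkinNode β σ (e ^ 2) (4 * n) i =
      transitionPoint β σ (e ^ 2) (4 * n) / n := by
  have hn0 : (n : ℝ) ≠ 0 := by positivity
  rcases hi with hi | hi
  · rw [shishkinNode_of_le he (by omega) hn, shishkinNode_of_le he (by omega) hn]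
    push_cast; field_simp; ring
  · rw [shishkinNode_of_ge he (by omega) hn, shishkinNode_of_ge he (by omega) hn]
    push_cast; field_simp; ring

theorem shishkin_width_coarse (he : 0 < e) {i : ℕ} (hi : n ≤ i) (hi' : i < 3 * n) (hn : 1 ≤ n) :
    shishkinNode β σ (e ^ 2) (4 * n) (i + 1) - shishkinNode β σ (e ^ 2) (4 * n) i =
      (1 - 2 * transitionPoint β σ (e ^ 2) (4 * n)) / (2 * n) := by
  have hn0 : (n : ℝ) ≠ 0 := by positivity
  rw [shishkinNode_of_mid he (by omega) (by omega) hn,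
    shishkinNode_of_mid he (by omega) (by omega) hn]
  push_cast; field_simp; ring

theorem shishkinNode_lt (he : 0 < e) (hn : 1 ≤ n)
    (hτ : 0 < transitionPoint β σ (e ^ 2) (4 * n))
    (hτ4 : transitionPoint β σ (e ^ 2) (4 * n) ≤ 1 / 4) (i : ℕ) :
    shishkinNode β σ (e ^ 2) (4 * n) i < shishkinNode β σ (e ^ 2) (4 * n) (i + 1) := by
  have hn0 : (0 : ℝ) < n := by positivity
  rw [← sub_pos]
  by_cases hi : i < n ∨ 3 * n ≤ i
  · rw [shishkin_width_fine he hi hn]; positivity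
  · rw [shishkin_width_coarse he (by omega) (by omega) hn]
    exact div_pos (by linarith) (by positivity)

theorem shishkin_cell_subset (he : 0 < e) (hn : 1 ≤ n)
    (hτ : 0 < transitionPoint β σ (e ^ 2) (4 * n))
    (hτ4 : transitionPoint β σ (e ^ 2) (4 * n) ≤ 1 / 4) {i : ℕ} (hi : i < 4 * n) :
    Icc (shishkinNode β σ (e ^ 2) (4 * n) i) (shishkinNode β σ (e ^ 2) (4 * n) (i + 1)) ⊆
      Icc 0 1 := by
  have hmono := strictMono_nat_of_lt_succ (shishkinNode_lt (β := β) (σ := σ) he hn hτ hτ4)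
  refine Icc_subset_Icc ?_ ?_
  · rw [← shishkinNode_zero (β := β) (σ := σ) he hn]; exact hmono.monotone (Nat.zero_le _)
  · rw [← shishkinNode_last (β := β) (σ := σ) he hn]; exact hmono.monotone (by omega)

theorem shishkin_coarse_subset (he : 0 < e) (hn : 1 ≤ n)
    (hτ : 0 < transitionPoint β σ (e ^ 2) (4 * n))
    (hτ4 : transitionPoint β σ (e ^ 2) (4 * n) ≤ 1 / 4) {i : ℕ} (hi : n ≤ i) (hi' : i < 3 * n) :
    Icc (shishkinNode β σ (e ^ 2) (4 * n) i) (shishkinNode β σ (e ^ 2) (4 * n) (i + 1)) ⊆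
      Icc (transitionPoint β σ (e ^ 2) (4 * n)) (1 - transitionPoint β σ (e ^ 2) (4 * n)) := by
  have hn0 : (n : ℝ) ≠ 0 := by positivity
  have hmono := strictMono_nat_of_lt_succ (shishkinNode_lt (β := β) (σ := σ) he hn hτ hτ4)
  have h1 : shishkinNode β σ (e ^ 2) (4 * n) n = transitionPoint β σ (e ^ 2) (4 * n) := by
    rw [shishkinNode_of_le he le_rfl hn]; field_simp
  have h2 : shishkinNode β σ (e ^ 2) (4 * n) (3 * n) =
      1 - transitionPoint β σ (e ^ 2) (4 * n) := by
    rw [shishkinNode_of_ge he le_rfl hn]; push_cast; field_simp; ring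
  refine Icc_subset_Icc (h1 ▸ hmono.monotone hi) (h2 ▸ hmono.monotone (by omega))

end Mesh

theorem sum_integral_cells {x : ℕ → ℝ} {N : ℕ} (h0 : x 0 = 0) (h1 : x N = 1) {F : ℝ → ℝ}
    (hF : Continuous F) :
    ∑ i ∈ Finset.range N, ∫ y in (x i)..(x (i + 1)), F y = ∫ y in (0 : ℝ)..1, F y := by
  rw [intervalIntegral.sum_integral_adjacent_intervals fun _ _ => hF.intervalIntegrable _ _, h0, h1]


/-! ### Approximants on the mesh -/

/-- The approximants of the regularised solution on a layer-adapted mesh. -/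
theorem exists_approximants (k : ℕ) {β σ B Cw : ℝ} (hβ : 0 < β) (hσ : 0 < σ) (hB : 0 < B)
    (hCw : 0 < Cw) : ∃ A : ℝ, 0 < A ∧ ∀ (e τ L : ℝ) (n : ℕ) (b w : ℝ → ℝ) (x : ℕ → ℝ),
      0 < e → e ≤ 1 → 1 ≤ n → 0 ≤ L → L ≤ 1 → Continuous b → ContDiff ℝ (k + 2 : ℕ) w →
      (∀ i < 4 * n, x i < x (i + 1)) →
      (∀ i < 4 * n, Icc (x i) (x (i + 1)) ⊆ Icc 0 1) →
      (∀ i, n ≤ i → i < 3 * n → Icc (x i) (x (i + 1)) ⊆ Icc τ (1 - τ)) →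
      (∀ i < 4 * n, i < n ∨ 3 * n ≤ i → x (i + 1) - x i = 4 * σ / β * e * L) →
      (∀ i, n ≤ i → i < 3 * n → x (i + 1) - x i ≤ 2 * ((4 * n : ℕ) : ℝ)⁻¹) →
      (∀ y ∈ Icc (0 : ℝ) 1, β ^ 2 ≤ b y) → (∀ y ∈ Icc (0 : ℝ) 1, b y ≤ B) →
      (∀ j ≤ k + 2, ∀ y ∈ Icc (0 : ℝ) 1,
        e ^ j * |iteratedDeriv j w y| ≤ Cw * (e ^ j + layer β e y)) →
      (∀ j ≤ k + 2, ∀ y ∈ Icc τ (1 - τ), |iteratedDeriv j w y| ≤ Cw) →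
      ∃ P Z : ℕ → ℝ[X], (∀ i, (P i).natDegree ≤ k) ∧ (∀ i, (Z i).natDegree ≤ k) ∧
        (∀ i < 4 * n, ∀ r : ℝ[X], r.natDegree < k →
          ∫ y in (x i)..(x (i + 1)), (e ^ 2 * deriv w y - (P i).eval y) * r.eval y = 0) ∧
        (∀ i < 4 * n, e ^ 2 * deriv w (x i) - (P i).eval (x i) = 0) ∧
        (∀ i < 4 * n, i < n ∨ 3 * n ≤ i → ∀ r : ℝ[X], r.natDegree < k →
          ∫ y in (x i)..(x (i + 1)), (w y - (Z i).eval y) * r.eval y = 0) ∧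
        (∀ i < 4 * n, i < n ∨ 3 * n ≤ i → w (x (i + 1)) - (Z i).eval (x (i + 1)) = 0) ∧
        (∀ i, n ≤ i → i < 3 * n → ∀ r : ℝ[X], r.natDegree ≤ k →
          ∫ y in (x i)..(x (i + 1)), b y * (w y - (Z i).eval y) * r.eval y = 0) ∧
        (∀ i < 4 * n, ∀ y ∈ Icc (x i) (x (i + 1)), |e ^ 2 * deriv w y - (P i).eval y| ≤
          A * if i < n ∨ 3 * n ≤ i then e * (L ^ (k + 1) * (e + Real.exp (4 * σ) * layer β e (x i)))
            else e ^ 2 * (((4 * n : ℕ) : ℝ) ^ (k + 1))⁻¹) ∧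
        (∀ i < 4 * n, ∀ y ∈ Icc (x i) (x (i + 1)), |w y - (Z i).eval y| ≤
          A * if i < n ∨ 3 * n ≤ i then L ^ (k + 1) * (e + Real.exp (4 * σ) * layer β e (x i))
            else (((4 * n : ℕ) : ℝ) ^ (k + 1))⁻¹) := by
  obtain ⟨CR, hCR, hrad⟩ := exists_radau_cell k
  obtain ⟨CP, hCP, hproj⟩ := exists_weighted_projection_cell k (pow_pos hβ 2) hB
  set c := 4 * σ / β with hc
  have hc0 : 0 < c := by positivity
  -- `c` comes from the fine width `c e L`, the number 2 from the coarse width, at most `2 / N`.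
  refine ⟨(CR + CP) * (Cw * (c ^ (k + 1) + 2 ^ (k + 1))), by positivity, ?_⟩
  intro e τ L n b w x he he1 hn hL hL1 hb hw hx hcell hco hfine hcoarse hbβ hbB hwl hwc
  set κ := Real.exp (4 * σ) with hκ
  set M := (((4 * n : ℕ) : ℝ) ^ (k + 1))⁻¹ with hM
  have hM0 : 0 < M := by positivity
  set A := (CR + CP) * (Cw * (c ^ (k + 1) + 2 ^ (k + 1))) with hA
  have hgc : ContDiff ℝ (k + 1 : ℕ) (fun y => e ^ 2 * deriv w y) :=
    contDiff_const.mul (ContDiff.deriv_nat hw)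
  have hgd : ∀ y, iteratedDeriv (k + 1) (fun y => e ^ 2 * deriv w y) y =
      e ^ 2 * iteratedDeriv (k + 2) w y := by
    intro y
    rw [iteratedDeriv_const_mul _ (ContDiff.deriv_nat hw).contDiffAt, ← iteratedDeriv_succ']
  have hwc1 : ContDiff ℝ (k + 1 : ℕ) w := hw.of_le (by norm_cast; omega)
  have hlay : ∀ i < 4 * n, i < n ∨ 3 * n ≤ i → ∀ y ∈ Icc (x i) (x (i + 1)),
      layer β e y ≤ κ * layer β e (x i) := by
    intro i hi hf y hy
    have h1 : |y - x i| ≤ c * e * L := by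
      rw [abs_of_nonneg (by linarith [hy.1]), ← hfine i hi hf]; linarith [hy.2]
    refine (layer_le_of_dist hβ he h1).trans ?_
    have h2 : β * (c * e * L) / e ≤ 4 * σ := by
      have : β * (c * e * L) / e = 4 * σ * L := by rw [hc]; field_simp
      rw [this]; exact mul_le_of_le_one_right (by positivity) hL1
    have := layer_pos β e (x i)
    exact mul_le_mul_of_nonneg_right (Real.exp_le_exp.2 h2) this.le
  -- derivative bounds on the fine cells
  have hder : ∀ j, j ≤ k + 2 → 1 ≤ j → ∀ i < 4 * n, i < n ∨ 3 * n ≤ i →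
      ∀ y ∈ Icc (x i) (x (i + 1)),
      |iteratedDeriv j w y| ≤ (e ^ j)⁻¹ * (Cw * (e + κ * layer β e (x i))) := by
    intro j hj hj1 i hi hf y hy
    have hej : 0 < e ^ j := by positivity
    rw [inv_mul_eq_div, le_div_iff₀ hej, mul_comm]
    refine (hwl j hj y (hcell i hi hy)).trans ?_
    gcongr
    -- One power of `e` is enough: after squaring and summing it is dominated by the layer
    -- contribution `O(e)`.
    · calc e ^ j ≤ e ^ 1 := pow_le_pow_of_le_one he.le he1 hj1
        _ = e := pow_one e
    · exact hlay i hi hf y hy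
  have hfactor : ∀ {C t : ℝ}, 0 ≤ C → C ≤ CR + CP → 0 ≤ t →
      C * (c ^ (k + 1) * Cw * t) ≤ A * t ∧ C * (2 ^ (k + 1) * Cw * t) ≤ A * t := by
    intro C t hC0 hC ht
    constructor
    · calc C * (c ^ (k + 1) * Cw * t) = C * (Cw * c ^ (k + 1)) * t := by ring
        _ ≤ (CR + CP) * (Cw * (c ^ (k + 1) + 2 ^ (k + 1))) * t := by
            gcongr; exact le_add_of_nonneg_right (by positivity)
    · calc C * (2 ^ (k + 1) * Cw * t) = C * (Cw * 2 ^ (k + 1)) * t := by ring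
        _ ≤ (CR + CP) * (Cw * (c ^ (k + 1) + 2 ^ (k + 1))) * t := by
            gcongr; exact le_add_of_nonneg_left (by positivity)
  have hpow : ∀ i, n ≤ i → i < 3 * n → (x (i + 1) - x i) ^ (k + 1) ≤ 2 ^ (k + 1) * M := by
    intro i h1 h2
    have h3 := hx i (by omega)
    calc (x (i + 1) - x i) ^ (k + 1) ≤ (2 * ((4 * n : ℕ) : ℝ)⁻¹) ^ (k + 1) := by
          have : 0 ≤ x (i + 1) - x i := by linarith
          gcongr; exact hcoarse i h1 h2
      _ = _ := by rw [mul_pow, hM, inv_pow]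
  have hPex : ∀ i, ∃ p : ℝ[X], p.natDegree ≤ k ∧ (i < 4 * n →
      (∀ r : ℝ[X], r.natDegree < k →
          ∫ y in (x i)..(x (i + 1)), (e ^ 2 * deriv w y - p.eval y) * r.eval y = 0) ∧
      e ^ 2 * deriv w (x i) - p.eval (x i) = 0 ∧
      ∀ y ∈ Icc (x i) (x (i + 1)), |e ^ 2 * deriv w y - p.eval y| ≤
          A * if i < n ∨ 3 * n ≤ i then e * (L ^ (k + 1) * (e + κ * layer β e (x i)))
            else e ^ 2 * M) := by
    intro i
    by_cases hi : i < 4 * n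
    swap
    · exact ⟨0, by simp, fun h => absurd h hi⟩
    by_cases hf : i < n ∨ 3 * n ≤ i
    -- The flux involves order `k + 2` of `w`, worth `e^(-(k+2))`. Against the prefactor `e²` and
    -- the width to the power `k + 1`, one factor `e` is left.
    · obtain ⟨p, hp, -, hpa, hpo, hpb⟩ := hrad (fun y => e ^ 2 * deriv w y) (x i) (x (i + 1))
        (e ^ 2 * ((e ^ (k + 2))⁻¹ * (Cw * (e + κ * layer β e (x i))))) False hgc (hx i hi)
        (fun y hy => by
          rw [hgd, abs_mul, abs_of_pos (by positivity : 0 < e ^ 2)]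
          gcongr
          exact hder (k + 2) le_rfl (by omega) i hi hf y hy)
      refine ⟨p, hp, fun _ => ⟨hpo, sub_eq_zero.2 (hpa not_false).symm, fun y hy =>
        (hpb y hy).trans ?_⟩⟩
      rw [if_pos hf, hfine i hi hf]
      have hl := layer_pos β e (x i)
      have e1 : (c * e * L) ^ (k + 1) *
          (e ^ 2 * ((e ^ (k + 2))⁻¹ * (Cw * (e + κ * layer β e (x i))))) =
          c ^ (k + 1) * Cw * (e * (L ^ (k + 1) * (e + κ * layer β e (x i)))) := by
        rw [mul_pow, mul_pow]; field_simp; ring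
      rw [e1]
      exact (hfactor hCR.le (by linarith) (by positivity)).1
    · have hn1 : n ≤ i := by omega
      have hn2 : i < 3 * n := by omega
      obtain ⟨p, hp, -, hpa, hpo, hpb⟩ := hrad (fun y => e ^ 2 * deriv w y) (x i) (x (i + 1))
        (e ^ 2 * Cw) False hgc (hx i hi)
        (fun y hy => by
          rw [hgd, abs_mul, abs_of_pos (by positivity : 0 < e ^ 2)]
          gcongr
          exact hwc (k + 2) le_rfl y (hco i hn1 hn2 hy))
      refine ⟨p, hp, fun _ => ⟨hpo, sub_eq_zero.2 (hpa not_false).symm, fun y hy =>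
        (hpb y hy).trans ?_⟩⟩
      rw [if_neg hf]
      calc CR * ((x (i + 1) - x i) ^ (k + 1) * (e ^ 2 * Cw)) ≤
            CR * (2 ^ (k + 1) * M * (e ^ 2 * Cw)) := by gcongr; exact hpow i hn1 hn2
        _ = CR * (2 ^ (k + 1) * Cw * (e ^ 2 * M)) := by ring
        _ ≤ _ := (hfactor hCR.le (by linarith) (by positivity)).2
  have hZex : ∀ i, ∃ p : ℝ[X], p.natDegree ≤ k ∧ (i < 4 * n →
      (i < n ∨ 3 * n ≤ i → ∀ r : ℝ[X], r.natDegree < k →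
          ∫ y in (x i)..(x (i + 1)), (w y - p.eval y) * r.eval y = 0) ∧
      (i < n ∨ 3 * n ≤ i → w (x (i + 1)) - p.eval (x (i + 1)) = 0) ∧
      (n ≤ i → i < 3 * n → ∀ r : ℝ[X], r.natDegree ≤ k →
          ∫ y in (x i)..(x (i + 1)), b y * (w y - p.eval y) * r.eval y = 0) ∧
      ∀ y ∈ Icc (x i) (x (i + 1)), |w y - p.eval y| ≤
          A * if i < n ∨ 3 * n ≤ i then L ^ (k + 1) * (e + κ * layer β e (x i)) else M) := by
    intro i
    by_cases hi : i < 4 * n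
    swap
    · exact ⟨0, by simp, fun h => absurd h hi⟩
    by_cases hf : i < n ∨ 3 * n ≤ i
    · obtain ⟨p, hp, hpa, -, hpo, hpb⟩ := hrad w (x i) (x (i + 1))
        ((e ^ (k + 1))⁻¹ * (Cw * (e + κ * layer β e (x i)))) True hwc1 (hx i hi)
        (fun y hy => hder (k + 1) (by omega) (by omega) i hi hf y hy)
      refine ⟨p, hp, fun _ => ⟨fun _ => hpo, fun _ => sub_eq_zero.2 (hpa trivial).symm,
        fun _ _ => by omega, fun y hy => (hpb y hy).trans ?_⟩⟩
      rw [if_pos hf, hfine i hi hf]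
      have hl := layer_pos β e (x i)
      have e1 : (c * e * L) ^ (k + 1) *
          ((e ^ (k + 1))⁻¹ * (Cw * (e + κ * layer β e (x i)))) =
          c ^ (k + 1) * Cw * (L ^ (k + 1) * (e + κ * layer β e (x i))) := by
        rw [mul_pow, mul_pow]; field_simp
      rw [e1]
      exact (hfactor hCR.le (by linarith) (by positivity)).1
    · have hn1 : n ≤ i := by omega
      have hn2 : i < 3 * n := by omega
      obtain ⟨p, hp, hpo, hpb⟩ := hproj b w (x i) (x (i + 1)) Cw hb hwc1 (hx i hi)
        (fun y hy => hbβ y (hcell i hi hy)) (fun y hy => hbB y (hcell i hi hy))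
        (fun y hy => hwc (k + 1) (by omega) y (hco i hn1 hn2 hy))
      refine ⟨p, hp, fun _ => ⟨fun h => absurd h hf, fun h => absurd h hf, fun _ _ => hpo,
        fun y hy => (hpb y hy).trans ?_⟩⟩
      rw [if_neg hf]
      calc CP * ((x (i + 1) - x i) ^ (k + 1) * Cw) ≤ CP * (2 ^ (k + 1) * M * Cw) := by
            gcongr; exact hpow i hn1 hn2
        _ = CP * (2 ^ (k + 1) * Cw * M) := by ring
        _ ≤ _ := (hfactor hCP.le (by linarith) hM0.le).2
  choose P hPd hP using hPex
  choose Z hZd hZ using hZex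
  exact ⟨P, Z, hPd, hZd, fun i hi => (hP i hi).1, fun i hi => (hP i hi).2.1,
    fun i hi => (hZ i hi).1, fun i hi => (hZ i hi).2.1,
    fun i h1 h2 => (hZ i (by omega)).2.2.1 h1 h2, fun i hi => (hP i hi).2.2,
    fun i hi => (hZ i hi).2.2.2⟩


/-! ### Summation of the local bounds -/

/-- The squared layers have integral `O(e)`, and on a fine cell the left end value is comparable
with all values, so the sum is dominated by the integral. One `κ²` comes from the summand, the other
from this comparison. -/
theorem sum_fine_sq_le {β e κ : ℝ} {n : ℕ} {x : ℕ → ℝ} (hβ : 0 < β) (he : 0 < e) (he1 : e ≤ 1)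
    (h0 : x 0 = 0) (h1 : x (4 * n) = 1)
    (hx : ∀ i < 4 * n, x i < x (i + 1))
    (hlay : ∀ i < 4 * n, i < n ∨ 3 * n ≤ i → ∀ y ∈ Icc (x i) (x (i + 1)),
      layer β e (x i) ≤ κ * layer β e y) :
    ∑ i ∈ Finset.range (4 * n), (if i < n ∨ 3 * n ≤ i then
      (x (i + 1) - x i) * (e + κ * layer β e (x i)) ^ 2 else 0) ≤ (2 + 4 * κ ^ 4 / β) * e := by
  have hlc : Continuous (layer β e) := continuous_layer β e
  have hterm : ∀ i ∈ Finset.range (4 * n), (if i < n ∨ 3 * n ≤ i then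
      (x (i + 1) - x i) * (e + κ * layer β e (x i)) ^ 2 else 0) ≤
      2 * e ^ 2 * (x (i + 1) - x i) +
        2 * κ ^ 4 * ∫ y in (x i)..(x (i + 1)), layer β e y ^ 2 := by
    intro i hi
    have hi := Finset.mem_range.1 hi
    have hw := sub_pos.2 (hx i hi)
    have hI : 0 ≤ ∫ y in (x i)..(x (i + 1)), layer β e y ^ 2 :=
      intervalIntegral.integral_nonneg (hx i hi).le fun _ _ => sq_nonneg _
    by_cases hf : i < n ∨ 3 * n ≤ i
    · rw [if_pos hf]
      have hl : (x (i + 1) - x i) * layer β e (x i) ^ 2 ≤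
          κ ^ 2 * ∫ y in (x i)..(x (i + 1)), layer β e y ^ 2 := by
        have : ∫ _y in (x i)..(x (i + 1)), layer β e (x i) ^ 2 =
            (x (i + 1) - x i) * layer β e (x i) ^ 2 := by
          rw [intervalIntegral.integral_const, smul_eq_mul]
        rw [← this, ← intervalIntegral.integral_const_mul]
        refine intervalIntegral.integral_mono_on (hx i hi).le (by simp)
          (Continuous.intervalIntegrable (by fun_prop) _ _) fun y hy => ?_
        rw [← mul_pow]
        have := hlay i hi hf y hy
        have := layer_pos β e (x i)
        gcongr
      have h2 : (e + κ * layer β e (x i)) ^ 2 ≤ 2 * e ^ 2 + 2 * κ ^ 2 * layer β e (x i) ^ 2 := by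
        nlinarith [sq_nonneg (e - κ * layer β e (x i))]
      calc (x (i + 1) - x i) * (e + κ * layer β e (x i)) ^ 2
          ≤ (x (i + 1) - x i) * (2 * e ^ 2 + 2 * κ ^ 2 * layer β e (x i) ^ 2) := by gcongr
        _ = 2 * e ^ 2 * (x (i + 1) - x i) +
            2 * κ ^ 2 * ((x (i + 1) - x i) * layer β e (x i) ^ 2) := by ring
        _ ≤ 2 * e ^ 2 * (x (i + 1) - x i) +
            2 * κ ^ 2 * (κ ^ 2 * ∫ y in (x i)..(x (i + 1)), layer β e y ^ 2) := by gcongr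
        _ = _ := by ring
    · rw [if_neg hf]; positivity
  refine (Finset.sum_le_sum hterm).trans ?_
  rw [Finset.sum_add_distrib, ← Finset.mul_sum, ← Finset.mul_sum, Finset.sum_range_sub, h0, h1,
    sum_integral_cells h0 h1 (F := fun y => layer β e y ^ 2) (by fun_prop)]
  have hI := integral_layer_sq_le (a := 0) hβ he (by norm_num)
  simp only [sub_zero, mul_zero, neg_zero, Real.exp_zero, mul_one] at hI ⊢
  have h2 : 2 * e ^ 2 ≤ 2 * e := by nlinarith
  have h3 : 2 * κ ^ 4 * ∫ y in (0 : ℝ)..1, layer β e y ^ 2 ≤ 2 * κ ^ 4 * (2 * e / β) := by gcongr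
  have h4 : 2 * κ ^ 4 * (2 * e / β) = 4 * κ ^ 4 / β * e := by ring
  linarith

theorem integral_weighted_sq_add_sub_le {b f g z : ℝ → ℝ} (hb : Continuous b) (hf : Continuous f)
    (hg : Continuous g) (hz : Continuous z) {a d B M : ℝ} (had : a ≤ d)
    (hb0 : ∀ y ∈ Icc a d, 0 ≤ b y) (hbB : ∀ y ∈ Icc a d, b y ≤ B)
    (hM : ∀ y ∈ Icc a d, |g y| ≤ M) :
    ∫ y in a..d, b y * (f y + g y - z y) ^ 2 ≤
      3 * (B * (∫ y in a..d, f y ^ 2) + B * ((d - a) * M ^ 2) + ∫ y in a..d, b y * z y ^ 2) := by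
  have hc : ∫ _y in a..d, B * M ^ 2 = B * ((d - a) * M ^ 2) := by
    rw [intervalIntegral.integral_const, smul_eq_mul]; ring
  rw [← hc, ← intervalIntegral.integral_const_mul,
    ← intervalIntegral.integral_add (Continuous.intervalIntegrable (by fun_prop) _ _) (by simp),
    ← intervalIntegral.integral_add (Continuous.intervalIntegrable (by fun_prop) _ _)
      (Continuous.intervalIntegrable (by fun_prop) _ _), ← intervalIntegral.integral_const_mul]
  refine intervalIntegral.integral_mono_on had (Continuous.intervalIntegrable (by fun_prop) _ _)
    (Continuous.intervalIntegrable (by fun_prop) _ _) fun y hy => ?_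
  have h1 := hb0 y hy
  have h2 : g y ^ 2 ≤ M ^ 2 := by rw [← sq_abs]; gcongr; exact hM y hy
  have h3 : b y * g y ^ 2 ≤ B * M ^ 2 := by
    have := hbB y hy
    have : 0 ≤ g y ^ 2 := sq_nonneg _
    gcongr
    exact h1.trans (hbB y hy)
  have h4 : b y * f y ^ 2 ≤ B * f y ^ 2 := by
    have := hbB y hy
    gcongr
  have h5 : (f y + g y - z y) ^ 2 ≤ 3 * (f y ^ 2 + g y ^ 2 + z y ^ 2) := by
    nlinarith [sq_nonneg (f y - g y), sq_nonneg (f y + z y), sq_nonneg (g y + z y)]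
  have h6 := mul_le_mul_of_nonneg_left h5 h1
  nlinarith


theorem sum_width_mul_sq_le {n : ℕ} {x s : ℕ → ℝ} {A ρ Λ' M' : ℝ}
    (h0 : x 0 = 0) (h1 : x (4 * n) = 1)
    (hx : ∀ i < 4 * n, x i < x (i + 1))
    (hs : ∑ i ∈ Finset.range (4 * n), (if i < n ∨ 3 * n ≤ i then
      (x (i + 1) - x i) * s i ^ 2 else 0) ≤ ρ) :
    ∑ i ∈ Finset.range (4 * n), (x (i + 1) - x i) *
      (A * if i < n ∨ 3 * n ≤ i then Λ' * s i else M') ^ 2 ≤ A ^ 2 * (Λ' ^ 2 * ρ + M' ^ 2) := by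
  have hterm : ∀ i ∈ Finset.range (4 * n), (x (i + 1) - x i) *
      (A * if i < n ∨ 3 * n ≤ i then Λ' * s i else M') ^ 2 ≤
      A ^ 2 * Λ' ^ 2 * (if i < n ∨ 3 * n ≤ i then (x (i + 1) - x i) * s i ^ 2 else 0) +
        A ^ 2 * M' ^ 2 * (x (i + 1) - x i) := by
    intro i hi
    have hw := sub_pos.2 (hx i (Finset.mem_range.1 hi))
    split_ifs
    · have : 0 ≤ A ^ 2 * M' ^ 2 * (x (i + 1) - x i) := by positivity
      linarith
    · apply le_of_eq; ring
  refine (Finset.sum_le_sum hterm).trans ?_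
  rw [Finset.sum_add_distrib, ← Finset.mul_sum, ← Finset.mul_sum, Finset.sum_range_sub, h0, h1]
  have : A ^ 2 * Λ' ^ 2 * ∑ i ∈ Finset.range (4 * n), (if i < n ∨ 3 * n ≤ i then
      (x (i + 1) - x i) * s i ^ 2 else 0) ≤ A ^ 2 * Λ' ^ 2 * ρ := by gcongr
  linarith

/-- Every term of the energy estimate is of order `e Λ²`, except the coarse residual, which has `n²
e² M² ≤ e² R²`. -/
theorem data_le {n : ℕ} {x s : ℕ → ℝ} {e A M Λ K₁ R S B Ci β C : ℝ} {G : ℝ → ℝ} (hn : 1 ≤ n)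
    (he : 0 < e) (he1 : e ≤ 1) (hA : 0 < A) (hM : 0 < M) (hMΛ : M ≤ Λ) (hR : n * M ≤ R)
    (hB : 0 < B) (hCi : 0 < Ci) (hC : 0 < C) (hβ : 0 < β)
    (h0 : x 0 = 0) (h1 : x (4 * n) = 1)
    (hx : ∀ i < 4 * n, x i < x (i + 1))
    (hs0 : ∀ i, 0 ≤ s i) (hsS : s 0 ≤ S) (hsS' : s (4 * n - 1) ≤ S)
    (hs : ∑ i ∈ Finset.range (4 * n), (if i < n ∨ 3 * n ≤ i then
      (x (i + 1) - x i) * s i ^ 2 else 0) ≤ K₁ * e)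
    (hG : Continuous G) (hGb : ∫ y in (0 : ℝ)..1, G y ^ 2 ≤ C * e * M ^ 2)
    {dq du : ℕ → ℝ}
    (hdq : ∀ i, dq i = A * if i < n ∨ 3 * n ≤ i then e * Λ * s i else e ^ 2 * M)
    (hdu : ∀ i, du i = A * if i < n ∨ 3 * n ≤ i then Λ * s i else M) :
    (∑ i ∈ Finset.range (4 * n), ((e ^ 2)⁻¹ * (2 * ((x (i + 1) - x i) * dq i ^ 2)) +
          (if i < n ∨ 3 * n ≤ i then 2 * B * ((x (i + 1) - x i) * du i ^ 2) else 0) +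
          2 / β ^ 2 * ∫ y in (x i)..(x (i + 1)), G y ^ 2)) +
        288 * n ^ 2 * Ci * e ^ 2 * (A * M) ^ 2 + e * (A * M + e⁻¹ * (A * (e ^ 2 * M))) ^ 2 +
        e * du 0 ^ 2 + e⁻¹ * dq (4 * n - 1) ^ 2 ≤
    (2 * A ^ 2 * (K₁ + 1) + 2 * B * A ^ 2 * K₁ + 2 / β ^ 2 * C + 4 * A ^ 2 + 2 * A ^ 2 * S ^ 2 +
      288 * Ci * A ^ 2) * (e * Λ ^ 2 + e ^ 2 * R ^ 2) := by
  have hM2 : M ^ 2 ≤ Λ ^ 2 := by gcongr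
  have hT : 0 ≤ e ^ 2 * R ^ 2 := by positivity
  have hK₁ : 0 ≤ K₁ := by
    have : 0 ≤ K₁ * e := le_trans (Finset.sum_nonneg fun i hi => by
      have := sub_pos.2 (hx i (Finset.mem_range.1 hi))
      split_ifs <;> positivity) hs
    exact nonneg_of_mul_nonneg_left this he
  have heM : e * M ^ 2 ≤ e * Λ ^ 2 := by gcongr
  have heM' : e ^ 2 * M ^ 2 ≤ e * Λ ^ 2 := by
    refine le_trans ?_ heM
    gcongr
    nlinarith
  have hS1 : ∑ i ∈ Finset.range (4 * n), (e ^ 2)⁻¹ * (2 * ((x (i + 1) - x i) * dq i ^ 2)) ≤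
      2 * A ^ 2 * (K₁ + 1) * (e * Λ ^ 2) := by
    rw [← Finset.mul_sum, ← Finset.mul_sum]
    have h := sum_width_mul_sq_le (A := A) (Λ' := e * Λ) (M' := e ^ 2 * M) h0 h1 hx hs
    simp only [← hdq] at h
    have e1 : (e ^ 2)⁻¹ * (2 * (A ^ 2 * ((e * Λ) ^ 2 * (K₁ * e) + (e ^ 2 * M) ^ 2))) =
        2 * A ^ 2 * (K₁ * (e * Λ ^ 2) + e ^ 2 * M ^ 2) := by field_simp
    calc _ ≤ (e ^ 2)⁻¹ * (2 * (A ^ 2 * ((e * Λ) ^ 2 * (K₁ * e) + (e ^ 2 * M) ^ 2))) := by gcongr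
      _ = 2 * A ^ 2 * (K₁ * (e * Λ ^ 2) + e ^ 2 * M ^ 2) := e1
      _ ≤ 2 * A ^ 2 * (K₁ * (e * Λ ^ 2) + e * Λ ^ 2) := by gcongr
      _ = _ := by ring
  have hS2 : ∑ i ∈ Finset.range (4 * n),
      (if i < n ∨ 3 * n ≤ i then 2 * B * ((x (i + 1) - x i) * du i ^ 2) else 0) ≤
      2 * B * A ^ 2 * K₁ * (e * Λ ^ 2) := by
    have : ∀ i ∈ Finset.range (4 * n),
        (if i < n ∨ 3 * n ≤ i then 2 * B * ((x (i + 1) - x i) * du i ^ 2) else 0) =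
        2 * B * A ^ 2 * Λ ^ 2 *
          (if i < n ∨ 3 * n ≤ i then (x (i + 1) - x i) * s i ^ 2 else 0) := by
      intro i _
      rw [hdu]
      split_ifs <;> ring
    rw [Finset.sum_congr rfl this, ← Finset.mul_sum]
    calc _ ≤ 2 * B * A ^ 2 * Λ ^ 2 * (K₁ * e) := by gcongr
      _ = _ := by ring
  have hS3 : ∑ i ∈ Finset.range (4 * n), 2 / β ^ 2 * ∫ y in (x i)..(x (i + 1)), G y ^ 2 ≤
      2 / β ^ 2 * C * (e * Λ ^ 2) := by
    rw [← Finset.mul_sum, sum_integral_cells h0 h1 (F := fun y => G y ^ 2) (by fun_prop), mul_assoc]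
    have : C * e * M ^ 2 ≤ C * (e * Λ ^ 2) := by rw [mul_assoc]; gcongr
    gcongr
    exact hGb.trans this
  have hS4 : 288 * n ^ 2 * Ci * e ^ 2 * (A * M) ^ 2 ≤ 288 * Ci * A ^ 2 * (e ^ 2 * R ^ 2) := by
    calc 288 * n ^ 2 * Ci * e ^ 2 * (A * M) ^ 2 = 288 * Ci * A ^ 2 * (e ^ 2 * (n * M) ^ 2) := by
          ring
      _ ≤ _ := by gcongr
  -- The flux error in the coarse cell next to the penalised node is of size `e² M`, so the penalty
  -- factor `e⁻¹` does no harm.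
  have hS5 : e * (A * M + e⁻¹ * (A * (e ^ 2 * M))) ^ 2 ≤ 4 * A ^ 2 * (e * Λ ^ 2) := by
    have e1 : A * M + e⁻¹ * (A * (e ^ 2 * M)) = A * M * (1 + e) := by field_simp
    calc e * (A * M + e⁻¹ * (A * (e ^ 2 * M))) ^ 2 = A ^ 2 * (1 + e) ^ 2 * (e * M ^ 2) := by
          rw [e1]; ring
      _ ≤ A ^ 2 * (1 + 1) ^ 2 * (e * Λ ^ 2) := by gcongr
      _ = _ := by ring
  have hS6 : e * du 0 ^ 2 ≤ A ^ 2 * S ^ 2 * (e * Λ ^ 2) := by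
    rw [hdu, if_pos (by omega)]
    have := hs0 0
    calc e * (A * (Λ * s 0)) ^ 2 = A ^ 2 * s 0 ^ 2 * (e * Λ ^ 2) := by ring
      _ ≤ _ := by gcongr
  have hS7 : e⁻¹ * dq (4 * n - 1) ^ 2 ≤ A ^ 2 * S ^ 2 * (e * Λ ^ 2) := by
    rw [hdq, if_pos (by omega)]
    have := hs0 (4 * n - 1)
    calc e⁻¹ * (A * (e * Λ * s (4 * n - 1))) ^ 2 = A ^ 2 * s (4 * n - 1) ^ 2 * (e * Λ ^ 2) := by
          field_simp
      _ ≤ _ := by gcongr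
  rw [Finset.sum_add_distrib, Finset.sum_add_distrib]
  have hr1 : 0 ≤ (2 * A ^ 2 * (K₁ + 1) + 2 * B * A ^ 2 * K₁ + 2 / β ^ 2 * C + 4 * A ^ 2 +
      2 * A ^ 2 * S ^ 2) * (e ^ 2 * R ^ 2) := by positivity
  have hr2 : 0 ≤ 288 * Ci * A ^ 2 * (e * Λ ^ 2) := by positivity
  linarith


set_option maxHeartbeats 1000000 in
/-- The error of the scheme on the cells, from the energy `Ξ` of its discrete part `(p, z)`. -/
theorem cell_errors_le {n : ℕ} {x s : ℕ → ℝ} {e A M Λ K₁ K₀ R S B C : ℝ} {b v w : ℝ → ℝ}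
    {p z P Z : ℕ → ℝ[X]} (hn : 1 ≤ n)
    (he : 0 < e) (he1 : e ≤ 1) (hA : 0 < A) (hM : 0 < M) (hMΛ : M ≤ Λ)
    (hB : 0 < B) (hC : 0 < C) (hK₁ : 0 ≤ K₁) (hK₀ : 0 ≤ K₀)
    (h0 : x 0 = 0) (h1 : x (4 * n) = 1) (hx : ∀ i < 4 * n, x i < x (i + 1))
    (hs0 : ∀ i, 0 ≤ s i) (hsS : s 0 ≤ S)
    (hs : ∑ i ∈ Finset.range (4 * n), (if i < n ∨ 3 * n ≤ i then
      (x (i + 1) - x i) * s i ^ 2 else 0) ≤ K₁ * e)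
    (hb : Continuous b) (hb0 : ∀ i < 4 * n, ∀ y ∈ Icc (x i) (x (i + 1)), 0 ≤ b y)
    (hbB : ∀ i < 4 * n, ∀ y ∈ Icc (x i) (x (i + 1)), b y ≤ B)
    (hv : ContDiff ℝ 1 v) (hw : ContDiff ℝ 1 w) (hw0 : w 0 = 0)
    (hw1 : w 1 = 0)
    (hvw : ∫ y in (0 : ℝ)..1, (v y - w y) ^ 2 ≤ C * e * M ^ 2)
    (hvw' : ∫ y in (0 : ℝ)..1, (e ^ 2 * (deriv v y - deriv w y)) ^ 2 ≤ C * e ^ 3 * M ^ 2)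
    (hqx : ∀ i < 4 * n, e ^ 2 * deriv w (x i) - (P i).eval (x i) = 0)
    (hux : w 1 - (Z (4 * n - 1)).eval 1 = 0)
    {dq du : ℕ → ℝ}
    (hdq : ∀ i, dq i = A * if i < n ∨ 3 * n ≤ i then e * Λ * s i else e ^ 2 * M)
    (hdu : ∀ i, du i = A * if i < n ∨ 3 * n ≤ i then Λ * s i else M)
    (hbq : ∀ i < 4 * n, ∀ y ∈ Icc (x i) (x (i + 1)), |e ^ 2 * deriv w y - (P i).eval y| ≤ dq i)
    (hbu : ∀ i < 4 * n, ∀ y ∈ Icc (x i) (x (i + 1)), |w y - (Z i).eval y| ≤ du i)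
    (hΞ : (∑ i ∈ Finset.range (4 * n), ((e ^ 2)⁻¹ * (∫ y in (x i)..(x (i + 1)), (p i).eval y ^ 2) +
        ∫ y in (x i)..(x (i + 1)), b y * (z i).eval y ^ 2)) +
      e * ((z 0).eval (x 0) ^ 2 + (z (4 * n - 1)).eval (x (4 * n)) ^ 2) +
      e⁻¹ * ((p (3 * n - 1)).eval (x (3 * n)) - (p (3 * n)).eval (x (3 * n))) ^ 2 ≤
      K₀ * (e * Λ ^ 2 + e ^ 2 * R ^ 2)) :
    (e ^ 2)⁻¹ * (∑ i ∈ Finset.range (4 * n), ∫ y in (x i)..(x (i + 1)),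
      (e ^ 2 * deriv v y - (P i + p i).eval y) ^ 2) ≤
      3 * (C + A ^ 2 * (K₁ + 1) + K₀) * (e * Λ ^ 2 + e ^ 2 * R ^ 2) ∧
    ∑ i ∈ Finset.range (4 * n), ∫ y in (x i)..(x (i + 1)), b y * (v y - (Z i + z i).eval y) ^ 2 ≤
      3 * (B * C + B * A ^ 2 * (K₁ + 1) + K₀) * (e * Λ ^ 2 + e ^ 2 * R ^ 2 + M ^ 2) ∧
    e * ((Z 0 + z 0).eval (x 0) ^ 2 + (Z (4 * n - 1) + z (4 * n - 1)).eval (x (4 * n)) ^ 2) ≤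
      2 * (K₀ + A ^ 2 * S ^ 2) * (e * Λ ^ 2 + e ^ 2 * R ^ 2) ∧
    e⁻¹ * ((P (3 * n - 1) + p (3 * n - 1)).eval (x (3 * n)) -
      (P (3 * n) + p (3 * n)).eval (x (3 * n))) ^ 2 ≤
      2 * (K₀ + A ^ 2) * (e * Λ ^ 2 + e ^ 2 * R ^ 2) := by
  have hvc := hv.continuous
  have hwc := hw.continuous
  have hvd : Continuous (deriv v) := hv.continuous_deriv le_rfl
  have hwd : Continuous (deriv w) := hw.continuous_deriv le_rfl
  have hM2 : M ^ 2 ≤ Λ ^ 2 := by gcongr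
  have heM : e * M ^ 2 ≤ e * Λ ^ 2 := by gcongr
  have hT : 0 ≤ e ^ 2 * R ^ 2 := by positivity
  have hE : 0 ≤ e * Λ ^ 2 := by positivity
  rw [Finset.sum_add_distrib, ← Finset.mul_sum] at hΞ
  have hSp : 0 ≤ (e ^ 2)⁻¹ *
      ∑ i ∈ Finset.range (4 * n), ∫ y in (x i)..(x (i + 1)), (p i).eval y ^ 2 :=
    mul_nonneg (by positivity) (Finset.sum_nonneg fun i hi =>
      intervalIntegral.integral_nonneg (hx i (Finset.mem_range.1 hi)).le fun _ _ => sq_nonneg _)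
  have hSz : 0 ≤ ∑ i ∈ Finset.range (4 * n), ∫ y in (x i)..(x (i + 1)), b y * (z i).eval y ^ 2 :=
    Finset.sum_nonneg fun i hi =>
      intervalIntegral.integral_nonneg (hx i (Finset.mem_range.1 hi)).le fun y hy =>
        mul_nonneg (hb0 i (Finset.mem_range.1 hi) y hy) (sq_nonneg _)
  have hJz : 0 ≤ e * ((z 0).eval (x 0) ^ 2 + (z (4 * n - 1)).eval (x (4 * n)) ^ 2) := by positivity
  have hJp : 0 ≤ e⁻¹ * ((p (3 * n - 1)).eval (x (3 * n)) - (p (3 * n)).eval (x (3 * n))) ^ 2 := by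
    positivity
  refine ⟨?_, ?_, ?_, ?_⟩
  · have hterm : ∀ i ∈ Finset.range (4 * n), ∫ y in (x i)..(x (i + 1)),
        (e ^ 2 * deriv v y - (P i + p i).eval y) ^ 2 ≤
        3 * ((∫ y in (x i)..(x (i + 1)), (e ^ 2 * (deriv v y - deriv w y)) ^ 2) +
          (x (i + 1) - x i) * dq i ^ 2 + ∫ y in (x i)..(x (i + 1)), (p i).eval y ^ 2) := by
      intro i hi
      have hi := Finset.mem_range.1 hi
      have h := integral_weighted_sq_add_sub_le (b := fun _ => 1) (B := 1)
        (f := fun y => e ^ 2 * (deriv v y - deriv w y))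
        (g := fun y => e ^ 2 * deriv w y - (P i).eval y) (z := fun y => (p i).eval y)
        continuous_const (by fun_prop) (by fun_prop) (by fun_prop) (hx i hi).le
        (fun _ _ => zero_le_one) (fun _ _ => le_rfl) (hbq i hi)
      simp only [one_mul] at h
      refine le_trans (le_of_eq (intervalIntegral.integral_congr fun y _ => ?_)) h
      simp only [Polynomial.eval_add]
      ring
    have h := Finset.sum_le_sum hterm
    rw [← Finset.mul_sum, Finset.sum_add_distrib, Finset.sum_add_distrib, sum_integral_cells h0 h1
      (F := fun y => (e ^ 2 * (deriv v y - deriv w y)) ^ 2) (by fun_prop)] at h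
    have hd := sum_width_mul_sq_le (A := A) (Λ' := e * Λ) (M' := e ^ 2 * M) h0 h1 hx hs
    simp only [← hdq] at hd
    have hinv : 0 < (e ^ 2)⁻¹ := by positivity
    have h' := mul_le_mul_of_nonneg_left h hinv.le
    have e1 : (e ^ 2)⁻¹ * (A ^ 2 * ((e * Λ) ^ 2 * (K₁ * e) + (e ^ 2 * M) ^ 2)) =
        A ^ 2 * (K₁ * (e * Λ ^ 2) + e ^ 2 * M ^ 2) := by field_simp
    have e2 : (e ^ 2)⁻¹ * (C * e ^ 3 * M ^ 2) = C * (e * M ^ 2) := by field_simp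
    have heM' : e ^ 2 * M ^ 2 ≤ e * Λ ^ 2 := by
      refine le_trans ?_ heM
      gcongr
      nlinarith
    have h2 := mul_le_mul_of_nonneg_left hd hinv.le
    have h3 := mul_le_mul_of_nonneg_left hvw' hinv.le
    rw [e1] at h2
    rw [e2] at h3
    have h4 : A ^ 2 * (K₁ * (e * Λ ^ 2) + e ^ 2 * M ^ 2) ≤ A ^ 2 * (K₁ + 1) * (e * Λ ^ 2) := by
      calc A ^ 2 * (K₁ * (e * Λ ^ 2) + e ^ 2 * M ^ 2) ≤
            A ^ 2 * (K₁ * (e * Λ ^ 2) + e * Λ ^ 2) := by gcongr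
        _ = _ := by ring
    have h5 : C * (e * M ^ 2) ≤ C * (e * Λ ^ 2) := by gcongr
    have h6 : 0 ≤ (C + A ^ 2 * (K₁ + 1)) * (e ^ 2 * R ^ 2) := by positivity
    linarith
  · have hterm : ∀ i ∈ Finset.range (4 * n), ∫ y in (x i)..(x (i + 1)),
        b y * (v y - (Z i + z i).eval y) ^ 2 ≤
        3 * (B * (∫ y in (x i)..(x (i + 1)), (v y - w y) ^ 2) +
          B * ((x (i + 1) - x i) * du i ^ 2) +
            ∫ y in (x i)..(x (i + 1)), b y * (z i).eval y ^ 2) := by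
      intro i hi
      have hi := Finset.mem_range.1 hi
      have h := integral_weighted_sq_add_sub_le (B := B) (f := fun y => v y - w y)
        (g := fun y => w y - (Z i).eval y) (z := fun y => (z i).eval y)
        hb (by fun_prop) (by fun_prop) (by fun_prop) (hx i hi).le
        (hb0 i hi) (hbB i hi) (hbu i hi)
      refine le_trans (le_of_eq (intervalIntegral.integral_congr fun y _ => ?_)) h
      simp only [Polynomial.eval_add]
      ring
    have h := Finset.sum_le_sum hterm
    rw [← Finset.mul_sum, Finset.sum_add_distrib, Finset.sum_add_distrib, ← Finset.mul_sum,
      ← Finset.mul_sum, sum_integral_cells h0 h1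
      (F := fun y => (v y - w y) ^ 2) (by fun_prop)] at h
    -- On coarse cells the projection error of `w` itself is of size `M` with no power of `e`. Hence
    -- `M ^ 2` appears in this bound and in none of the other three.
    have hd := sum_width_mul_sq_le (A := A) (Λ' := Λ) (M' := M) h0 h1 hx hs
    simp only [← hdu] at hd
    have h2 := mul_le_mul_of_nonneg_left hd hB.le
    have h3 := mul_le_mul_of_nonneg_left hvw hB.le
    have h5 : B * (C * e * M ^ 2) ≤ B * C * (e * Λ ^ 2) := by
      calc B * (C * e * M ^ 2) = B * C * (e * M ^ 2) := by ring
        _ ≤ _ := by gcongr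
    have h6 : 0 ≤ (B * C + B * A ^ 2 * (K₁ + 1)) * (e ^ 2 * R ^ 2) := by positivity
    have h7 : 0 ≤ B * C * M ^ 2 := by positivity
    have h8 : 0 ≤ B * A ^ 2 * K₁ * M ^ 2 := by positivity
    have h9 : 0 ≤ K₀ * M ^ 2 := by positivity
    have h10 : 0 ≤ B * A ^ 2 * (e * Λ ^ 2) := by positivity
    linarith
  -- At `x_N` the right-end interpolation reproduces the zero boundary value; at `x_0` only the
  -- local error bound is available.
  · have hz : (Z (4 * n - 1)).eval (x (4 * n)) = 0 := by rw [h1]; linarith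
    have hz0 : (Z 0).eval (x 0) ^ 2 ≤ A ^ 2 * S ^ 2 * Λ ^ 2 := by
      have h := hbu 0 (by omega) (x 0) ⟨le_rfl, (hx 0 (by omega)).le⟩
      rw [h0, hw0, zero_sub, abs_neg, hdu, if_pos (by omega)] at h
      rw [h0, ← sq_abs]
      have := hs0 0
      calc |(Z 0).eval 0| ^ 2 ≤ (A * (Λ * s 0)) ^ 2 := by gcongr
        _ = A ^ 2 * s 0 ^ 2 * Λ ^ 2 := by ring
        _ ≤ _ := by gcongr
    rw [Polynomial.eval_add, Polynomial.eval_add, hz, zero_add]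
    have h2 : ((Z 0).eval (x 0) + (z 0).eval (x 0)) ^ 2 ≤
        2 * (A ^ 2 * S ^ 2 * Λ ^ 2) + 2 * (z 0).eval (x 0) ^ 2 := by
      nlinarith [sq_nonneg ((Z 0).eval (x 0) - (z 0).eval (x 0))]
    have h3 : e * (((Z 0).eval (x 0) + (z 0).eval (x 0)) ^ 2 +
        (z (4 * n - 1)).eval (x (4 * n)) ^ 2) ≤ e * (2 * (A ^ 2 * S ^ 2 * Λ ^ 2) +
        2 * (z 0).eval (x 0) ^ 2 + 2 * (z (4 * n - 1)).eval (x (4 * n)) ^ 2) := by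
      gcongr
      nlinarith [sq_nonneg ((z (4 * n - 1)).eval (x (4 * n)))]
    have h4 : 0 ≤ A ^ 2 * S ^ 2 * (e ^ 2 * R ^ 2) := by positivity
    linarith
  · have hmem : x (3 * n) ∈ Icc (x (3 * n - 1)) (x (3 * n - 1 + 1)) := by
      have := hx (3 * n - 1) (by omega)
      rw [Nat.sub_add_cancel (by omega)] at this ⊢
      exact ⟨this.le, le_rfl⟩
    have h2 := hbq _ (by omega) _ hmem
    have h3 := hqx (3 * n) (by omega)
    rw [hdq, if_neg (by omega)] at h2
    obtain ⟨a, ha⟩ : ∃ a, a = e ^ 2 * deriv w (x (3 * n)) - (P (3 * n - 1)).eval (x (3 * n)) :=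
      ⟨_, rfl⟩
    obtain ⟨J, hJ⟩ : ∃ J, J = (p (3 * n - 1)).eval (x (3 * n)) - (p (3 * n)).eval (x (3 * n)) :=
      ⟨_, rfl⟩
    rw [← ha] at h2
    rw [← hJ] at hΞ hJp
    -- `P (3 * n)` is exact at its left end, so the jump of the approximant is the error `a` from
    -- the coarse cell alone.
    have h4 : (P (3 * n - 1) + p (3 * n - 1)).eval (x (3 * n)) -
      (P (3 * n) + p (3 * n)).eval (x (3 * n)) = J - a := by
      rw [Polynomial.eval_add, Polynomial.eval_add, ha, hJ]; linarith
    have h5 : e⁻¹ * a ^ 2 ≤ A ^ 2 * (e * Λ ^ 2) := by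
      rw [← sq_abs]
      calc e⁻¹ * |a| ^ 2 ≤ e⁻¹ * (A * (e ^ 2 * M)) ^ 2 := by gcongr
        _ = A ^ 2 * e ^ 2 * (e * M ^ 2) := by field_simp
        _ ≤ A ^ 2 * 1 ^ 2 * (e * Λ ^ 2) := by gcongr
        _ = _ := by ring
    have h6 : e⁻¹ * (J - a) ^ 2 ≤ 2 * (e⁻¹ * J ^ 2) + 2 * (e⁻¹ * a ^ 2) := by
      have : 0 ≤ e⁻¹ * (J + a) ^ 2 := by positivity
      linarith
    have h7 : 0 ≤ A ^ 2 * (e ^ 2 * R ^ 2) := by positivity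
    rw [h4]
    linarith


/-! ### Error bounds on the cells -/

/-- All constants are fixed before `e` and `n`, which is the uniformity claimed. The error is the
sum of the cut-off part `v - w`, the local approximation error and the discrete part. -/
theorem exists_cellwise_error_bounds (k : ℕ) (hk : 1 ≤ k) {β σ C₀ : ℝ} (hβ : 0 < β)
    (hσ : (k : ℝ) + 1 ≤ σ) (hC₀ : 0 < C₀) {b f : ℝ → ℝ}
    (hb : ContDiff ℝ (k + 2 * (k + 1 + 1) : ℕ) b) (hf : ContDiff ℝ (k + 2 * (k + 1 + 1) : ℕ) f)
    (hbβ : ∀ x ∈ Icc (0 : ℝ) 1, β ^ 2 ≤ b x) :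
    ∃ K : ℝ, 0 < K ∧ ∀ (e : ℝ) (n : ℕ) (u Q U : ℝ → ℝ), 0 < e → e ≤ 1 → 1 ≤ n →
      e ^ 2 ≤ C₀ * ((4 * n : ℕ) : ℝ)⁻¹ → transitionPoint β σ (e ^ 2) (4 * n) ≤ 1 / 4 →
      IsSolution (e ^ 2) b f u →
      ∀ x : ℕ → ℝ, x = shishkinNode β σ (e ^ 2) (4 * n) →
      IsLDGSolution k (e ^ 2) b f x (4 * n) Q U →
      ∀ T : ℝ, T = e * ((((4 * n : ℕ) : ℝ)⁻¹ * Real.log (4 * n : ℕ)) ^ (k + 1)) ^ 2 +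
        e ^ 2 * ((((4 * n : ℕ) : ℝ) ^ k)⁻¹) ^ 2 →
      ∃ (v : ℝ → ℝ) (q z : ℕ → ℝ[X]), ContDiff ℝ 1 v ∧ (∀ y ∈ Icc (0 : ℝ) 1, v y = u y) ∧
        (∀ i < 4 * n, ∀ y ∈ Ioo (x i) (x (i + 1)), Q y = (q i).eval y) ∧
        (∀ i < 4 * n, ∀ y ∈ Ioo (x i) (x (i + 1)), U y = (z i).eval y) ∧
        (e ^ 2)⁻¹ * (∑ i ∈ Finset.range (4 * n), ∫ y in (x i)..(x (i + 1)),
          (e ^ 2 * deriv v y - (q i).eval y) ^ 2) ≤ K * T ∧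
        ∑ i ∈ Finset.range (4 * n), ∫ y in (x i)..(x (i + 1)), b y * (v y - (z i).eval y) ^ 2 ≤
          K * (T + ((((4 * n : ℕ) : ℝ) ^ (k + 1))⁻¹) ^ 2) ∧
        e * ((z 0).eval (x 0) ^ 2 + (z (4 * n - 1)).eval (x (4 * n)) ^ 2) ≤ K * T ∧
        e⁻¹ * ((q (3 * n - 1)).eval (x (3 * n)) - (q (3 * n)).eval (x (3 * n))) ^ 2 ≤ K * T := by
  have hσ0 : 0 < σ := lt_of_lt_of_le (by positivity) hσ
  obtain ⟨B, hB, hBall⟩ := exists_bound_iteratedDeriv hb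
  have hbB : ∀ y ∈ Icc (0 : ℝ) 1, b y ≤ B := fun y hy =>
    (le_abs_self _).trans (by simpa using hBall 0 (Nat.zero_le _) y hy)
  obtain ⟨C, hC, hlayer⟩ := exists_layer_adapted k hβ hσ hC₀ hb hf hbβ
  obtain ⟨A, hA, happ⟩ := exists_approximants k (B := B) (Cw := C) hβ hσ0 hB hC
  obtain ⟨Ci, hCi, hinv⟩ := exists_inverse_inequality_cell k
  obtain ⟨κ, hκ⟩ : ∃ κ, κ = Real.exp (4 * σ) := ⟨_, rfl⟩
  have hκ0 : 0 < κ := hκ ▸ Real.exp_pos _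
  obtain ⟨S, hS⟩ : ∃ S, S = 1 + κ * 2 := ⟨_, rfl⟩
  obtain ⟨K₁, hK₁⟩ : ∃ K₁, K₁ = 2 + 4 * κ ^ 4 / β := ⟨_, rfl⟩
  have hK₁0 : 0 < K₁ := by rw [hK₁]; positivity
  obtain ⟨K₀, hK₀⟩ : ∃ K₀, K₀ = 2 * (2 * A ^ 2 * (K₁ + 1) + 2 * B * A ^ 2 * K₁ + 2 / β ^ 2 * C +
      4 * A ^ 2 + 2 * A ^ 2 * S ^ 2 + 288 * Ci * A ^ 2) := ⟨_, rfl⟩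
  have hK₀0 : 0 < K₀ := by rw [hK₀]; positivity
  refine ⟨3 * (C + A ^ 2 * (K₁ + 1) + K₀) + 3 * (B * C + B * A ^ 2 * (K₁ + 1) + K₀) +
    2 * (K₀ + A ^ 2 * S ^ 2) + 2 * (K₀ + A ^ 2), by positivity, ?_⟩
  intro e n u Q U he he1 hn heN hτ4 hu x hxe hLDG T hT
  obtain ⟨τ, hτ⟩ : ∃ τ, τ = transitionPoint β σ (e ^ 2) (4 * n) := ⟨_, rfl⟩
  have hn0 : (0 : ℝ) < n := by positivity
  have hN : 4 ≤ 4 * n := by omega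
  have hlog := one_le_log_natCast hN
  have hτeq : τ = σ * e * Real.log (4 * n : ℕ) / β := by
    rw [hτ, transitionPoint, Real.sqrt_sq he.le]
  have hτ0 : 0 < τ := by rw [hτeq]; positivity
  rw [← hτ] at hτ4
  have hβτ : β * τ = σ * e * Real.log (4 * n : ℕ) := by rw [hτeq]; field_simp
  have hx0 : x 0 = 0 := hxe ▸ shishkinNode_zero he hn
  have hx1 : x (4 * n) = 1 := hxe ▸ shishkinNode_last he hn
  have hx : ∀ i < 4 * n, x i < x (i + 1) := fun i _ => by
    rw [hxe]; exact shishkinNode_lt he hn (hτ ▸ hτ0) (hτ ▸ hτ4) i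
  have hcell : ∀ i < 4 * n, Icc (x i) (x (i + 1)) ⊆ Icc 0 1 := fun i hi => by
    rw [hxe]; exact shishkin_cell_subset he hn (hτ ▸ hτ0) (hτ ▸ hτ4) hi
  have hco : ∀ i, n ≤ i → i < 3 * n → Icc (x i) (x (i + 1)) ⊆ Icc τ (1 - τ) := fun i h1 h2 => by
    rw [hxe, hτ]; exact shishkin_coarse_subset he hn (hτ ▸ hτ0) (hτ ▸ hτ4) h1 h2
  obtain ⟨N, hNdef⟩ : ∃ N : ℝ, N = ((4 * n : ℕ) : ℝ) := ⟨_, rfl⟩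
  have hNn : N = 4 * n := by rw [hNdef]; push_cast; ring
  have hN0 : 0 < N := by rw [hNn]; positivity
  obtain ⟨L, hL⟩ : ∃ L, L = N⁻¹ * Real.log N := ⟨_, rfl⟩
  have hlogN : 1 ≤ Real.log N := hNdef ▸ hlog
  have hL0 : 0 < L := by rw [hL]; positivity
  have hL1 : L ≤ 1 := by
    rw [hL, inv_mul_le_iff₀ hN0, mul_one]
    linarith [Real.log_le_sub_one_of_pos hN0]
  have hfine : ∀ i < 4 * n, i < n ∨ 3 * n ≤ i → x (i + 1) - x i = 4 * σ / β * e * L := by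
    intro i _ hf
    rw [hxe, shishkin_width_fine he hf hn, ← hτ, hτeq, ← hNdef, hL, hNn]
    field_simp
  have hcoarse : ∀ i, n ≤ i → i < 3 * n → x (i + 1) - x i = (1 - 2 * τ) / (2 * n) := by
    intro i h1 h2
    rw [hxe, shishkin_width_coarse he h1 h2 hn, ← hτ]
  obtain ⟨v, w, hv, hvu, hw, hw0, hw1, hwl, hwc, hvw, hvw', hG⟩ :=
    hlayer e τ (4 * n) u he he1 hN heN hβτ hτ4 hu
  obtain ⟨P, Z, hP, hZ, hPo, hPx, hZo, hZx, hZb, hPb, hZb'⟩ := happ e τ L n b w x he he1 hn hL0.le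
    hL1 hb.continuous hw hx hcell hco hfine (fun i h1 h2 => by
      rw [hcoarse i h1 h2, ← hNdef, hNn]
      have : (1 - 2 * τ) / (2 * n) ≤ 1 / (2 * n) := by gcongr; linarith
      refine this.trans_eq ?_
      field_simp; norm_num) hbβ hbB hwl hwc
  obtain ⟨q, z, hq, hz, hQq, hUz, hfQ, hfU⟩ := hLDG.exists_polynomials hn he hx
  rw [← hNdef] at hT hvw hvw' hG hPb hZb' ⊢
  rw [← hL] at hT
  obtain ⟨M, hM⟩ : ∃ M, M = (N ^ (k + 1))⁻¹ := ⟨_, rfl⟩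
  obtain ⟨Λ, hΛ⟩ : ∃ Λ, Λ = L ^ (k + 1) := ⟨_, rfl⟩
  obtain ⟨R, hR⟩ : ∃ R, R = (N ^ k)⁻¹ := ⟨_, rfl⟩
  obtain ⟨s, hs⟩ : ∃ s : ℕ → ℝ, s = fun i => e + κ * layer β e (x i) := ⟨_, rfl⟩
  have hs' : ∀ i, s i = e + κ * layer β e (x i) := fun i => by rw [hs]
  rw [← hM] at hvw hvw' hG hPb hZb' ⊢
  rw [← hΛ, ← hR] at hT
  simp only [← hκ, ← hΛ, ← hs'] at hPb hZb'
  have hM0 : 0 < M := by rw [hM]; positivity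
  have hMΛ : M ≤ Λ := by
    rw [hM, hΛ, hL, mul_pow, inv_pow]
    exact le_mul_of_one_le_right (by positivity) (one_le_pow₀ hlogN)
  have hRM : n * M ≤ R := by
    have : R = N * M := by rw [hR, hM, pow_succ]; field_simp
    rw [this]
    gcongr
    rw [hNn]; linarith
  have hs0 : ∀ i, 0 ≤ s i := fun i => by
    have := layer_pos β e (x i)
    rw [hs' i]; positivity
  have hsS : ∀ i < 4 * n, s i ≤ S := fun i hi => by
    rw [hs', hS]
    have := layer_le_two hβ he (hcell i hi ⟨le_rfl, (hx i hi).le⟩)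
    gcongr
  have hsum : ∑ i ∈ Finset.range (4 * n), (if i < n ∨ 3 * n ≤ i then
      (x (i + 1) - x i) * s i ^ 2 else 0) ≤ K₁ * e := by
    simp only [hs', hK₁]
    refine sum_fine_sq_le hβ he he1 hx0 hx1 hx fun i hi hf y hy => ?_
    have h1 : |x i - y| ≤ 4 * σ / β * e * L := by
      rw [abs_sub_comm, abs_of_nonneg (by linarith [hy.1]), ← hfine i hi hf]; linarith [hy.2]
    refine (layer_le_of_dist hβ he h1).trans ?_
    have h2 : β * (4 * σ / β * e * L) / e ≤ 4 * σ := by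
      have : β * (4 * σ / β * e * L) / e = 4 * σ * L := by field_simp
      rw [this]; exact mul_le_of_le_one_right (by positivity) hL1
    rw [hκ]
    exact mul_le_mul_of_nonneg_right (Real.exp_le_exp.2 h2) (layer_pos β e y).le
  obtain ⟨dq, hdq⟩ : ∃ dq : ℕ → ℝ, ∀ i, dq i =
      A * if i < n ∨ 3 * n ≤ i then e * Λ * s i else e ^ 2 * M := ⟨_, fun _ => rfl⟩
  obtain ⟨du, hdu⟩ : ∃ du : ℕ → ℝ, ∀ i, du i =
      A * if i < n ∨ 3 * n ≤ i then Λ * s i else M := ⟨_, fun _ => rfl⟩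
  simp only [← mul_assoc e Λ] at hPb
  simp only [← hdq] at hPb
  simp only [← hdu] at hZb'
  have hv1 : ContDiff ℝ 1 v := hv.of_le (by norm_cast; omega)
  have hw1' : ContDiff ℝ 1 w := hw.of_le (by norm_cast; omega)
  have hw2 : ContDiff ℝ 2 w := hw.of_le (by norm_cast; omega)
  have hwdc : Continuous (deriv w) := hw1'.continuous_deriv le_rfl
  have hwddc : Continuous (deriv (deriv w)) :=
    (ContDiff.deriv_nat (n := 1) hw2).continuous_deriv le_rfl
  have hbc := hb.continuous
  have hfc := hf.continuous
  have hwcont := hw1'.continuous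
  have hw0x : w (x 0) = 0 := by rw [hx0, hw0]
  have hw1x : w (x (4 * n)) = 0 := by rw [hx1, hw1]
  have hηq : ∀ i, Continuous fun y => e ^ 2 * deriv w y - (P i).eval y := fun i => by fun_prop
  have hηu : ∀ i, Continuous fun y => w y - (Z i).eval y := fun i => by fun_prop
  obtain ⟨G, hGdef⟩ : ∃ G : ℝ → ℝ, G = fun y => f y - (-e ^ 2 * deriv (deriv w) y + b y * w y) :=
    ⟨_, rfl⟩
  have hGc : Continuous G := by rw [hGdef]; fun_prop
  have hpe : (fun i y => (q i - P i).eval y) = fun i y => (q i).eval y - (P i).eval y :=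
    funext fun i => funext fun y => Polynomial.eval_sub ..
  have hze : (fun i y => (z i - Z i).eval y) = fun i y => (z i).eval y - (Z i).eval y :=
    funext fun i => funext fun y => Polynomial.eval_sub ..
  -- Error equation: the forms of `(q, z)` and of `(e² w', w)` agree up to the source `G`.
  -- Subtracting the forms of `(P, Z)` from both gives the hypotheses on the discrete error.
  have hdisc := discrete_estimate (p := fun i => q i - P i) (z := fun i => z i - Z i) hk hn he hβ
    hCi hinv hbc hGc hx
    (fun i hi y hy => hbβ y (hcell i hi hy)) (fun i hi y hy => hbB y (hcell i hi hy))
    (fun i h1 h2 => by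
      rw [hcoarse i h1 h2]
      have : 4 * (n : ℝ) * ((1 - 2 * τ) / (2 * n)) = 2 * (1 - 2 * τ) := by field_simp; norm_num
      rw [this]; linarith)
    (fun i => (Polynomial.natDegree_sub_le _ _).trans (max_le (hq i) (hP i)))
    (fun i => (Polynomial.natDegree_sub_le _ _).trans (max_le (hz i) (hZ i)))
    (ηq := fun i y => e ^ 2 * deriv w y - (P i).eval y) (ηu := fun i y => w y - (Z i).eval y)
    hηq hηu
    (fun i hi => by
      rw [hpe, hze, formQ_sub (fun i => (q i).continuous) (fun i => (z i).continuous)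
          (fun i => (P i).continuous) (fun i => (Z i).continuous),
        formQ_sub (q := fun _ y => e ^ 2 * deriv w y) (u := fun _ => w) (fun _ => by fun_prop)
          (fun _ => hwcont) (fun i => (P i).continuous) (fun i => (Z i).continuous),
        formQ_exact he hw1' hw0x hw1x,
        hfQ i hi _ ((Polynomial.natDegree_sub_le _ _).trans (max_le (hq i) (hP i)))])
    (fun i hi => by
      rw [hpe, hze, formU_sub hbc (fun i => (q i).continuous) (fun i => (z i).continuous)
          (fun i => (P i).continuous) (fun i => (Z i).continuous),
        formU_sub hbc (q := fun _ y => e ^ 2 * deriv w y) (u := fun _ => w) (fun _ => by fun_prop)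
          (fun _ => hwcont) (fun i => (P i).continuous) (fun i => (Z i).continuous),
        formU_exact hbc hw2 hw0x hw1x,
        hfU i hi _ ((Polynomial.natDegree_sub_le _ _).trans (max_le (hz i) (hZ i))), hGdef,
        integral_sub_mul hfc (by fun_prop) (by fun_prop)]
      ring)
    hPo hPx hZo hZx hZb (dq := dq) (du := du) hPb hZb' (Du := A * M) (Dq := A * (e ^ 2 * M))
    (fun i h1 h2 => by rw [hdu, if_neg (by omega)])
    (by rw [hdq, if_neg (by omega)])
  have hdata := data_le (R := R) (B := B) (Ci := Ci) (β := β) hn he he1 hA hM0 hMΛ hRM hB hCi hC hβ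
    hx0 hx1 hx hs0 (hsS 0 (by omega)) (hsS (4 * n - 1) (by omega)) hsum hGc (by rw [hGdef]; exact hG)
    hdq hdu
  have hΞ := hdisc.trans (mul_le_mul_of_nonneg_left hdata zero_le_two)
  rw [← mul_assoc, ← hK₀] at hΞ
  have hux : w 1 - (Z (4 * n - 1)).eval 1 = 0 := by
    have := hZx (4 * n - 1) (by omega) (by omega)
    rwa [Nat.sub_add_cancel (by omega), hx1] at this
  obtain ⟨r1, r2, r3, r4⟩ := cell_errors_le (p := fun i => q i - P i) (z := fun i => z i - Z i)
    (S := S) hn he he1 hA hM0 hMΛ hB hC hK₁0.le hK₀0.le hx0 hx1 hx hs0 (hsS 0 (by omega)) hsum hbc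
    (fun i hi y hy => (by positivity : (0 : ℝ) ≤ β ^ 2).trans (hbβ y (hcell i hi hy)))
    (fun i hi y hy => hbB y (hcell i hi hy)) hv1 hw1' hw0 hw1 hvw hvw' hPx hux hdq hdu hPb hZb' hΞ
  simp only [add_sub_cancel] at r1 r2 r3 r4
  rw [← hT] at r1 r2 r3 r4
  have hΛ0 : 0 < Λ := hM0.trans_le hMΛ
  have hT0 : 0 ≤ T := by rw [hT]; positivity
  have hTM : 0 ≤ T + M ^ 2 := by positivity
  refine ⟨v, q, z, hv1, hvu, hQq, hUz, r1.trans ?_, r2.trans ?_, r3.trans ?_, r4.trans ?_⟩ <;>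
    refine mul_le_mul_of_nonneg_right ?_ (by assumption)
  · have : 0 ≤ 3 * (B * C + B * A ^ 2 * (K₁ + 1) + K₀) + 2 * (K₀ + A ^ 2 * S ^ 2) +
      2 * (K₀ + A ^ 2) := by positivity
    linarith
  · have : 0 ≤ 3 * (C + A ^ 2 * (K₁ + 1) + K₀) + 2 * (K₀ + A ^ 2 * S ^ 2) +
      2 * (K₀ + A ^ 2) := by positivity
    linarith
  · have : 0 ≤ 3 * (C + A ^ 2 * (K₁ + 1) + K₀) + 3 * (B * C + B * A ^ 2 * (K₁ + 1) + K₀) +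
      2 * (K₀ + A ^ 2) := by positivity
    linarith
  · have : 0 ≤ 3 * (C + A ^ 2 * (K₁ + 1) + K₀) + 3 * (B * C + B * A ^ 2 * (K₁ + 1) + K₀) +
      2 * (K₀ + A ^ 2 * S ^ 2) := by positivity
    linarith


/-! ### From polynomials on the cells to the norms -/

/-- The four contributions to the norms of the error. -/
theorem exists_error_bounds (k : ℕ) (hk : 1 ≤ k) {β σ C₀ : ℝ} (hβ : 0 < β)
    (hσ : (k : ℝ) + 1 ≤ σ) (hC₀ : 0 < C₀) {b f : ℝ → ℝ}
    (hb : ContDiff ℝ (k + 2 * (k + 1 + 1) : ℕ) b) (hf : ContDiff ℝ (k + 2 * (k + 1 + 1) : ℕ) f)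
    (hbβ : ∀ x ∈ Icc (0 : ℝ) 1, β ^ 2 ≤ b x) :
    ∃ K : ℝ, 0 < K ∧ ∀ (e : ℝ) (n : ℕ) (u Q U : ℝ → ℝ), 0 < e → e ≤ 1 → 1 ≤ n →
      e ^ 2 ≤ C₀ * ((4 * n : ℕ) : ℝ)⁻¹ → transitionPoint β σ (e ^ 2) (4 * n) ≤ 1 / 4 →
      IsSolution (e ^ 2) b f u →
      ∀ x : ℕ → ℝ, x = shishkinNode β σ (e ^ 2) (4 * n) →
      IsLDGSolution k (e ^ 2) b f x (4 * n) Q U →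
      ∀ T : ℝ, T = e * ((((4 * n : ℕ) : ℝ)⁻¹ * Real.log (4 * n : ℕ)) ^ (k + 1)) ^ 2 +
        e ^ 2 * ((((4 * n : ℕ) : ℝ) ^ k)⁻¹) ^ 2 →
      (e ^ 2)⁻¹ * normSq x (4 * n) (exactFlux (e ^ 2) u - Q) ≤ K * T ∧
      normSq x (4 * n) (fun y => √(b y) * (u - U) y) ≤
        K * (T + ((((4 * n : ℕ) : ℝ) ^ (k + 1))⁻¹) ^ 2) ∧
      e * (jump x (4 * n) (u - U) 0 ^ 2 + jump x (4 * n) (u - U) (4 * n) ^ 2) ≤ K * T ∧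
      e⁻¹ * jump x (4 * n) (exactFlux (e ^ 2) u - Q) (3 * (4 * n) / 4) ^ 2 ≤ K * T := by
  obtain ⟨K, hK, hbounds⟩ := exists_cellwise_error_bounds k hk hβ hσ hC₀ hb hf hbβ
  refine ⟨K, hK, fun e n u Q U he he1 hn heN hτ4 hu x hxe hLDG T hT => ?_⟩
  obtain ⟨v, q, z, hv, hvu, hQ, hU, r1, r2, r3, r4⟩ :=
    hbounds e n u Q U he he1 hn heN hτ4 hu x hxe hLDG T hT
  have hn0 : (0 : ℝ) < n := by positivity
  have hσ0 : 0 < σ := lt_of_lt_of_le (by positivity) hσ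
  have hlog := one_le_log_natCast (N := 4 * n) (by omega)
  have hτ0 : 0 < transitionPoint β σ (e ^ 2) (4 * n) := by
    rw [transitionPoint, Real.sqrt_sq he.le]; positivity
  have hx0 : x 0 = 0 := hxe ▸ shishkinNode_zero he hn
  have hx1 : x (4 * n) = 1 := hxe ▸ shishkinNode_last he hn
  have hx : ∀ i < 4 * n, x i < x (i + 1) := fun i _ => by
    rw [hxe]; exact shishkinNode_lt he hn hτ0 hτ4 i
  have hcell : ∀ i < 4 * n, Icc (x i) (x (i + 1)) ⊆ Icc 0 1 := fun i hi => by
    rw [hxe]; exact shishkin_cell_subset he hn hτ0 hτ4 hi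
  have hvc := hv.continuous
  have hvd : Continuous (deriv v) := hv.continuous_deriv le_rfl
  have hder : ∀ y ∈ Icc (0 : ℝ) 1, derivWithin u (Icc 0 1) y = deriv v y := fun y hy => by
    rw [← derivWithin_congr hvu (hvu y hy)]
    exact ((hv.differentiable (by simp)) y).derivWithin (uniqueDiffOn_Icc_zero_one y hy)
  have hqc : ∀ i < 4 * n, ∀ y ∈ Ioo (x i) (x (i + 1)),
      (exactFlux (e ^ 2) u - Q) y = e ^ 2 * deriv v y - (q i).eval y := fun i hi y hy => by
    rw [Pi.sub_apply, exactFlux, hder y (hcell i hi (Ioo_subset_Icc_self hy)), hQ i hi y hy]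
  have huc : ∀ i < 4 * n, ∀ y ∈ Ioo (x i) (x (i + 1)),
      (u - U) y = v y - (z i).eval y := fun i hi y hy => by
    rw [Pi.sub_apply, ← hvu y (hcell i hi (Ioo_subset_Icc_self hy)), hU i hi y hy]
  have hqcont : ∀ i, Continuous fun y => e ^ 2 * deriv v y - (q i).eval y := fun i => by fun_prop
  have hucont : ∀ i, Continuous fun y => v y - (z i).eval y := fun i => by fun_prop
  refine ⟨le_of_eq_of_le ?_ r1, le_of_eq_of_le ?_ r2, le_of_eq_of_le ?_ r3, le_of_eq_of_le ?_ r4⟩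
  · unfold normSq cellInner
    congr 1
    refine Finset.sum_congr rfl fun i hi => ?_
    have hi := Finset.mem_range.1 hi
    refine integral_congr_of_eqOn_Ioo (hx i hi).le fun y hy => ?_
    rw [hqc i hi y hy, ← sq]
  · unfold normSq cellInner
    refine Finset.sum_congr rfl fun i hi => ?_
    have hi := Finset.mem_range.1 hi
    refine integral_congr_of_eqOn_Ioo (hx i hi).le fun y hy => ?_
    have hb0 : 0 ≤ b y := (by positivity : (0 : ℝ) ≤ β ^ 2).trans
      (hbβ y (hcell i hi (Ioo_subset_Icc_self hy)))
    beta_reduce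
    rw [huc i hi y hy, mul_mul_mul_comm, Real.mul_self_sqrt hb0, sq]
  -- The solution vanishes at the boundary, so only the trace of `U` is left. Likewise the exact
  -- flux is continuous and drops out of the jump at `3n`.
  · have e0 : jump x (4 * n) (u - U) 0 = (z 0).eval (x 0) := by
      rw [jump, if_pos rfl, traceR_eq (hx 0 (by omega)) (hucont 0) (huc 0 (by omega)), hx0,
        hvu 0 (by simp), hu.left_boundary]
      ring
    have e1 : jump x (4 * n) (u - U) (4 * n) = -(z (4 * n - 1)).eval (x (4 * n)) := by
      obtain ⟨m, hm⟩ : ∃ m, 4 * n = m + 1 := ⟨4 * n - 1, by omega⟩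
      rw [jump, if_neg (by omega), if_pos rfl]
      rw [hm] at hx huc hx1 ⊢
      rw [traceL_eq (hx m (by omega)) (hucont m) (huc m (by omega)), hx1, hvu 1 (by simp),
        hu.right_boundary, Nat.add_sub_cancel]
      ring
    rw [e0, e1, neg_sq]
  · have h3 : 3 * (4 * n) / 4 = 3 * n := by omega
    have e1 : jump x (4 * n) (exactFlux (e ^ 2) u - Q) (3 * n) =
        -((q (3 * n - 1)).eval (x (3 * n)) - (q (3 * n)).eval (x (3 * n))) := by
      obtain ⟨m, hm⟩ : ∃ m, 3 * n = m + 1 := ⟨3 * n - 1, by omega⟩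
      rw [jump, if_neg (by omega), if_neg (by omega), hm,
        traceL_eq (hx m (by omega)) (hqcont m) (hqc m (by omega)),
        traceR_eq (hx (m + 1) (by omega)) (hqcont (m + 1)) (hqc (m + 1) (by omega)),
        Nat.add_sub_cancel]
      ring
    rw [h3, e1, neg_sq]


/-! ### Data given on the unit interval, and powers of ε -/

theorem IsSolution.congr {ε : ℝ} {b f b' f' u : ℝ → ℝ} (hu : IsSolution ε b f u)
    (hb : ∀ y ∈ Icc (0 : ℝ) 1, b' y = b y) (hf : ∀ y ∈ Icc (0 : ℝ) 1, f' y = f y) :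
    IsSolution ε b' f' u where
  contDiffOn := hu.contDiffOn
  equation y hy := by
    rw [hb y (Ioo_subset_Icc_self hy), hf y (Ioo_subset_Icc_self hy)]
    exact hu.equation y hy
  left_boundary := hu.left_boundary
  right_boundary := hu.right_boundary

/-- The scheme sees `b` and `f` only through integrals over cells, so they may be replaced by smooth
extensions. -/
theorem IsLDGSolution.congr {k N : ℕ} {ε : ℝ} {b f b' f' Q U : ℝ → ℝ} {x : ℕ → ℝ}
    (h : IsLDGSolution k ε b f x N Q U) (hx : ∀ i < N, x i ≤ x (i + 1))
    (hb : ∀ i < N, ∀ y ∈ Ioo (x i) (x (i + 1)), b' y = b y)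
    (hf : ∀ i < N, ∀ y ∈ Ioo (x i) (x (i + 1)), f' y = f y) :
    IsLDGSolution k ε b' f' x N Q U where
  memQ := h.memQ
  memU := h.memU
  eqQ := h.eqQ
  eqU v hv i hi := by
    have h1 : cellInner x i (fun y => b' y * U y) v = cellInner x i (fun y => b y * U y) v :=
      integral_congr_of_eqOn_Ioo (hx i hi) fun y hy => by beta_reduce; rw [hb i hi y hy]
    have h2 : cellInner x i f' v = cellInner x i f v :=
      integral_congr_of_eqOn_Ioo (hx i hi) fun y hy => by rw [hf i hi y hy]
    rw [h1, h2]
    exact h.eqU v hv i hi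

theorem normSq_congr {N : ℕ} {x : ℕ → ℝ} (hx : ∀ i < N, x i ≤ x (i + 1)) {v w : ℝ → ℝ}
    (h : ∀ i < N, ∀ y ∈ Ioo (x i) (x (i + 1)), v y = w y) : normSq x N v = normSq x N w := by
  refine Finset.sum_congr rfl fun i hi => ?_
  have hi := Finset.mem_range.1 hi
  exact integral_congr_of_eqOn_Ioo (hx i hi) fun y hy => by rw [h i hi y hy]

/-- The two norms in terms of the four contributions, for `ε = t⁴`. -/
theorem sqrt_energy_balanced_le {t K X₁ X₂ X₃ X₄ Λ R M : ℝ} (ht : 0 < t) (ht1 : t ≤ 1) (hK : 0 < K)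
    (hΛ : 0 ≤ Λ) (hR : 0 ≤ R) (hM : 0 ≤ M) (hMΛ : M ≤ Λ)
    (h1 : ((t ^ 2) ^ 2)⁻¹ * X₁ ≤ K * (t ^ 2 * Λ ^ 2 + (t ^ 2) ^ 2 * R ^ 2))
    (h2 : X₂ ≤ K * (t ^ 2 * Λ ^ 2 + (t ^ 2) ^ 2 * R ^ 2 + M ^ 2))
    (h3 : t ^ 2 * X₃ ≤ K * (t ^ 2 * Λ ^ 2 + (t ^ 2) ^ 2 * R ^ 2))
    (h4 : (t ^ 2)⁻¹ * X₄ ≤ K * (t ^ 2 * Λ ^ 2 + (t ^ 2) ^ 2 * R ^ 2)) :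
    √(((t ^ 2) ^ 2)⁻¹ * X₁ + X₂ + t ^ 2 * X₃ + (t ^ 2)⁻¹ * X₄) ≤
      √(5 * K) * (t * Λ + t ^ 2 * R + M) ∧
    √((t ^ 6)⁻¹ * X₁ + X₂ + X₃ + ((t ^ 2) ^ 2)⁻¹ * X₄) ≤ √(5 * K) * (Λ + t * R) := by
  have hM2 : M ^ 2 ≤ Λ ^ 2 := by gcongr
  have hi : 0 < (t ^ 2)⁻¹ := by positivity
  -- Passing to the balanced norm divides three of the contributions by `e = t ^ 2`; this is the
  -- resulting rate.
  have e0 : (t ^ 2)⁻¹ * (K * (t ^ 2 * Λ ^ 2 + (t ^ 2) ^ 2 * R ^ 2)) =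
      K * (Λ ^ 2 + t ^ 2 * R ^ 2) := by field_simp
  constructor
  · refine (Real.sqrt_le_left (by positivity)).2 ?_
    rw [mul_pow, Real.sq_sqrt (by positivity)]
    have h5 : 0 ≤ K * ((t * Λ) * (t ^ 2 * R)) := by positivity
    have h6 : 0 ≤ K * ((t * Λ) * M) := by positivity
    have h7 : 0 ≤ K * ((t ^ 2 * R) * M) := by positivity
    have h8 : 0 ≤ K * (t ^ 2 * Λ ^ 2) := by positivity
    have h9 : 0 ≤ K * ((t ^ 2) ^ 2 * R ^ 2) := by positivity
    have h10 : 0 ≤ K * M ^ 2 := by positivity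
    linarith
  · refine (Real.sqrt_le_left (by positivity)).2 ?_
    rw [mul_pow, Real.sq_sqrt (by positivity)]
    have g1 : (t ^ 6)⁻¹ * X₁ ≤ K * (Λ ^ 2 + t ^ 2 * R ^ 2) := by
      rw [← e0]
      refine le_of_eq_of_le ?_ (mul_le_mul_of_nonneg_left h1 hi.le)
      field_simp
    have g3 : X₃ ≤ K * (Λ ^ 2 + t ^ 2 * R ^ 2) := by
      rw [← e0]
      refine le_of_eq_of_le ?_ (mul_le_mul_of_nonneg_left h3 hi.le)
      field_simp
    have g4 : ((t ^ 2) ^ 2)⁻¹ * X₄ ≤ K * (Λ ^ 2 + t ^ 2 * R ^ 2) := by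
      rw [← e0]
      refine le_of_eq_of_le ?_ (mul_le_mul_of_nonneg_left h4 hi.le)
      field_simp
    have ht2 : t ^ 2 ≤ 1 := pow_le_one₀ ht.le ht1
    -- This contribution is not rescaled, and `M ≤ Λ` absorbs the extra `M ^ 2`. With it `Λ ^ 2`
    -- occurs five times in total, whence `5 * K`.
    have g2 : X₂ ≤ K * (Λ ^ 2 + t ^ 2 * R ^ 2 + Λ ^ 2) := by
      refine h2.trans (mul_le_mul_of_nonneg_left ?_ hK.le)
      have i1 : t ^ 2 * Λ ^ 2 ≤ Λ ^ 2 := mul_le_of_le_one_left (sq_nonneg _) ht2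
      have i2 : (t ^ 2) ^ 2 * R ^ 2 ≤ t ^ 2 * R ^ 2 :=
        mul_le_mul_of_nonneg_right (pow_le_of_le_one (by positivity) ht2 two_ne_zero) (sq_nonneg _)
      linarith
    have h5 : 0 ≤ K * (Λ * (t * R)) := by positivity
    have h9 : 0 ≤ K * (t ^ 2 * R ^ 2) := by positivity
    linarith

end LDG

theorem theorem1 (k : ℕ) (hk : 1 ≤ k) :
    ∃ m : ℕ, ∀ (β σ C₀ : ℝ) (b f : ℝ → ℝ), 0 < β → (k : ℝ) + 1 ≤ σ → 0 < C₀ →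
      ContDiffOn ℝ m b (Set.Icc 0 1) → ContDiffOn ℝ m f (Set.Icc 0 1) →
      (∀ x ∈ Set.Icc (0 : ℝ) 1, β ^ 2 ≤ b x) →
      ∃ C : ℝ, 0 < C ∧ ∀ (ε : ℝ) (N : ℕ) (u Q U : ℝ → ℝ),
        0 < ε → ε ≤ 1 → 4 ≤ N → 4 ∣ N → ε ≤ C₀ * (N : ℝ)⁻¹ →
        LDG.transitionPoint β σ ε N ≤ 1 / 4 →
        LDG.IsSolution ε b f u →
        LDG.IsLDGSolution k ε b f (LDG.shishkinNode β σ ε N) N Q U →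
        LDG.energyNorm ε b (LDG.shishkinNode β σ ε N) N (LDG.exactFlux ε u - Q) (u - U) ≤
            C * (ε ^ (1 / 4 : ℝ) * ((N : ℝ)⁻¹ * Real.log N) ^ (k + 1)
              + ε ^ (1 / 2 : ℝ) * ((N : ℝ) ^ k)⁻¹ + ((N : ℝ) ^ (k + 1))⁻¹) ∧
          LDG.balancedNorm ε b (LDG.shishkinNode β σ ε N) N (LDG.exactFlux ε u - Q) (u - U) ≤
            C * (((N : ℝ)⁻¹ * Real.log N) ^ (k + 1) + ε ^ (1 / 4 : ℝ) * ((N : ℝ) ^ k)⁻¹) := by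
  -- The outer expansion has `k + 2` terms at two derivatives each, and its defect has to remain
  -- `C^k`.
  refine ⟨k + 2 * (k + 1 + 1), fun β σ C₀ b f hβ hσ hC₀ hb hf hbβ => ?_⟩
  obtain ⟨b', hb', hbe⟩ := LDG.exists_contDiff_extension _ b hb
  obtain ⟨f', hf', hfe⟩ := LDG.exists_contDiff_extension _ f hf
  obtain ⟨K, hK, hall⟩ := LDG.exists_error_bounds k hk hβ hσ hC₀ hb' hf' fun x hx => by
    rw [hbe x hx]; exact hbβ x hx
  refine ⟨√(5 * K), Real.sqrt_pos.2 (by positivity), ?_⟩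
  intro ε N u Q U hε hε1 hN4 hN hεN hτ hu hQU
  obtain ⟨n, rfl⟩ := hN
  have hn : 1 ≤ n := by omega
  -- In terms of `t` all powers of `ε` have integer exponents, with `e = t ^ 2`.
  obtain ⟨t, ht⟩ : ∃ t, t = ε ^ (1 / 4 : ℝ) := ⟨_, rfl⟩
  have ht0 : 0 < t := ht ▸ Real.rpow_pos_of_pos hε _
  have ht1 : t ≤ 1 := ht ▸ Real.rpow_le_one hε.le hε1 (by norm_num)
  have ht2 : ε ^ (1 / 2 : ℝ) = t ^ 2 := by
    rw [ht, ← Real.rpow_natCast, ← Real.rpow_mul hε.le]; norm_num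
  have ht4 : ε = (t ^ 2) ^ 2 := by
    rw [← ht2, ← Real.rpow_natCast, ← Real.rpow_mul hε.le]; norm_num
  have ht6 : ε ^ (-(3 / 2) : ℝ) = (t ^ 6)⁻¹ := by
    rw [ht, ← Real.rpow_natCast, ← Real.rpow_mul hε.le, ← Real.rpow_neg hε.le]; norm_num
  have hsq : √ε = t ^ 2 := by rw [ht4, Real.sqrt_sq (by positivity)]
  have hσ0 : 0 < σ := lt_of_lt_of_le (by positivity) hσ
  have hn0 : (0 : ℝ) < n := by positivity
  have hlog := LDG.one_le_log_natCast hN4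
  have hτ0 : 0 < LDG.transitionPoint β σ ε (4 * n) := by
    rw [LDG.transitionPoint, hsq]; positivity
  unfold LDG.energyNorm LDG.balancedNorm
  rw [ht6, hsq, ht2, ← ht]
  rw [ht4] at hεN hτ hτ0 hu hQU ⊢
  obtain ⟨x, hx⟩ : ∃ x, x = LDG.shishkinNode β σ ((t ^ 2) ^ 2) (4 * n) := ⟨_, rfl⟩
  have he : 0 < t ^ 2 := by positivity
  have hlt : ∀ i < 4 * n, x i ≤ x (i + 1) := fun i _ => by
    rw [hx]; exact (LDG.shishkinNode_lt he hn hτ0 hτ i).le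
  have hcell : ∀ i < 4 * n, ∀ y ∈ Set.Ioo (x i) (x (i + 1)), y ∈ Set.Icc (0 : ℝ) 1 :=
    fun i hi y hy => by
      rw [hx] at hy
      exact LDG.shishkin_cell_subset he hn hτ0 hτ hi (Set.Ioo_subset_Icc_self hy)
  rw [← hx] at hQU ⊢
  obtain ⟨r1, r2, r3, r4⟩ := hall (t ^ 2) n u Q U he (pow_le_one₀ ht0.le ht1) hn hεN hτ
    (hu.congr hbe hfe) x hx (hQU.congr hlt (fun i hi y hy => hbe y (hcell i hi y hy))
      fun i hi y hy => hfe y (hcell i hi y hy)) _ rfl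
  rw [LDG.normSq_congr hlt (w := fun y => √(b y) * (u - U) y) fun i hi y hy => by
    rw [hbe y (hcell i hi y hy)]] at r2
  refine LDG.sqrt_energy_balanced_le ht0 ht1 hK (by positivity) (by positivity) (by positivity) ?_
    r1 r2 r3 r4
  rw [mul_pow, inv_pow]
  exact le_mul_of_one_le_right (by positivity) (one_le_pow₀ hlog)
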